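/- Let $d$ be odd and $N\ge 1$. Let $\Omega$ be a compact space with an action $T$ of $\mathbb Z^d$ by homeomorphisms and an invariant ergodic Borel probability measure $\mathbf P$, and let $\wedge$ be a real-valued antisymmetric bilinear form on $\mathbb Z^d$. For $M_N(\mathbb C)$-valued functions $f,g$ on $\Omega\times\mathbb Z^d$ put $$(fg)(\omega,x)=\sum_{y\in\mathbb Z^d}e^{i\,x\wedge y}f(\omega,y)\,g(T_y^{-1}\omega,x-y),\qquad (\pi_\omega(f)\psi)(x)=\sum_{y\in\mathbb Z^d}e^{i\,y\wedge x}f(T_x^{-1}\omega,y-x)\psi(y)$$ for $\psi\in\ell^2(\mathbb Z^d,\mathbb C^N)$, so that $f(\omega,x)=\langle 0|\pi_\omega(f)|x\rangle$, and $$\mathcal T(f)=\int_\Omega\mathbf P(d\omega)\,\mathrm{Tr}\,f(\omega,0),\qquad (\partial_jf)(\omega,x)=-i\,x_jf(\omega,x),$$ so that $\pi_\omega(\partial_jf)=i[X_j,\pi_\omega(f)]$, where $X_j$ is the $j$-th position operator. Let $\mathcal A_{\rm loc}$ be the set of measurable $f$ such that $\mathbf P\text{-}\operatorname{ess\,sup}_\omega\|\pi_\omega(f)\|<\infty$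 and $\int_\Omega\mathbf P(d\omega)\,\|f(\omega,x)\|\le A\,e^{-\lambda|x|}$ for all $x\in\mathbb Z^d$, for some $A,\lambda>0$. Let $\sigma_1,\dots,\sigma_d$ be self-adjoint matrices of size $2^{(d-1)/2}$ with $\sigma_i\sigma_j+\sigma_j\sigma_i=2\delta_{ij}$ and $\sigma_1\cdots\sigma_d=(-i)^{(d-1)/2}\mathbf 1$. For $x_0\in[0,1]^d$ let $F_{x_0}=D_{x_0}/|D_{x_0}|$ be the phase of $D_{x_0}=\sum_{j}(X_j+x_{0,j})\otimes\sigma_j$ on $\ell^2(\mathbb Z^d,\mathbb C^N)\otimes\mathbb C^{2^{(d-1)/2}}$ (with $D_{x_0}$ replaced by the identity at the site $x=-x_0$, if $x_0\in\mathbb Z^d$), write $\pi_\omega$ also for $\pi_\omega\otimes\mathrm{id}$, and for $\eta=\pi_\omega(f_0)[F_{x_0},\pi_\omega(f_1)]\cdots[F_{x_0},\pi_\omega(f_d)]$ put $\mathrm{Tr}'(\eta)=\tfrac12\mathrm{Tr}\bigl(F_{x_0}(F_{x_0}\eta-(-1)^d\eta F_{x_0})\bigr)$. Let $$\tau_d(f_0,\dots,f_d)=2^{-d}\,i^{d+1}\int_{[0,1]^d}dx_0\int_\Omega\mathbf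 P(d\omega)\,\mathrm{Tr}'\bigl(\pi_\omega(f_0)[F_{x_0},\pi_\omega(f_1)]\cdots[F_{x_0},\pi_\omega(f_d)]\bigr).$$ Then for all $f_0,\dots,f_d\in\mathcal A_{\rm loc}$ both sides of the following formula are well defined (for almost every $(x_0,\omega)$ the operator under the trace is trace class, $\mathrm{Tr}'(\eta)$ is integrable in $(x_0,\omega)$, and the integrals defining $\mathcal T$ converge absolutely), and $$\tau_d(f_0,\dots,f_d)=\Lambda_d\sum_{\rho\in S_d}\mathrm{sgn}(\rho)\,\mathcal T\bigl(f_0\,\partial_{\rho_1}f_1\cdots\partial_{\rho_d}f_d\bigr),\qquad \Lambda_d=\frac{i\,(-i\pi)^{(d-1)/2}}{d!!}.$$ -/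

import Mathlib

open MeasureTheory Complex
open scoped Kronecker Nat

namespace OddChern

/-- The lattice `ℤ^d`. -/
abbrev Lattice (d : ℕ) : Type := Fin d → ℤ

/-- The inclusion `ℤ^d ⊆ ℝ^d` shifted by `x₀`: the Euclidean vector `x + x₀`. -/
noncomputable def shiftVec {d : ℕ} (x₀ : Fin d → ℝ) (x : Lattice d) : EuclideanSpace ℝ (Fin d) :=
  WithLp.toLp 2 (fun j => (x j : ℝ) + x₀ j)

/-- The Hilbert space `ℓ²(ℤ^d, ℂ^ι)` with fiber `ℂ^ι`. For `ι = Fin N` this is `ℓ²(ℤ^d, ℂ^N)`; for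
`ι = Fin N × Fin d'` it is `ℓ²(ℤ^d, ℂ^N) ⊗ ℂ^d'`. -/
abbrev Hil (d : ℕ) (ι : Type) [Fintype ι] : Type :=
  lp (fun _ : Lattice d => EuclideanSpace ℂ ι) 2

/-- The absolute value `|A| = (A^* A)^{1/2}` of a bounded operator on a Hilbert space. -/
noncomputable def opAbs {E : Type*} [NormedAddCommGroup E] [InnerProductSpace ℂ E] [CompleteSpace E]
    (A : E →L[ℂ] E) : E →L[ℂ] E :=
  CFC.abs A

section Operators

variable {d : ℕ} {ι : Type} [Fintype ι] [DecidableEq ι]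

/-- `A` is the bounded operator with matrix kernel `k`:
`(A ψ)(x) = ∑_y k(x,y) ψ(y)` for all `ψ` and `x`. -/
def IsKernelOp (k : Lattice d → Lattice d → Matrix ι ι ℂ) (A : Hil d ι →L[ℂ] Hil d ι) : Prop :=
  ∀ (ψ : Hil d ι) (x : Lattice d),
    HasSum (fun y => Matrix.toEuclideanCLM (𝕜 := ℂ) (k x y) (ψ y)) (A ψ x)

theorem IsKernelOp.unique {k : Lattice d → Lattice d → Matrix ι ι ℂ}
    {A B : Hil d ι →L[ℂ] Hil d ι} (hA : IsKernelOp k A) (hB : IsKernelOp k B) : A = B := by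
  refine ContinuousLinearMap.ext fun ψ => ?_
  ext1
  funext x
  exact (hA ψ x).unique (hB ψ x)

open Classical in
/-- The bounded operator with kernel `k` (and `0` if `k` is not the kernel of a bounded
operator). -/
noncomputable def kernelOp (k : Lattice d → Lattice d → Matrix ι ι ℂ) :
    Hil d ι →L[ℂ] Hil d ι :=
  if h : ∃ A, IsKernelOp k A then h.choose else 0

/-- The standard orthonormal basis vector `|x, i⟩`. -/
noncomputable def ket (p : Lattice d × ι) : Hil d ι :=
  lp.single 2 p.1 (EuclideanSpace.single p.2 (1 : ℂ))

/-- Trace class operators: `∑ ⟨e, |A| e⟩ < ∞`, where `|A| = (A^* A)^{1/2}`. -/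
def IsTraceClass (A : Hil d ι →L[ℂ] Hil d ι) : Prop :=
  Summable fun p : Lattice d × ι => (inner ℂ (ket p) (opAbs A (ket p))).re

/-- The trace of a (trace class) operator. -/
noncomputable def opTrace (A : Hil d ι →L[ℂ] Hil d ι) : ℂ :=
  ∑' p : Lattice d × ι, inner ℂ (ket p) (A (ket p))

/-- The differential `dη = F η - (-1)^k η F` of a form `η` of degree `k`. -/
noncomputable def qDiff (F : Hil d ι →L[ℂ] Hil d ι) (k : ℕ) (η : Hil d ι →L[ℂ] Hil d ι) :
    Hil d ι →L[ℂ] Hil d ι :=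
  F * η - ((-1 : ℂ) ^ k) • (η * F)

/-- The graded trace `Tr'(η) = ½ Tr(F dη)` of a form `η` of top degree `d`. -/
noncomputable def gradedTrace (F η : Hil d ι →L[ℂ] Hil d ι) : ℂ :=
  (1 / 2 : ℂ) * opTrace (F * qDiff F d η)

end Operators

/-- Symbols of covariant families: matrix valued functions on `Ω × ℤ^d`. -/
abbrev Symbol (Ω : Type*) (d N : ℕ) : Type _ := Ω → Lattice d → Matrix (Fin N) (Fin N) ℂ

section Observables

variable {Ω : Type*} {d N : ℕ} [AddAction (Lattice d) Ω]

/-- The twisted convolution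
`(fg)(ω,x) = ∑_y e^{i x∧y} f(ω,y) g(T_y⁻¹ω, x-y)`, where `T_a ω = a +ᵥ ω`. -/
noncomputable def symbolMul (w : Lattice d →ₗ[ℤ] Lattice d →ₗ[ℤ] ℝ) (f g : Symbol Ω d N) :
    Symbol Ω d N :=
  fun ω x => ∑' y : Lattice d, cexp (I * (w x y : ℂ)) • (f ω y * g (-y +ᵥ ω) (x - y))

/-- The kernel of the representation `π_ω(f)`:
`⟨x|π_ω(f)|y⟩ = e^{i y∧x} f(T_x⁻¹ω, y-x)`. With the twisted convolution above, `π_ω` is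
multiplicative, it is covariant under the magnetic translations
`(V_a ψ)(x) = e^{i a∧x} ψ(x-a)`, and `⟨0|π_ω(f)|x⟩ = f(ω,x)`. -/
noncomputable def covKernel (w : Lattice d →ₗ[ℤ] Lattice d →ₗ[ℤ] ℝ) (f : Symbol Ω d N) (ω : Ω) :
    Lattice d → Lattice d → Matrix (Fin N) (Fin N) ℂ :=
  fun x y => cexp (I * (w y x : ℂ)) • f (-x +ᵥ ω) (y - x)

/-- The derivation `∂_j`, for which `π_ω(∂_j f) = i [X_j, π_ω(f)]`; as the symbol of an operator is
`f(ω,x) = ⟨0|π_ω(f)|x⟩`, this is `(∂_j f)(ω,x) = -i x_j f(ω,x)`. -/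
noncomputable def symbolDeriv (j : Fin d) (f : Symbol Ω d N) : Symbol Ω d N :=
  fun ω x => (-I * (x j : ℂ)) • f ω x

theorem covKernel_symbolDeriv (w : Lattice d →ₗ[ℤ] Lattice d →ₗ[ℤ] ℝ) (j : Fin d) (f : Symbol Ω d N)
    (ω : Ω) (x y : Lattice d) :
    covKernel w (symbolDeriv j f) ω x y
      = I • ((x j : ℂ) • covKernel w f ω x y - (y j : ℂ) • covKernel w f ω x y) := by
  ext a b
  simp [covKernel, symbolDeriv]
  ring

variable [MeasurableSpace Ω]

/-- The trace per unit volume `𝒯(f) = ∫ P(dω) Tr f(ω,0)`. -/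
noncomputable def traceVol (P : Measure Ω) (f : Symbol Ω d N) : ℂ :=
  ∫ ω, (f ω 0).trace ∂P

/-- Membership in the von Neumann algebra `L^∞(𝒜, P)`: measurable symbols for which
`P-esssup ‖π_ω(f)‖ < ∞`. -/
structure IsEssBounded (P : Measure Ω) (w : Lattice d →ₗ[ℤ] Lattice d →ₗ[ℤ] ℝ)
    (f : Symbol Ω d N) : Prop where
  aemeasurable : ∀ x a b, AEMeasurable (fun ω => f ω x a b) P
  bounded : ∃ C : ℝ, ∀ᵐ ω ∂P, ∃ A : Hil d (Fin N) →L[ℂ] Hil d (Fin N),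
    IsKernelOp (covKernel w f ω) A ∧ ‖A‖ ≤ C

/-- Membership in the algebra `𝒜_loc` of localized observables: elements of `L^∞(𝒜, P)` with
`∫ P(dω) ‖f(ω,x)‖ ≤ A e^{-λ|x|}` for some `A, λ > 0`. -/
structure IsLocalized (P : Measure Ω) (w : Lattice d →ₗ[ℤ] Lattice d →ₗ[ℤ] ℝ)
    (f : Symbol Ω d N) : Prop where
  essBounded : IsEssBounded P w f
  decay : ∃ A > (0 : ℝ), ∃ l > (0 : ℝ), ∀ x : Lattice d,
    ∫ ω, ‖Matrix.toEuclideanCLM (𝕜 := ℂ) (f ω x)‖ ∂P ≤ A * Real.exp (-l * ‖shiftVec 0 x‖)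

end Observables

/-- The index set of a basis of `Cliff(d) = ℂ^{d'}`, `d' = 2^{(d-1)/2}`. -/
abbrev CliffIdx (d : ℕ) : Type := Fin (2 ^ ((d - 1) / 2))

/-- Self-adjoint generators `σ_1, …, σ_d` of an irreducible representation on `ℂ^{d'}` of the odd
complex Clifford algebra, with the orientation `σ_1 ⋯ σ_d = (-i)^{(d-1)/2}`. Irreducibility is
automatic, by the dimension of the representation space. -/
structure IsCliffordRep {d : ℕ} (σ : Fin d → Matrix (CliffIdx d) (CliffIdx d) ℂ) : Prop where
  hermitian : ∀ j, (σ j).IsHermitian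
  anticomm : ∀ i j, σ i * σ j + σ j * σ i = if i = j then 2 else 0
  orientation : (List.ofFn σ).prod = ((-I) ^ ((d - 1) / 2)) • (1 : Matrix _ _ ℂ)

section Cocycle

variable {d : ℕ}

/-- The fiber at `x` of the Dirac phase `F_{x₀} = D_{x₀}/|D_{x₀}|`, where
`D_{x₀} = ∑_j (X_j + x_{0,j}) ⊗ σ_j`, so that `|D_{x₀}| = |X + x₀|`. On the zero mode at `x = -x₀`,
if there is one, `D_{x₀}` and hence the phase is replaced by the identity. -/
noncomputable def phaseFiber (σ : Fin d → Matrix (CliffIdx d) (CliffIdx d) ℂ) (x₀ : Fin d → ℝ)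
    (x : Lattice d) : Matrix (CliffIdx d) (CliffIdx d) ℂ :=
  open Classical in
  if shiftVec x₀ x = 0 then 1
  else ((‖shiftVec x₀ x‖⁻¹ : ℝ) : ℂ) • ∑ j, ((shiftVec x₀ x j : ℝ) : ℂ) • σ j

/-- The Dirac phase `F_{x₀}` on `ℓ²(ℤ^d, ℂ^N) ⊗ Cliff(d)`. -/
noncomputable def diracPhase (N : ℕ) (σ : Fin d → Matrix (CliffIdx d) (CliffIdx d) ℂ)
    (x₀ : Fin d → ℝ) : Hil d (Fin N × CliffIdx d) →L[ℂ] Hil d (Fin N × CliffIdx d) :=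
  kernelOp fun x y =>
    if x = y then (1 : Matrix (Fin N) (Fin N) ℂ) ⊗ₖ phaseFiber σ x₀ x else 0

variable {Ω : Type*} {N : ℕ} [AddAction (Lattice d) Ω]

/-- The representation `π_ω ⊗ id` on `ℓ²(ℤ^d, ℂ^N) ⊗ Cliff(d)`. -/
noncomputable def rep (w : Lattice d →ₗ[ℤ] Lattice d →ₗ[ℤ] ℝ) (ω : Ω) (f : Symbol Ω d N) :
    Hil d (Fin N × CliffIdx d) →L[ℂ] Hil d (Fin N × CliffIdx d) :=
  kernelOp fun x y => covKernel w f ω x y ⊗ₖ (1 : Matrix (CliffIdx d) (CliffIdx d) ℂ)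

/-- The form `π_ω(f_0) [F_{x₀}, π_ω(f_1)] ⋯ [F_{x₀}, π_ω(f_d)]` of degree `d`. -/
noncomputable def topForm (w : Lattice d →ₗ[ℤ] Lattice d →ₗ[ℤ] ℝ)
    (σ : Fin d → Matrix (CliffIdx d) (CliffIdx d) ℂ) (f : Fin (d + 1) → Symbol Ω d N)
    (x₀ : Fin d → ℝ) (ω : Ω) :
    Hil d (Fin N × CliffIdx d) →L[ℂ] Hil d (Fin N × CliffIdx d) :=
  rep w ω (f 0) * (List.ofFn fun i : Fin d =>
    diracPhase N σ x₀ * rep w ω (f i.succ) - rep w ω (f i.succ) * diracPhase N σ x₀).prod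

/-- The constant `λ_d = 2^{-d} i^{d+1}`. -/
noncomputable def lambdaConst (d : ℕ) : ℂ := (2 ^ d : ℂ)⁻¹ * I ^ (d + 1)

/-- The averaged cyclic cocycle
`τ_d(f_0,…,f_d) = λ_d ∫_{[0,1]^d} dx₀ ∫_Ω P(dω) Tr'(π_ω(f_0)[F_{x₀},π_ω(f_1)]⋯[F_{x₀},π_ω(f_d)])`. -/
noncomputable def cocycle [MeasurableSpace Ω] (P : Measure Ω)
    (w : Lattice d →ₗ[ℤ] Lattice d →ₗ[ℤ] ℝ)
    (σ : Fin d → Matrix (CliffIdx d) (CliffIdx d) ℂ) (f : Fin (d + 1) → Symbol Ω d N) : ℂ :=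
  lambdaConst d * ∫ x₀ in Set.Icc (0 : Fin d → ℝ) 1,
    ∫ ω, gradedTrace (diracPhase N σ x₀) (topForm w σ f x₀ ω) ∂P

/-- The product `f_0 ∂_{ρ_1}f_1 ⋯ ∂_{ρ_d}f_d`. -/
noncomputable def derivProd (w : Lattice d →ₗ[ℤ] Lattice d →ₗ[ℤ] ℝ)
    (f : Fin (d + 1) → Symbol Ω d N) (ρ : Equiv.Perm (Fin d)) : Symbol Ω d N :=
  (List.ofFn fun i : Fin d => symbolDeriv (ρ i) (f i.succ)).foldl (symbolMul w) (f 0)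

/-- The constant `Λ_d = i (-iπ)^{(d-1)/2} / d!!` (for odd `d`). -/
noncomputable def LambdaConst (d : ℕ) : ℂ :=
  I * (-I * (Real.pi : ℂ)) ^ ((d - 1) / 2) / (d‼ : ℂ)

end Cocycle

end OddChern

/-! Write û for Clifford multiplication by u, and u_x for the unit vector in the direction x + x₀.
The commutator of the phase with A has matrix elements a(x,y) ⊗ (û_x - û_y). Expanding Tr' over
closed paths z_0, …, z_d therefore splits each loop into a product of matrix elements, free of x₀,
and a Clifford trace. The trace is an alternating form of top degree, hence a constant times det(u_i
- u_{i+1}), the volume of an inscribed simplex (`trace_prod_cliff`, `gradedTrace_formOp`).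
Translating a loop only shifts ω, because the magnetic phases cancel around it (`loopProd_add`).
After averaging over ω, the sum over translates of a loop and the mean over x₀ in the unit cube thus
combine into one integral over ℝ^d.

That integral is the volume of the unit ball times the determinant of the edges z_i - z_{i+1}
(`integral_simplexDet_unitVec`). Indeed the determinant is an alternating sum over faces. Replacing
radial projection by nearest point projection to the ball changes each face term by a function of
bounded support which, after a translation, is odd under a reflection; so the integral does not
change. The radial integral scales exactly like t^d when the simplex is shrunk by t, while the ball
version divided by t^d tends to the edge determinant inside the ball and to 0 outside. Leibniz
expansion of the edge determinant gives the signed sum of products of derivations, which expand over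
the same loops (`IsUniformlyLocalized.hasSum_traceVol`).

Convergence rests on a gain for odd d: the inscribed simplex is small to order d + 1 in its edges,
not just d (`exists_abs_stdDet_sub_le`). As u_x varies at rate 1/|x|, this yields |x|^{-(d+1)},
summable over ℤ^d. For operators the same exponent appears because F dη is F times a product of d +
1 commutators (`mul_qDiff_eq`). Decay in expectation suffices since the matrix elements are bounded:
the longest step of a path controls all the others (`integral_prod_le_exp`). -/

namespace OddChern

/-! ### Clifford traces as determinants -/

section Clifford

variable {d : ℕ}

/-- The determinant of `d` vectors of `ℝ^d`. -/
noncomputable abbrev stdDet (d : ℕ) :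
    EuclideanSpace ℝ (Fin d) [⋀^Fin d]→ₗ[ℝ] ℝ :=
  (EuclideanSpace.basisFun (Fin d) ℝ).toBasis.det

/-- Clifford multiplication by a vector of `ℝ^d`. -/
noncomputable def cliff (σ : Fin d → Matrix (CliffIdx d) (CliffIdx d) ℂ) :
    EuclideanSpace ℝ (Fin d) →ₗ[ℝ] Matrix (CliffIdx d) (CliffIdx d) ℂ where
  toFun v := ∑ j, ((v j : ℝ) : ℂ) • σ j
  map_add' v w := by simp [add_smul, Finset.sum_add_distrib]
  map_smul' r v := by
    simp only [PiLp.smul_apply, smul_eq_mul, ofReal_mul, mul_smul, RingHom.id_apply,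
      Finset.smul_sum]
    rfl

theorem cliff_apply (σ : Fin d → Matrix (CliffIdx d) (CliffIdx d) ℂ)
    (v : EuclideanSpace ℝ (Fin d)) : cliff σ v = ∑ j, ((v j : ℝ) : ℂ) • σ j := rfl

theorem cliff_basisFun (σ : Fin d → Matrix (CliffIdx d) (CliffIdx d) ℂ) (i : Fin d) :
    cliff σ (EuclideanSpace.basisFun (Fin d) ℝ i) = σ i := by
  rw [cliff_apply, Finset.sum_eq_single i]
  · simp
  · intro j _ hj
    simp [hj]
  · simp

variable {σ : Fin d → Matrix (CliffIdx d) (CliffIdx d) ℂ} (hσ : IsCliffordRep σ)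

include hσ in
theorem cliff_mul_add_mul (v w : EuclideanSpace ℝ (Fin d)) :
    cliff σ v * cliff σ w + cliff σ w * cliff σ v
      = ((2 * inner ℝ v w : ℝ) : ℂ) • (1 : Matrix (CliffIdx d) (CliffIdx d) ℂ) := by
  have h1 : cliff σ v * cliff σ w + cliff σ w * cliff σ v
      = ∑ i, ∑ j, ((v i : ℂ) * (w j : ℂ)) • (σ i * σ j + σ j * σ i) := by
    simp only [cliff_apply, Finset.sum_mul, Finset.mul_sum, smul_mul_smul_comm, smul_add,
      Finset.sum_add_distrib]
    congr 1
    rw [Finset.sum_comm]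
    refine Finset.sum_congr rfl fun i _ => Finset.sum_congr rfl fun j _ => ?_
    rw [mul_comm]
  rw [h1]
  simp only [hσ.anticomm, smul_ite, smul_zero, Finset.sum_ite_eq, Finset.mem_univ, if_true]
  rw [← Finset.sum_smul, show (2 : Matrix (CliffIdx d) (CliffIdx d) ℂ) = (2 : ℂ) • 1 by
    rw [← Algebra.algebraMap_eq_smul_one, map_ofNat], smul_smul]
  congr 1
  simp [PiLp.inner_apply, mul_comm]

include hσ in
theorem cliff_mul_self (v : EuclideanSpace ℝ (Fin d)) :
    cliff σ v * cliff σ v = ((‖v‖ ^ 2 : ℝ) : ℂ) • (1 : Matrix (CliffIdx d) (CliffIdx d) ℂ) := by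
  have h := cliff_mul_add_mul hσ v v
  rw [← two_smul ℂ (cliff σ v * cliff σ v), real_inner_self_eq_norm_sq, ofReal_mul, mul_smul,
    ofReal_ofNat] at h
  exact smul_right_injective _ (two_ne_zero (α := ℂ)) h

include hσ in
theorem cliff_mul_prod_of_orthogonal (n : EuclideanSpace ℝ (Fin d))
    (l : List (EuclideanSpace ℝ (Fin d))) (h : ∀ v ∈ l, inner ℝ n v = 0) :
    cliff σ n * (l.map (cliff σ)).prod
      = ((-1 : ℂ) ^ l.length) • ((l.map (cliff σ)).prod * cliff σ n) := by
  induction l with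
  | nil => simp
  | cons v l ih =>
    have h1 := cliff_mul_add_mul hσ n v
    rw [h v (by simp), mul_zero, ofReal_zero, zero_smul] at h1
    rw [List.map_cons, List.prod_cons, ← mul_assoc, eq_neg_of_add_eq_zero_left h1, neg_mul,
      mul_assoc, ih fun w hw => h w (by simp [hw]), List.length_cons, pow_succ, mul_smul_comm,
      mul_neg_one, neg_smul, mul_assoc]

include hσ in
-- The element n̂ anticommutes with the product A of an odd number of factors. Hence tr(n̂ n̂ A) =
-- -tr(n̂ A n̂), cyclicity gives the opposite sign, and n̂² is a nonzero scalar.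
theorem trace_prod_eq_zero_of_orthogonal {n : EuclideanSpace ℝ (Fin d)} (hn : n ≠ 0)
    {l : List (EuclideanSpace ℝ (Fin d))} (hl : Odd l.length) (h : ∀ v ∈ l, inner ℝ n v = 0) :
    ((l.map (cliff σ)).prod).trace = 0 := by
  have h1 := cliff_mul_prod_of_orthogonal hσ n l h
  rw [hl.neg_one_pow, neg_one_smul] at h1
  have h2 := congrArg (fun A => (cliff σ n * A).trace) h1
  simp only [mul_neg, Matrix.trace_neg] at h2
  rw [← mul_assoc, cliff_mul_self hσ, ← mul_assoc, Matrix.trace_mul_comm (cliff σ n * _), ← mul_assoc,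
    cliff_mul_self hσ, smul_mul_assoc, one_mul, Matrix.trace_smul, smul_eq_mul,
    self_eq_neg, mul_eq_zero] at h2
  exact h2.resolve_left (by simpa using hn)

theorem exists_orthogonal_of_card_lt {s : Finset (EuclideanSpace ℝ (Fin d))} (hs : s.card < d) :
    ∃ n : EuclideanSpace ℝ (Fin d), n ≠ 0 ∧ ∀ v ∈ s, inner ℝ n v = 0 := by
  have h1 : Module.finrank ℝ (Submodule.span ℝ (s : Set (EuclideanSpace ℝ (Fin d)))) < d :=
    (finrank_span_finset_le_card s).trans_lt hs
  have h2 : Submodule.span ℝ (s : Set (EuclideanSpace ℝ (Fin d))) ≠ ⊤ := by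
    intro h
    rw [h, finrank_top, finrank_euclideanSpace, Fintype.card_fin] at h1
    exact lt_irrefl _ h1
  obtain ⟨n, hn, hn0⟩ := Submodule.exists_mem_ne_zero_of_ne_bot
    (mt Submodule.orthogonal_eq_bot_iff.mp h2)
  exact ⟨n, hn0, fun v hv => Submodule.inner_left_of_mem_orthogonal (Submodule.subset_span hv) hn⟩

include hσ in
theorem trace_prod_eq_zero_of_length_lt {l : List (EuclideanSpace ℝ (Fin d))}
    (hl : Odd l.length) (hd : l.length < d) : ((l.map (cliff σ)).prod).trace = 0 := by
  classical
  obtain ⟨n, hn, h⟩ := exists_orthogonal_of_card_lt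
    ((List.toFinset_card_le l).trans_lt hd)
  exact trace_prod_eq_zero_of_orthogonal hσ hn hl fun v hv => h v (by simpa using hv)

include hσ in
-- Anticommuting brings the two copies of a together, where their product is a scalar. Each
-- correction is a scalar times a product of d - 2 factors, an odd number below d, whose trace
-- vanishes.
theorem trace_prod_eq_zero_of_repeat (hd : Odd d) (a : EuclideanSpace ℝ (Fin d))
    (l₁ l₂ l₃ : List (EuclideanSpace ℝ (Fin d)))
    (hl : (l₁ ++ a :: (l₂ ++ a :: l₃)).length = d) :
    (((l₁ ++ a :: (l₂ ++ a :: l₃)).map (cliff σ)).prod).trace = 0 := by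
  have hodd : ∀ l : List (EuclideanSpace ℝ (Fin d)), l.length + 2 = d →
      ((l.map (cliff σ)).prod).trace = 0 := fun l h =>
    trace_prod_eq_zero_of_length_lt hσ (by rw [← h] at hd; simpa [Nat.odd_add] using hd) (by omega)
  induction l₂ generalizing l₁ with
  | nil =>
    have h := hodd (l₁ ++ l₃) (by simp at hl ⊢; omega)
    simp only [List.map_append, List.prod_append, List.nil_append, List.map_cons,
      List.prod_cons] at h ⊢
    rw [← mul_assoc (cliff σ a), cliff_mul_self hσ, smul_one_mul, mul_smul_comm, Matrix.trace_smul,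
      h, smul_zero]
  | cons b l₂ ih =>
    have h := hodd (l₁ ++ (l₂ ++ a :: l₃)) (by simp at hl ⊢; omega)
    have h2 := ih (l₁ ++ [b]) (by simp at hl ⊢; omega)
    simp only [List.map_append, List.prod_append, List.map_cons, List.cons_append,
      List.prod_cons, List.map_nil, List.prod_nil, mul_one] at h h2 ⊢
    rw [← mul_assoc (cliff σ a), eq_sub_of_add_eq (cliff_mul_add_mul hσ a b), sub_mul,
      smul_one_mul, mul_sub, mul_smul_comm, Matrix.trace_sub, Matrix.trace_smul, h, smul_zero,
      zero_sub, neg_eq_zero]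
    simpa only [mul_assoc] using h2

theorem _root_.List.Duplicate.exists_append {α : Type*} {a : α} {l : List α} (h : l.Duplicate a) :
    ∃ l₁ l₂ l₃, l = l₁ ++ a :: (l₂ ++ a :: l₃) := by
  induction h with
  | cons_mem h =>
    obtain ⟨s, t, rfl⟩ := List.append_of_mem h
    exact ⟨[], s, t, rfl⟩
  | @cons_duplicate b l h ih =>
    obtain ⟨l₁, l₂, l₃, rfl⟩ := ih
    exact ⟨b :: l₁, l₂, l₃, rfl⟩

/-- The alternating form `w ↦ tr(ŵ_1 ⋯ ŵ_d)`. -/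
noncomputable def cliffTrace (hd : Odd d) : EuclideanSpace ℝ (Fin d) [⋀^Fin d]→ₗ[ℝ] ℂ where
  __ := ((Matrix.traceLinearMap (CliffIdx d) ℝ ℂ).compMultilinearMap
    (MultilinearMap.mkPiAlgebraFin ℝ d (Matrix (CliffIdx d) (CliffIdx d) ℂ))).compLinearMap
      fun _ => cliff σ
  map_eq_zero_of_eq' v i j hv hij := by
    have h1 : ¬ (List.ofFn v).Nodup := by
      rw [List.nodup_ofFn]
      exact fun h => hij (h hv)
    obtain ⟨a, ha⟩ := List.exists_duplicate_iff_not_nodup.mpr h1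
    obtain ⟨l₁, l₂, l₃, hl⟩ := ha.exists_append
    have h2 := trace_prod_eq_zero_of_repeat hσ hd a l₁ l₂ l₃ (by rw [← hl]; simp)
    rw [← hl, List.map_ofFn] at h2
    simpa [Function.comp_def] using h2

/-- The constant `tr(σ_1 ⋯ σ_d)`. -/
noncomputable def cliffConst (d : ℕ) : ℂ := (-I) ^ ((d - 1) / 2) * 2 ^ ((d - 1) / 2)

theorem cliffConst_ne_zero (d : ℕ) : cliffConst d ≠ 0 := by
  simp [cliffConst]

include hσ in
-- Alternating forms of top degree are unique up to a scalar, which the orientation of the σ_j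
-- fixes.
theorem trace_prod_cliff (hd : Odd d) (w : Fin d → EuclideanSpace ℝ (Fin d)) :
    ((List.ofFn fun i => cliff σ (w i)).prod).trace = cliffConst d * (stdDet d w : ℂ) := by
  have h0 : cliffTrace hσ hd w = ((List.ofFn fun i => cliff σ (w i)).prod).trace := by
    simp [cliffTrace]
  have hb : cliffTrace hσ hd (EuclideanSpace.basisFun (Fin d) ℝ).toBasis = cliffConst d := by
    have : cliffTrace hσ hd (EuclideanSpace.basisFun (Fin d) ℝ).toBasis
        = ((List.ofFn σ).prod).trace := by
      simp [cliffTrace, cliff_basisFun, -EuclideanSpace.basisFun_apply]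
    rw [this, hσ.orientation, Matrix.trace_smul]
    simp [cliffConst]
  -- Uniqueness is available for real valued forms, so real and imaginary parts are treated
  -- separately.
  have hre := congrArg (fun f => f w) (AlternatingMap.eq_smul_basis_det
    (EuclideanSpace.basisFun (Fin d) ℝ).toBasis (reLm.compAlternatingMap (cliffTrace hσ hd)))
  have him := congrArg (fun f => f w) (AlternatingMap.eq_smul_basis_det
    (EuclideanSpace.basisFun (Fin d) ℝ).toBasis (imLm.compAlternatingMap (cliffTrace hσ hd)))
  simp only [LinearMap.compAlternatingMap_apply, AlternatingMap.smul_apply, hb,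
    smul_eq_mul] at hre him
  rw [← h0]
  apply Complex.ext
  · simpa using hre
  · simpa using him

include hσ in
/-- For unit vectors `û_0, …, û_n` with `n` odd,
`tr(û_0 (û_0 - û_1) ⋯ (û_{n-1} - û_n) (û_n - û_0)) = -2 tr((û_0 - û_1) ⋯ (û_{n-1} - û_n))`. -/
theorem trace_unit_mul_prod_sub {n : ℕ} (hn : Odd n) (u : Fin (n + 1) → EuclideanSpace ℝ (Fin d))
    (hu : ∀ i, ‖u i‖ = 1) :
    (cliff σ (u 0) * (List.ofFn fun i : Fin n => cliff σ (u i.castSucc - u i.succ)).prod *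
        cliff σ (u (Fin.last n) - u 0)).trace
      = -2 * ((List.ofFn fun i : Fin n => cliff σ (u i.castSucc - u i.succ)).prod).trace := by
  have hsq : ∀ i, cliff σ (u i) * cliff σ (u i) = 1 := fun i => by
    rw [cliff_mul_self hσ, hu]; simp
  -- For unit vectors û(û - v̂) = -(û - v̂)v̂, so û_0 passes through the chain, each factor
  -- contributing a sign and advancing the index by one.
  have hcomm : ∀ (m : ℕ) (u : Fin (m + 1) → EuclideanSpace ℝ (Fin d)),
      (∀ i, cliff σ (u i) * cliff σ (u i) = 1) →
      cliff σ (u 0) * (List.ofFn fun i : Fin m => cliff σ (u i.castSucc - u i.succ)).prod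
        = (-1 : ℂ) ^ m • ((List.ofFn fun i : Fin m => cliff σ (u i.castSucc - u i.succ)).prod
          * cliff σ (u (Fin.last m))) := by
    intro m
    induction m with
    | zero => intro u _; simp
    | succ m ih =>
      intro u hsq
      have h1 := ih (fun i => u i.succ) fun i => hsq _
      have h2 : cliff σ (u 0) * cliff σ (u 0 - u 1) = - (cliff σ (u 0 - u 1) * cliff σ (u 1)) := by
        rw [map_sub, mul_sub, sub_mul, hsq, hsq]; abel
      simp only [List.ofFn_succ, List.prod_cons, Fin.castSucc_zero, Fin.succ_zero_eq_one,
        Fin.castSucc_succ] at h1 ⊢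
      rw [← mul_assoc, h2, neg_mul, mul_assoc, h1, mul_smul_comm, pow_succ, mul_neg_one, neg_smul,
        mul_assoc, Fin.succ_last]
  rw [map_sub, mul_sub, Matrix.trace_sub, Matrix.trace_mul_comm _ (cliff σ (u 0)), ← mul_assoc, hsq,
    one_mul, hcomm n u hsq, hn.neg_one_pow, neg_one_smul, neg_mul, mul_assoc, hsq, mul_one,
    Matrix.trace_neg]
  ring

open scoped Matrix.Norms.L2Operator

theorem exists_norm_trace_le (n : Type*) [Fintype n] [DecidableEq n] :
    ∃ C : ℝ, 0 ≤ C ∧ ∀ A : Matrix n n ℂ, ‖A.trace‖ ≤ C * ‖A‖ :=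
  ⟨‖LinearMap.toContinuousLinearMap (Matrix.traceLinearMap n ℂ ℂ)‖, norm_nonneg _, fun A =>
    (LinearMap.toContinuousLinearMap (Matrix.traceLinearMap n ℂ ℂ)).le_opNorm A⟩

theorem exists_norm_cliff_le (σ : Fin d → Matrix (CliffIdx d) (CliffIdx d) ℂ) :
    ∃ C : ℝ, 0 ≤ C ∧ ∀ v, ‖cliff σ v‖ ≤ C * ‖v‖ :=
  ⟨‖LinearMap.toContinuousLinearMap (cliff σ)‖, norm_nonneg _, fun A =>
    (LinearMap.toContinuousLinearMap (cliff σ)).le_opNorm A⟩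

theorem norm_prod_ofFn_cliff_le {C : ℝ} (hC : 0 ≤ C) (h : ∀ v, ‖cliff σ v‖ ≤ C * ‖v‖)
    (A : Matrix (CliffIdx d) (CliffIdx d) ℂ) {n : ℕ} (w : Fin n → EuclideanSpace ℝ (Fin d)) :
    ‖A * (List.ofFn fun i => cliff σ (w i)).prod‖ ≤ ‖A‖ * (C ^ n * ∏ i, ‖w i‖) := by
  induction n generalizing A with
  | zero => simp
  | succ n ih =>
    rw [List.ofFn_succ, List.prod_cons, ← mul_assoc, Fin.prod_univ_succ]
    refine (ih _ _).trans ?_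
    calc _ ≤ (‖A‖ * (C * ‖w 0‖)) * (C ^ n * ∏ i : Fin n, ‖w i.succ‖) := by
          gcongr
          exact (norm_mul_le _ _).trans (by gcongr; exact h _)
      _ = _ := by ring

include hσ in
-- The determinant is a multiple of a Clifford trace, and the latter is bounded by
-- submultiplicativity.
theorem exists_abs_stdDet_le (hd : Odd d) :
    ∃ C : ℝ, 0 ≤ C ∧ ∀ w : Fin d → EuclideanSpace ℝ (Fin d), |stdDet d w| ≤ C * ∏ i, ‖w i‖ := by
  obtain ⟨C, hC, h⟩ := exists_norm_cliff_le σ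
  obtain ⟨T, hT, hT'⟩ := exists_norm_trace_le (CliffIdx d)
  refine ⟨‖cliffConst d‖⁻¹ * (T * (‖(1 : Matrix (CliffIdx d) (CliffIdx d) ℂ)‖ * C ^ d)),
    by positivity, fun w => ?_⟩
  have h1 := congrArg norm (trace_prod_cliff hσ hd w)
  rw [norm_mul, norm_real, Real.norm_eq_abs] at h1
  have h2 : |stdDet d w| = ‖cliffConst d‖⁻¹ * ‖((List.ofFn fun i => cliff σ (w i)).prod).trace‖ := by
    rw [h1, inv_mul_cancel_left₀ (norm_ne_zero_iff.mpr (cliffConst_ne_zero d))]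
  rw [h2, mul_assoc, mul_assoc, mul_assoc]
  gcongr
  refine (hT' _).trans ?_
  gcongr
  simpa using norm_prod_ofFn_cliff_le hC h 1 w

include hσ in
/-- The simplex spanned by unit vectors `u_0, …, u_d` of `ℝ^d`, `d` odd, has a volume that is small
to the order `d + 1` in its diameter. -/
theorem exists_abs_stdDet_sub_le (hd : Odd d) :
    ∃ C : ℝ, 0 ≤ C ∧ ∀ u : Fin (d + 1) → EuclideanSpace ℝ (Fin d), (∀ i, ‖u i‖ = 1) →
      |stdDet d fun i => u i.castSucc - u i.succ|
        ≤ C * (‖u (Fin.last d) - u 0‖ * ∏ i : Fin d, ‖u i.castSucc - u i.succ‖) := by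
  obtain ⟨C, hC, h⟩ := exists_norm_cliff_le σ
  obtain ⟨T, hT, hT'⟩ := exists_norm_trace_le (CliffIdx d)
  refine ⟨‖cliffConst d‖⁻¹ * (2⁻¹ * (T * (C * C ^ d * C))), by positivity, fun u hu => ?_⟩
  -- This rewrites the determinant as a trace that also contains the closing edge u_d - u_0: the
  -- additional order of smallness.
  have h1 := trace_unit_mul_prod_sub hσ hd u hu
  rw [trace_prod_cliff hσ hd] at h1
  have h1 := congrArg norm h1
  rw [norm_mul, norm_mul, norm_real, Real.norm_eq_abs, norm_neg, norm_ofNat] at h1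
  have h2 : |stdDet d fun i => u i.castSucc - u i.succ| = ‖cliffConst d‖⁻¹ * (2⁻¹ *
      (2 * (‖cliffConst d‖ * |stdDet d fun i => u i.castSucc - u i.succ|))) := by
    have := norm_ne_zero_iff.mpr (cliffConst_ne_zero d)
    field_simp
  rw [h2, ← h1]
  have h3 : ‖cliff σ (u 0) * (List.ofFn fun i : Fin d => cliff σ (u i.castSucc - u i.succ)).prod *
      cliff σ (u (Fin.last d) - u 0)‖ ≤ (C * 1) * (C ^ d * ∏ i : Fin d, ‖u i.castSucc - u i.succ‖)
        * (C * ‖u (Fin.last d) - u 0‖) := by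
    refine (norm_mul_le _ _).trans (mul_le_mul ?_ (h _) (norm_nonneg _) (by positivity))
    refine (norm_prod_ofFn_cliff_le hC h _ _).trans ?_
    gcongr
    rw [← hu 0]
    exact h _
  calc _ ≤ ‖cliffConst d‖⁻¹ * (2⁻¹ * (T * ((C * 1) *
        (C ^ d * ∏ i : Fin d, ‖u i.castSucc - u i.succ‖) * (C * ‖u (Fin.last d) - u 0‖)))) := by
        gcongr
        exact (hT' _).trans (by gcongr)
    _ = _ := by ring

end Clifford

/-! ### Radial and nearest point projections, and determinants of simplices -/

section Simplex

variable {d : ℕ}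

/-- Euclidean space `ℝ^d`. -/
abbrev Euc (d : ℕ) : Type := EuclideanSpace ℝ (Fin d)

/-- The radial projection to the unit sphere. -/
noncomputable def unitVec (v : Euc d) : Euc d := ‖v‖⁻¹ • v

/-- The nearest point projection to the unit ball. -/
noncomputable def ballProj (v : Euc d) : Euc d := (max ‖v‖ 1)⁻¹ • v

theorem ballProj_eq_unitVec {v : Euc d} (h : 1 ≤ ‖v‖) : ballProj v = unitVec v := by
  rw [ballProj, unitVec, max_eq_left h]

theorem ballProj_eq_self {v : Euc d} (h : ‖v‖ ≤ 1) : ballProj v = v := by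
  rw [ballProj, max_eq_right h, inv_one, one_smul]

theorem norm_unitVec {v : Euc d} (h : v ≠ 0) : ‖unitVec v‖ = 1 := by
  rw [unitVec, norm_smul, norm_inv, norm_norm, inv_mul_cancel₀ (norm_ne_zero_iff.mpr h)]

theorem norm_unitVec_le (v : Euc d) : ‖unitVec v‖ ≤ 1 := by
  by_cases h : v = 0
  · simp [h, unitVec]
  · exact (norm_unitVec h).le

theorem norm_ballProj_le (v : Euc d) : ‖ballProj v‖ ≤ 1 := by
  rw [ballProj, norm_smul, norm_inv, Real.norm_of_nonneg (by positivity), inv_mul_le_one₀ (by positivity)]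
  exact le_max_left _ _

/-- Serves both projections: m and n are the norms of a and b, or these norms cut off below at 1,
and both are 1-Lipschitz. -/
theorem norm_smul_inv_sub_smul_inv_le {a b : Euc d} {m n : ℝ} (hm : 0 < m) (hn : 0 < n)
    (hb : ‖b‖ ≤ n) (hmn : |n - m| ≤ ‖a - b‖) :
    ‖m⁻¹ • a - n⁻¹ • b‖ ≤ 2 * ‖a - b‖ / m := by
  have h1 : m⁻¹ • a - n⁻¹ • b = m⁻¹ • (a - b) + ((n - m) / m * n⁻¹) • b := by
    have : m⁻¹ - n⁻¹ = (n - m) / m * n⁻¹ := by field_simp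
    rw [← this, smul_sub, sub_smul]
    abel
  rw [h1]
  refine (norm_add_le _ _).trans ?_
  rw [norm_smul, norm_smul, norm_mul, norm_div, norm_inv, norm_inv, Real.norm_eq_abs (n - m),
    Real.norm_of_nonneg hm.le, Real.norm_of_nonneg hn.le]
  have h2 : |n - m| / m * n⁻¹ * ‖b‖ ≤ ‖a - b‖ / m := by
    rw [mul_assoc]
    have : n⁻¹ * ‖b‖ ≤ 1 := by rwa [inv_mul_le_one₀ hn]
    calc _ ≤ ‖a - b‖ / m * 1 := by gcongr
      _ = _ := mul_one _
  calc _ ≤ m⁻¹ * ‖a - b‖ + ‖a - b‖ / m := by gcongr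
    _ = _ := by ring

theorem norm_unitVec_sub_le {a b : Euc d} (ha : a ≠ 0) (hb : b ≠ 0) :
    ‖unitVec a - unitVec b‖ ≤ 2 * ‖a - b‖ / ‖a‖ :=
  norm_smul_inv_sub_smul_inv_le (norm_pos_iff.mpr ha) (norm_pos_iff.mpr hb) le_rfl
    (by rw [abs_sub_comm]; exact abs_norm_sub_norm_le _ _)

theorem norm_ballProj_sub_le (a b : Euc d) :
    ‖ballProj a - ballProj b‖ ≤ 2 * ‖a - b‖ / max ‖a‖ 1 :=
  norm_smul_inv_sub_smul_inv_le (by positivity) (by positivity) (le_max_left _ _)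
    (by
      rw [abs_sub_comm]
      exact (abs_max_sub_max_le_abs _ _ _).trans (abs_norm_sub_norm_le _ _))

theorem unitVec_map (R : Euc d ≃ₗᵢ[ℝ] Euc d) (v : Euc d) : unitVec (R v) = R (unitVec v) := by
  simp [unitVec]

theorem ballProj_map (R : Euc d ≃ₗᵢ[ℝ] Euc d) (v : Euc d) : ballProj (R v) = R (ballProj v) := by
  simp [ballProj]

theorem unitVec_smul {t : ℝ} (ht : 0 < t) (v : Euc d) : unitVec (t • v) = unitVec v := by
  rw [unitVec, unitVec, norm_smul, Real.norm_of_nonneg ht.le, smul_smul, mul_inv, mul_assoc,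
    mul_comm, mul_assoc, mul_inv_cancel₀ ht.ne', mul_one]

theorem measurable_unitVec : Measurable (unitVec : Euc d → Euc d) := by
  unfold unitVec; fun_prop

theorem measurable_ballProj : Measurable (ballProj : Euc d → Euc d) := by
  unfold ballProj; fun_prop

theorem stdDet_apply (w : Fin d → Euc d) : stdDet d w = (Matrix.of fun i j => w i j).det := by
  rw [stdDet, Module.Basis.det_apply, ← Matrix.det_transpose]
  rfl

theorem continuous_stdDet : Continuous (stdDet d : (Fin d → Euc d) → ℝ) := by
  simp only [funext stdDet_apply]
  apply Continuous.matrix_det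
  apply continuous_matrix
  intro i j
  simp only [Matrix.of_apply]
  fun_prop

/-- The determinant of the edges of a simplex is an alternating sum of those of its faces. -/
theorem exists_stdDet_sub_eq_sum (d : ℕ) : ∃ s : Fin (d + 1) → ℝ, ∀ w : Fin (d + 1) → Euc d,
    (stdDet d fun i => w i.castSucc - w i.succ) = ∑ k : Fin (d + 1), s k * stdDet d fun j => w (k.succAbove j) := by
  -- The factor (-1)^d reverses the d edges; (-1)^k comes from Laplace expansion along the column of
  -- ones of `A`, which row subtraction reduces to `B`.
  refine ⟨fun k => (-1) ^ d * (-1) ^ (k : ℕ), fun w => ?_⟩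
  let A : Matrix (Fin (d + 1)) (Fin (d + 1)) ℝ := Matrix.of fun i => Fin.cons 1 (w i)
  let B : Matrix (Fin (d + 1)) (Fin (d + 1)) ℝ := Matrix.of
    (Fin.cons (Fin.cons 1 (w 0)) fun i : Fin d => Fin.cons 0 fun j => w i.succ j - w i.castSucc j)
  have h1 : A.det = B.det := by
    refine Matrix.det_eq_of_forall_row_eq_smul_add_pred (fun _ => 1) (fun j => rfl) fun i j => ?_
    refine Fin.cases ?_ (fun j => ?_) j <;> simp [A, B]
  have h2 : A.det = ∑ k : Fin (d + 1), (-1) ^ (k : ℕ) * stdDet d fun j => w (k.succAbove j) := by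
    rw [Matrix.det_succ_column_zero]
    refine Finset.sum_congr rfl fun k _ => ?_
    rw [stdDet_apply]
    simp only [A, Matrix.of_apply, Fin.cons_zero, mul_one]
    rfl
  have h3 : B.det = stdDet d fun i => w i.succ - w i.castSucc := by
    rw [Matrix.det_succ_column_zero, Finset.sum_eq_single 0]
    · rw [stdDet_apply]
      simp only [B, Matrix.of_apply, Fin.cons_zero, mul_one, Fin.val_zero, pow_zero, one_mul]
      rfl
    · intro k _ hk
      obtain ⟨k, rfl⟩ := Fin.exists_succ_eq.mpr hk
      simp [B]
    · simp
  have h4 : (stdDet d fun i => w i.castSucc - w i.succ)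
      = (-1) ^ d * stdDet d fun i => w i.succ - w i.castSucc := by
    have := (stdDet d).toMultilinearMap.map_smul_univ (fun _ => (-1 : ℝ))
      (fun i => w i.succ - w i.castSucc)
    simpa using this
  rw [h4, ← h3, ← h1, h2, Finset.mul_sum]
  simp only [mul_assoc]

/-- The determinant of the edges of the image under `g` of the simplex `v + z`. -/
noncomputable def simplexDet (g : Euc d → Euc d) (z : Fin (d + 1) → Euc d) (v : Euc d) : ℝ :=
  stdDet d fun i => g (v + z i.castSucc) - g (v + z i.succ)

theorem measurable_simplexDet {g : Euc d → Euc d} (hg : Measurable g) (z : Fin (d + 1) → Euc d) :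
    Measurable (simplexDet g z) := by
  unfold simplexDet
  exact continuous_stdDet.measurable.comp (by fun_prop)

/-- The d points of a face lie in an affine hyperplane. Once v is translated by `q i₀`, the
reflection in its direction fixes the remaining offsets, commutes with both maps and reverses the
determinant, so the integrand is odd. -/
theorem integral_stdDet_sub_eq_zero (hd : 0 < d) {g₁ g₂ : Euc d → Euc d}
    (h₁ : ∀ (R : Euc d ≃ₗᵢ[ℝ] Euc d) v, g₁ (R v) = R (g₁ v))
    (h₂ : ∀ (R : Euc d ≃ₗᵢ[ℝ] Euc d) v, g₂ (R v) = R (g₂ v)) (q : Fin d → Euc d) :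
    ∫ v, ((stdDet d fun j => g₁ (v + q j)) - stdDet d fun j => g₂ (v + q j)) = 0 := by
  classical
  let i₀ : Fin d := ⟨0, hd⟩
  obtain ⟨n, hn, hn'⟩ : ∃ n : Euc d, n ≠ 0 ∧
      ∀ v ∈ (Finset.univ.erase i₀).image (fun j => q j - q i₀), inner ℝ n v = 0 := by
    refine exists_orthogonal_of_card_lt (Finset.card_image_le.trans_lt ?_)
    rw [Finset.card_erase_of_mem (Finset.mem_univ _), Finset.card_univ, Fintype.card_fin]
    omega
  have hq : ∀ j, q j - q i₀ ∈ (ℝ ∙ n)ᗮ := fun j => by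
    rw [Submodule.mem_orthogonal_singleton_iff_inner_right]
    by_cases hj : j = i₀
    · simp [hj]
    · exact hn' _ (Finset.mem_image_of_mem _ (by simp [hj]))
  let R : Euc d ≃ₗᵢ[ℝ] Euc d := (ℝ ∙ n)ᗮ.reflection
  have hR : ∀ j, R (q j - q i₀) = q j - q i₀ := fun j =>
    Submodule.reflection_mem_subspace_eq_self (hq j)
  have hdet : LinearMap.det (R.toLinearEquiv : Euc d →ₗ[ℝ] Euc d) = -1 := by
    rw [Submodule.det_reflection, Submodule.orthogonal_orthogonal, finrank_span_singleton hn, pow_one]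
  have hR' : ∀ g : Euc d → Euc d, (∀ v, g (R v) = R (g v)) → ∀ v,
      (stdDet d fun j => g (R v + (q j - q i₀))) = - stdDet d fun j => g (v + (q j - q i₀)) := by
    intro g hg v
    have : (fun j => g (R v + (q j - q i₀)))
        = (R.toLinearEquiv : Euc d →ₗ[ℝ] Euc d) ∘ fun j => g (v + (q j - q i₀)) := by
      funext j
      simp only [Function.comp_apply]
      rw [← hR j, ← map_add, hg, hR j]
      rfl
    rw [this, stdDet, Module.Basis.det_comp, hdet, neg_one_mul]
  set H : Euc d → ℝ := fun v => (stdDet d fun j => g₁ (v + (q j - q i₀)))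
    - stdDet d fun j => g₂ (v + (q j - q i₀)) with hH
  have e1 : ∫ v, ((stdDet d fun j => g₁ (v + q j)) - stdDet d fun j => g₂ (v + q j)) = ∫ v, H v := by
    rw [← integral_add_right_eq_self H (q i₀)]
    simp [hH, add_assoc]
  have e2 : ∫ v, H v = ∫ v, H (R v) :=
    ((R.measurePreserving).integral_comp R.toMeasurableEquiv.measurableEmbedding H).symm
  have e3 : ∀ v, H (R v) = - H v := fun v => by
    simp only [hH, hR' g₁ (h₁ R), hR' g₂ (h₂ R)]
    ring
  rw [e1]
  simp only [e3, integral_neg] at e2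
  linarith

end Simplex

/-! ### The integral of an inscribed simplex over all translates -/

section SimplexIntegral

variable {d : ℕ} {σ : Fin d → Matrix (CliffIdx d) (CliffIdx d) ℂ} (hσ : IsCliffordRep σ)

theorem simplexDet_unitVec_eq_ballProj {z : Fin (d + 1) → Euc d} {v : Euc d}
    (h : ∀ i, 1 ≤ ‖v + z i‖) : simplexDet unitVec z v = simplexDet ballProj z v := by
  simp only [simplexDet, ballProj_eq_unitVec (h _)]

theorem one_add_norm_div_le_max {v z : Euc d} {M : ℝ} (hz : ‖z‖ ≤ M) :
    (1 + ‖v‖) / (2 + M) ≤ max ‖v + z‖ 1 := by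
  have hM : 0 ≤ M := (norm_nonneg _).trans hz
  have h1 : ‖v‖ ≤ ‖v + z‖ + M := by
    have := norm_sub_le (v + z) z
    rw [add_sub_cancel_right] at this
    linarith
  have h2 := le_max_left ‖v + z‖ 1
  have h3 := le_max_right ‖v + z‖ 1
  rw [div_le_iff₀ (by positivity)]
  nlinarith

theorem norm_ballProj_add_sub_le {v a b : Euc d} {M : ℝ} (ha : ‖a‖ ≤ M) (t : ℝ) (ht : 0 ≤ t)
    (ht1 : t ≤ 1) (hb : ‖b‖ ≤ M) :
    ‖ballProj (v + t • a) - ballProj (v + t • b)‖ ≤ t * (4 * M * (2 + M) / (1 + ‖v‖)) := by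
  have hM : 0 ≤ M := (norm_nonneg _).trans ha
  refine (norm_ballProj_sub_le _ _).trans ?_
  have h1 : ‖v + t • a - (v + t • b)‖ ≤ t * (2 * M) := by
    rw [add_sub_add_left_eq_sub, ← smul_sub, norm_smul, Real.norm_of_nonneg ht]
    gcongr
    exact (norm_sub_le _ _).trans (by linarith)
  have h2 : (1 + ‖v‖) / (2 + M) ≤ max ‖v + t • a‖ 1 := one_add_norm_div_le_max (by
    rw [norm_smul, Real.norm_of_nonneg ht]
    nlinarith [norm_nonneg a])
  calc _ ≤ 2 * (t * (2 * M)) / ((1 + ‖v‖) / (2 + M)) := by gcongr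
    _ = _ := by field_simp; ring

include hσ in
-- With all vertices outside the open unit ball the projected points are unit vectors, so the gain
-- of one order applies.
theorem exists_abs_simplexDet_le_pow (hd : Odd d) : ∃ C : ℝ, 0 ≤ C ∧
    ∀ (z : Fin (d + 1) → Euc d) (v : Euc d) (r : ℝ), (∀ i, 1 ≤ ‖v + z i‖) →
      (∀ i j, ‖ballProj (v + z i) - ballProj (v + z j)‖ ≤ r) →
      |simplexDet ballProj z v| ≤ C * r ^ (d + 1) := by
  obtain ⟨C, hC, h⟩ := exists_abs_stdDet_sub_le hσ hd
  refine ⟨C, hC, fun z v r hz hr => ?_⟩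
  refine (h (fun i => ballProj (v + z i)) fun i => ?_).trans ?_
  · rw [ballProj_eq_unitVec (hz i), norm_unitVec]
    rw [← norm_pos_iff]
    linarith [hz i]
  · have : (0 : ℝ) ≤ r := (norm_nonneg _).trans (hr 0 0)
    gcongr
    calc _ ≤ r * ∏ i : Fin d, r := by
          gcongr
          · exact hr _ _
          · exact hr _ _
      _ = _ := by rw [Finset.prod_const, Finset.card_univ, Fintype.card_fin, pow_succ']

theorem exists_norm_le (z : Fin (d + 1) → Euc d) : ∃ M : ℝ, 0 ≤ M ∧ ∀ i, ‖z i‖ ≤ M :=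
  ⟨‖z‖, norm_nonneg _, fun i => norm_le_pi_norm z i⟩

include hσ in
-- The bound is uniform in t in order to dominate the rescaled integrands of a shrinking simplex.
-- Far out every vertex has norm at least 1 and the order d + 1 is available; near the origin the
-- order d suffices, the missing factor 1 + ‖v‖ being at most 2 + M.
theorem exists_abs_simplexDet_ballProj_le (hd : Odd d) (z : Fin (d + 1) → Euc d) :
    ∃ K : ℝ, 0 ≤ K ∧ ∀ (t : ℝ), 0 ≤ t → t ≤ 1 → ∀ v,
      |simplexDet ballProj (fun i => t • z i) v| ≤ t ^ d * (K * ((1 + ‖v‖) ^ (d + 1))⁻¹) := by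
  obtain ⟨M, hM, hz⟩ := exists_norm_le z
  obtain ⟨C, hC, h⟩ := exists_abs_simplexDet_le_pow hσ hd
  obtain ⟨C', hC', h'⟩ := exists_abs_stdDet_le hσ hd
  set k := 4 * M * (2 + M) with hk
  have hk0 : 0 ≤ k := by positivity
  refine ⟨C * k ^ (d + 1) + C' * k ^ d * (2 + M), by positivity, fun t ht ht1 v => ?_⟩
  have hdiff : ∀ i j, ‖ballProj (v + t • z i) - ballProj (v + t • z j)‖ ≤ t * (k / (1 + ‖v‖)) :=
    fun i j => norm_ballProj_add_sub_le (hz i) t ht ht1 (hz j)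
  have hv : 0 < 1 + ‖v‖ := by positivity
  by_cases hc : M + 1 ≤ ‖v‖
  · have h1 : ∀ i, 1 ≤ ‖v + t • z i‖ := fun i => by
      have h2 := norm_sub_le (v + t • z i) (t • z i)
      rw [add_sub_cancel_right, norm_smul, Real.norm_of_nonneg ht] at h2
      nlinarith [hz i, norm_nonneg (z i)]
    refine (h _ v _ h1 hdiff).trans ?_
    calc C * (t * (k / (1 + ‖v‖))) ^ (d + 1)
        = t ^ (d + 1) * (C * k ^ (d + 1) * ((1 + ‖v‖) ^ (d + 1))⁻¹) := by
          rw [mul_pow, div_pow]; ring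
      _ ≤ t ^ d * ((C * k ^ (d + 1) + C' * k ^ d * (2 + M)) * ((1 + ‖v‖) ^ (d + 1))⁻¹) := by
          refine mul_le_mul (pow_le_pow_of_le_one ht ht1 (Nat.le_succ d)) ?_ (by positivity)
            (by positivity)
          gcongr
          exact le_add_of_nonneg_right (by positivity)
  · refine (h' _).trans ?_
    calc _ ≤ C' * ∏ i : Fin d, (t * (k / (1 + ‖v‖))) := by
          gcongr
          exact hdiff _ _
      _ = t ^ d * ((C' * k ^ d * (1 + ‖v‖)) * ((1 + ‖v‖) ^ (d + 1))⁻¹) := by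
          rw [Finset.prod_const, Finset.card_univ, Fintype.card_fin, mul_pow, div_pow]
          field_simp
          ring
      _ ≤ _ := by
          gcongr
          have : C' * k ^ d * (1 + ‖v‖) ≤ C' * k ^ d * (2 + M) :=
            mul_le_mul_of_nonneg_left (by linarith) (by positivity)
          exact this.trans (le_add_of_nonneg_left (by positivity))

include hσ in
theorem exists_abs_simplexDet_unitVec_le (hd : Odd d) (z : Fin (d + 1) → Euc d) :
    ∃ K : ℝ, 0 ≤ K ∧ ∀ v, |simplexDet unitVec z v| ≤ K * ((1 + ‖v‖) ^ (d + 1))⁻¹ := by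
  obtain ⟨M, hM, hz⟩ := exists_norm_le z
  obtain ⟨K, hK, h⟩ := exists_abs_simplexDet_ballProj_le hσ hd z
  obtain ⟨C', hC', h'⟩ := exists_abs_stdDet_le hσ hd
  refine ⟨K + C' * 2 ^ d * (2 + M) ^ (d + 1), by positivity, fun v => ?_⟩
  by_cases hc : M + 1 ≤ ‖v‖
  · have h1 : ∀ i, 1 ≤ ‖v + z i‖ := fun i => by
      have h2 := norm_sub_le (v + z i) (z i)
      rw [add_sub_cancel_right] at h2
      linarith [hz i]
    have h2 := h 1 zero_le_one le_rfl v
    simp only [one_smul, one_pow, one_mul] at h2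
    rw [simplexDet_unitVec_eq_ballProj h1]
    refine h2.trans ?_
    gcongr
    exact le_add_of_nonneg_right (by positivity)
  · refine (h' _).trans ?_
    have h1 : (1 : ℝ) ≤ (2 + M) ^ (d + 1) * ((1 + ‖v‖) ^ (d + 1))⁻¹ := by
      rw [← div_eq_mul_inv, one_le_div (by positivity)]
      exact pow_le_pow_left₀ (by positivity) (by linarith) _
    calc _ ≤ C' * ∏ i : Fin d, (2 : ℝ) := by
          gcongr
          refine (norm_sub_le _ _).trans ?_
          linarith [norm_unitVec_le (v + z (Fin.castSucc ‹_›)), norm_unitVec_le (v + z (Fin.succ ‹_›))]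
      _ = C' * 2 ^ d * 1 := by simp
      _ ≤ C' * 2 ^ d * ((2 + M) ^ (d + 1) * ((1 + ‖v‖) ^ (d + 1))⁻¹) := by gcongr
      _ ≤ _ := by
          rw [← mul_assoc]
          gcongr
          exact le_add_of_nonneg_left hK

theorem integrable_inv_one_add_norm_pow (d : ℕ) :
    Integrable (fun v : Euc d => ((1 + ‖v‖) ^ (d + 1))⁻¹) := by
  have h := integrable_one_add_norm (E := Euc d) (μ := volume) (r := (d : ℝ) + 1) (by simp)
  refine h.congr (ae_of_all _ fun v => ?_)
  simp only
  rw [Real.rpow_neg (by positivity), ← Nat.cast_add_one, Real.rpow_natCast]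

include hσ in
theorem integrable_simplexDet_unitVec (hd : Odd d) (z : Fin (d + 1) → Euc d) :
    Integrable (simplexDet unitVec z) := by
  obtain ⟨K, hK, h⟩ := exists_abs_simplexDet_unitVec_le hσ hd z
  exact ((integrable_inv_one_add_norm_pow d).const_mul K).mono'
    (measurable_simplexDet measurable_unitVec z).aestronglyMeasurable (ae_of_all _ h)

include hσ in
theorem integrable_simplexDet_ballProj (hd : Odd d) (z : Fin (d + 1) → Euc d) :
    Integrable (simplexDet ballProj z) := by
  obtain ⟨K, hK, h⟩ := exists_abs_simplexDet_ballProj_le hσ hd z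
  refine ((integrable_inv_one_add_norm_pow d).const_mul K).mono'
    (measurable_simplexDet measurable_ballProj z).aestronglyMeasurable (ae_of_all _ fun v => ?_)
  simpa using h 1 zero_le_one le_rfl v

include hσ in
-- Both maps agree outside the unit ball, so the difference is bounded with bounded support.
theorem integrable_stdDet_sub (hd : Odd d) (q : Fin d → Euc d) :
    Integrable fun v => (stdDet d fun j => unitVec (v + q j))
      - stdDet d fun j => ballProj (v + q j) := by
  obtain ⟨C, hC, h⟩ := exists_abs_stdDet_le hσ hd
  have hb : ∀ g : Euc d → Euc d, (∀ v, ‖g v‖ ≤ 1) → ∀ v, |stdDet d fun j => g (v + q j)| ≤ C := by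
    intro g hg v
    refine (h _).trans ?_
    calc _ ≤ C * ∏ j : Fin d, (1 : ℝ) := by
          gcongr
          exact hg _
      _ = C := by simp
  have hm : ∀ g : Euc d → Euc d, Measurable g →
      Measurable fun v => stdDet d fun j => g (v + q j) := fun g hg =>
    continuous_stdDet.measurable.comp (by fun_prop)
  have hsupp : ∀ v, v ∉ Metric.closedBall (0 : Euc d) (‖q‖ + 1) →
      (stdDet d fun j => unitVec (v + q j)) - (stdDet d fun j => ballProj (v + q j)) = 0 := by
    intro v hv
    have h1 : ∀ j, 1 ≤ ‖v + q j‖ := fun j => by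
      have h2 := norm_sub_le (v + q j) (q j)
      rw [add_sub_cancel_right] at h2
      have h3 := norm_le_pi_norm q j
      simp only [Metric.mem_closedBall, dist_zero_right, not_le] at hv
      linarith
    simp only [ballProj_eq_unitVec (h1 _), sub_self]
  rw [← integrableOn_iff_integrable_of_support_subset (s := Metric.closedBall (0 : Euc d) (‖q‖ + 1))
    (Function.support_subset_iff'.mpr hsupp)]
  refine Measure.integrableOn_of_bounded (M := 2 * C) measure_closedBall_lt_top.ne
    ((hm _ measurable_unitVec).sub (hm _ measurable_ballProj)).aestronglyMeasurable
    (ae_of_all _ fun v => ?_)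
  rw [Real.norm_eq_abs]
  refine (abs_sub _ _).trans ?_
  linarith [hb _ norm_unitVec_le v, hb _ norm_ballProj_le v]

include hσ in
theorem integral_simplexDet_unitVec_eq_ballProj (hd : Odd d) (z : Fin (d + 1) → Euc d) :
    ∫ v, simplexDet unitVec z v = ∫ v, simplexDet ballProj z v := by
  obtain ⟨s, hs⟩ := exists_stdDet_sub_eq_sum d
  rw [← sub_eq_zero, ← integral_sub (integrable_simplexDet_unitVec hσ hd z)
    (integrable_simplexDet_ballProj hσ hd z)]
  have h1 : ∀ v, simplexDet unitVec z v - simplexDet ballProj z v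
      = ∑ k : Fin (d + 1), s k * ((stdDet d fun j => unitVec (v + z (k.succAbove j)))
        - stdDet d fun j => ballProj (v + z (k.succAbove j))) := fun v => by
    simp only [simplexDet]
    rw [hs fun i => unitVec (v + z i), hs fun i => ballProj (v + z i), ← Finset.sum_sub_distrib]
    simp only [mul_sub]
  simp only [h1]
  rw [integral_finsetSum _ fun k _ => (integrable_stdDet_sub hσ hd _).const_mul _]
  refine Finset.sum_eq_zero fun k _ => ?_
  rw [integral_const_mul, integral_stdDet_sub_eq_zero hd.pos unitVec_map ballProj_map, mul_zero]

/-- Radial projection ignores the scale, so only the Jacobian t^d of the substitution remains. -/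
theorem integral_simplexDet_unitVec_smul (z : Fin (d + 1) → Euc d) {t : ℝ} (ht : 0 < t) :
    ∫ v, simplexDet unitVec (fun i => t • z i) v = t ^ d * ∫ v, simplexDet unitVec z v := by
  have h := Measure.integral_comp_smul (volume : Measure (Euc d))
    (simplexDet unitVec (fun i => t • z i)) t
  have h1 : ∀ v, simplexDet unitVec (fun i => t • z i) (t • v) = simplexDet unitVec z v := fun v => by
    simp only [simplexDet, ← smul_add, unitVec_smul ht]
  simp only [h1, finrank_euclideanSpace, Fintype.card_fin, smul_eq_mul] at h
  rw [h, abs_of_pos (by positivity), mul_inv_cancel_left₀ (by positivity)]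

theorem simplexDet_ballProj_of_le {z : Fin (d + 1) → Euc d} {v : Euc d} {t : ℝ}
    (h : ∀ i, ‖v + t • z i‖ ≤ 1) : simplexDet ballProj (fun i => t • z i) v
      = t ^ d * stdDet d fun i => z i.castSucc - z i.succ := by
  simp only [simplexDet, ballProj_eq_self (h _), add_sub_add_left_eq_sub, ← smul_sub]
  have := (stdDet d).toMultilinearMap.map_smul_univ (fun _ => t)
    (fun i => z i.castSucc - z i.succ)
  simpa using this

include hσ in
/-- The integral over all translates of a simplex of the volume of the inscribed simplex with the
directions of its vertices is proportional to its volume. -/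
theorem integral_simplexDet_unitVec (hd : Odd d) (z : Fin (d + 1) → Euc d) :
    ∫ v, simplexDet unitVec z v
      = volume.real (Metric.ball (0 : Euc d) 1) * stdDet d fun i => z i.castSucc - z i.succ := by
  obtain ⟨M, hM, hz⟩ := exists_norm_le z
  obtain ⟨K, hK, h⟩ := exists_abs_simplexDet_ballProj_le hσ hd z
  obtain ⟨C, hC, hpow⟩ := exists_abs_simplexDet_le_pow hσ hd
  set D := stdDet d fun i => z i.castSucc - z i.succ with hD
  let t : ℕ → ℝ := fun n => 1 / ((n : ℝ) + 1)
  have ht : ∀ n, 0 < t n := fun n => by positivity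
  have ht1 : ∀ n, t n ≤ 1 := fun n => by
    rw [div_le_one (by positivity)]
    linarith [n.cast_nonneg (α := ℝ)]
  have htlim : Filter.Tendsto t Filter.atTop (nhds 0) := tendsto_one_div_add_atTop_nhds_zero_nat
  -- The rescaled ball integrals form a constant sequence, so their value is the integral of the
  -- pointwise limit.
  have hconst : ∀ n, ∫ v, (t n ^ d)⁻¹ * simplexDet ballProj (fun i => t n • z i) v
      = ∫ v, simplexDet unitVec z v := fun n => by
    rw [integral_const_mul, ← integral_simplexDet_unitVec_eq_ballProj hσ hd,
      integral_simplexDet_unitVec_smul z (ht n), inv_mul_cancel_left₀ (pow_pos (ht n) d).ne']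
  have hdom := tendsto_integral_of_dominated_convergence (μ := (volume : Measure (Euc d)))
    (F := fun n v => (t n ^ d)⁻¹ * simplexDet ballProj (fun i => t n • z i) v)
    (f := (Metric.ball (0 : Euc d) 1).indicator fun _ => D)
    (fun v => K * ((1 + ‖v‖) ^ (d + 1))⁻¹)
    (fun n => ((measurable_simplexDet measurable_ballProj _).const_mul _).aestronglyMeasurable)
    ((integrable_inv_one_add_norm_pow d).const_mul K)
    (fun n => ae_of_all _ fun v => by
      rw [norm_mul, norm_inv, norm_pow, Real.norm_of_nonneg (ht n).le, Real.norm_eq_abs,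
        inv_mul_le_iff₀ (pow_pos (ht n) d)]
      exact h _ (ht n).le (ht1 n) v)
    ?_
  · simp only [hconst] at hdom
    rw [tendsto_nhds_unique tendsto_const_nhds hdom, integral_indicator measurableSet_ball,
      setIntegral_const, smul_eq_mul]
  -- The pointwise limit is determined only off the unit sphere, a null set.
  · have hsphere : ∀ᵐ v : Euc d, v ∉ Metric.sphere (0 : Euc d) 1 := by
      rw [ae_iff]
      simp only [not_not, Set.ofPred_mem_eq]
      exact Measure.addHaar_sphere_of_ne_zero (volume : Measure (Euc d)) 0 one_ne_zero
    filter_upwards [hsphere] with v hv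
    have hsmall : ∀ n i, ‖t n • z i‖ ≤ t n * M := fun n i => by
      rw [norm_smul, Real.norm_of_nonneg (ht n).le]
      exact mul_le_mul_of_nonneg_left (hz i) (ht n).le
    have hMlim : Filter.Tendsto (fun n => t n * M) Filter.atTop (nhds 0) := by
      simpa using htlim.mul_const M
    rw [mem_sphere_zero_iff_norm] at hv
    rcases lt_or_gt_of_ne hv with hv | hv
    · rw [Set.indicator_of_mem (by simpa using hv)]
      refine tendsto_const_nhds.congr' ?_
      filter_upwards [hMlim.eventually_lt_const (sub_pos.mpr hv)] with n hn
      rw [simplexDet_ballProj_of_le fun i => ?_, inv_mul_cancel_left₀ (pow_pos (ht n) d).ne']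
      linarith [norm_add_le v (t n • z i), hsmall n i]
    · rw [Set.indicator_of_notMem (by simpa using hv.le)]
      -- Outside the ball the order d + 1 leaves one factor t after division by t^d.
      have hlim : Filter.Tendsto (fun n => t n * (C * (4 * M * (2 + M) / (1 + ‖v‖)) ^ (d + 1)))
          Filter.atTop (nhds 0) := by simpa using htlim.mul_const _
      refine squeeze_zero_norm' ?_ hlim
      filter_upwards [hMlim.eventually_lt_const (sub_pos.mpr hv)] with n hn
      rw [norm_mul, norm_inv, norm_pow, Real.norm_of_nonneg (ht n).le, Real.norm_eq_abs,
        inv_mul_le_iff₀ (pow_pos (ht n) d)]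
      refine (hpow _ v _ (fun i => ?_) fun i j => norm_ballProj_add_sub_le (hz i) (t n) (ht n).le
        (ht1 n) (hz j)).trans (le_of_eq ?_)
      · have h2 := norm_sub_le (v + t n • z i) (t n • z i)
        rw [add_sub_cancel_right] at h2
        linarith [hsmall n i]
      · rw [mul_pow]; ring

end SimplexIntegral

/-! ### Operators on ℓ² and their matrix elements -/

section Kernels

set_option linter.unusedSectionVars false

open scoped Matrix.Norms.L2Operator

variable {d : ℕ} {ι κ : Type} [Fintype ι] [Fintype κ]

/-- The operator that acts by `T x` on the fiber at `x`. -/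
noncomputable def fiberOp (T : Lattice d → EuclideanSpace ℂ ι →L[ℂ] EuclideanSpace ℂ κ) (C : ℝ)
    (hT : ∀ x, ‖T x‖ ≤ C) : Hil d ι →L[ℂ] Hil d κ :=
  have hle : ∀ (ψ : Hil d ι) x, ‖T x (ψ x)‖ ≤ ‖((C : ℂ) • ψ : Hil d ι) x‖ := fun ψ x => by
    rw [lp.coeFn_smul, Pi.smul_apply, norm_smul, norm_real,
      Real.norm_of_nonneg ((norm_nonneg _).trans (hT x))]
    exact (T x).le_of_opNorm_le (hT x) _
  LinearMap.mkContinuous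
    { toFun := fun ψ => (⟨fun x => T x (ψ x),
        (lp.memℓp ((C : ℂ) • ψ : Hil d ι)).mono' (hle ψ)⟩ : Hil d κ)
      map_add' := fun ψ χ => by ext1; funext x; exact map_add (T x) _ _
      map_smul' := fun r ψ => by ext1; funext x; exact map_smul (T x) _ _ } C fun ψ => by
    refine (lp.norm_mono two_ne_zero (hle ψ)).trans ?_
    rw [norm_smul, norm_real, Real.norm_of_nonneg ((norm_nonneg _).trans (hT 0))]

variable [DecidableEq ι] [DecidableEq κ]

theorem isKernelOp_fiberOp (M : Lattice d → Matrix ι ι ℂ) (C : ℝ) (hM : ∀ x, ‖M x‖ ≤ C) :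
    IsKernelOp (fun x y => if x = y then M x else 0)
      (fiberOp (fun x => Matrix.toEuclideanCLM (𝕜 := ℂ) (M x)) C hM) := by
  intro ψ x
  have h := hasSum_single (f := fun y => Matrix.toEuclideanCLM (𝕜 := ℂ)
    (if x = y then M x else 0) (ψ y)) x fun y hy => by rw [if_neg hy.symm, map_zero]; rfl
  rw [if_pos rfl] at h
  exact h

theorem isKernelOp_kernelOp {k : Lattice d → Lattice d → Matrix ι ι ℂ}
    {A : Hil d ι →L[ℂ] Hil d ι} (h : IsKernelOp k A) : IsKernelOp k (kernelOp k) := by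
  have h' : ∃ A, IsKernelOp k A := ⟨A, h⟩
  rw [kernelOp, dif_pos h']
  exact h'.choose_spec

/-- The matrix element `⟨x|A|y⟩`. -/
noncomputable def kern (A : Hil d ι →L[ℂ] Hil d ι) (x y : Lattice d) : Matrix ι ι ℂ :=
  Matrix.of fun i j => A (ket (y, j)) x i

theorem inner_ket (p : Lattice d × ι) (ψ : Hil d ι) : inner ℂ (ket p) ψ = ψ p.1 p.2 := by
  rw [ket, lp.inner_single_left, EuclideanSpace.inner_single_left]
  simp

theorem norm_ket (p : Lattice d × ι) : ‖(ket p : Hil d ι)‖ = 1 := by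
  rw [ket, lp.norm_single (by norm_num)]
  simp

theorem kern_sub (A B : Hil d ι →L[ℂ] Hil d ι) (x y : Lattice d) :
    kern (A - B) x y = kern A x y - kern B x y := by
  ext i j; simp [kern]

theorem kern_add (A B : Hil d ι →L[ℂ] Hil d ι) (x y : Lattice d) :
    kern (A + B) x y = kern A x y + kern B x y := by
  ext i j; simp [kern]

theorem IsKernelOp.apply_single {k : Lattice d → Lattice d → Matrix ι ι ℂ}
    {A : Hil d ι →L[ℂ] Hil d ι} (h : IsKernelOp k A) (x y : Lattice d) (v : EuclideanSpace ℂ ι) :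
    A (lp.single 2 y v) x = Matrix.toEuclideanCLM (𝕜 := ℂ) (k x y) v := by
  refine (h _ x).unique ?_
  convert hasSum_single y fun z hz => ?_ using 1
  · rw [lp.single_apply_self]
  · rw [lp.single_apply_ne _ _ _ hz, map_zero]

theorem IsKernelOp.kern_eq {k : Lattice d → Lattice d → Matrix ι ι ℂ}
    {A : Hil d ι →L[ℂ] Hil d ι} (h : IsKernelOp k A) (x y : Lattice d) : kern A x y = k x y := by
  ext i j
  rw [kern, Matrix.of_apply, ket, h.apply_single, Matrix.ofLp_toEuclideanCLM]
  simp

theorem IsKernelOp.norm_le {k : Lattice d → Lattice d → Matrix ι ι ℂ}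
    {A : Hil d ι →L[ℂ] Hil d ι} (h : IsKernelOp k A) (x y : Lattice d) : ‖k x y‖ ≤ ‖A‖ := by
  rw [← Matrix.l2_opNorm_toEuclideanCLM]
  refine ContinuousLinearMap.opNorm_le_bound _ (norm_nonneg _) fun v => ?_
  rw [← h.apply_single]
  refine (lp.norm_apply_le_norm two_ne_zero _ x).trans ((A.le_opNorm _).trans_eq ?_)
  rw [lp.norm_single (by norm_num)]

/-- Parseval's identity for the inner product of A^*|x,i⟩ with B|y,j⟩. -/
theorem hasSum_kern_mul (A B : Hil d ι →L[ℂ] Hil d ι) (x y : Lattice d) :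
    HasSum (fun z => kern A x z * kern B z y) (kern (A * B) x y) := by
  refine Pi.hasSum.mpr fun i => Pi.hasSum.mpr fun j => ?_
  have h := lp.hasSum_inner (𝕜 := ℂ) (ContinuousLinearMap.adjoint A (ket (x, i))) (B (ket (y, j)))
  rw [ContinuousLinearMap.adjoint_inner_left, inner_ket] at h
  refine HasSum.congr_fun h fun z => ?_
  have h1 : ∀ l, kern A x z i l = star (ContinuousLinearMap.adjoint A (ket (x, i)) z l) := fun l => by
    have h2 := inner_ket (z, l) (ContinuousLinearMap.adjoint A (ket (x, i)))
    rw [ContinuousLinearMap.adjoint_inner_right, ← inner_conj_symm, inner_ket] at h2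
    simp only at h2
    rw [← h2]
    simp [kern]
  simp only [Matrix.mul_apply, PiLp.inner_apply, h1]
  refine Finset.sum_congr rfl fun l _ => ?_
  simp [kern, mul_comm]

theorem kern_mul_of_diag_left {A B : Hil d ι →L[ℂ] Hil d ι} {M : Lattice d → Matrix ι ι ℂ}
    (hA : IsKernelOp (fun x y => if x = y then M x else 0) A) (x y : Lattice d) :
    kern (A * B) x y = M x * kern B x y := by
  refine (hasSum_kern_mul A B x y).unique ?_
  convert hasSum_single x fun z hz => ?_ using 1
  · rw [hA.kern_eq, if_pos rfl]
  · rw [hA.kern_eq, if_neg (Ne.symm hz), zero_mul]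

theorem kern_mul_of_diag_right {A B : Hil d ι →L[ℂ] Hil d ι} {M : Lattice d → Matrix ι ι ℂ}
    (hB : IsKernelOp (fun x y => if x = y then M x else 0) B) (x y : Lattice d) :
    kern (A * B) x y = kern A x y * M y := by
  refine (hasSum_kern_mul A B x y).unique ?_
  convert hasSum_single y fun z hz => ?_ using 1
  · rw [hB.kern_eq, if_pos rfl]
  · rw [hB.kern_eq, if_neg hz, mul_zero]

theorem norm_apply_ket_le {A : Hil d ι →L[ℂ] Hil d ι} {y : Lattice d}
    (h : Summable fun x => ‖kern A x y‖) (j : ι) : ‖A (ket (y, j))‖ ≤ ∑' x, ‖kern A x y‖ := by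
  have hle : ∀ x, ‖A (ket (y, j)) x‖ ≤ ‖kern A x y‖ := fun x => by
    have h1 : A (ket (y, j)) x = Matrix.toEuclideanCLM (𝕜 := ℂ) (kern A x y)
        (EuclideanSpace.single j 1) := by
      ext i
      rw [Matrix.ofLp_toEuclideanCLM]
      simp [kern]
    rw [h1, ← Matrix.l2_opNorm_toEuclideanCLM]
    refine (ContinuousLinearMap.le_opNorm _ _).trans_eq ?_
    simp
  have h1 := lp.hasSum_single (by norm_num : (2 : ENNReal) ≠ ⊤) (A (ket (y, j)))
  have h2 : ∀ x, ‖(lp.single 2 x (A (ket (y, j)) x) : Hil d ι)‖ ≤ ‖kern A x y‖ := fun x => by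
    rw [lp.norm_single (by norm_num)]
    exact hle x
  rw [← h1.tsum_eq]
  exact tsum_of_norm_bounded h.hasSum h2

theorem norm_opAbs_apply {E : Type*} [NormedAddCommGroup E] [InnerProductSpace ℂ E]
    [CompleteSpace E] (A : E →L[ℂ] E) (ψ : E) : ‖opAbs A ψ‖ = ‖A ψ‖ := by
  have h1 : star (CFC.abs A) * CFC.abs A = star A * A := by
    rw [(CFC.abs_nonneg A).isSelfAdjoint.star_eq, CFC.abs_mul_abs]
  have h2 : inner ℂ (CFC.abs A ψ) (CFC.abs A ψ) = inner ℂ (A ψ) (A ψ) := by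
    have := congrArg (fun B : E →L[ℂ] E => inner ℂ ψ (B ψ)) h1
    simpa [ContinuousLinearMap.star_eq_adjoint, ContinuousLinearMap.adjoint_inner_right] using this
  rw [inner_self_eq_norm_sq_to_K, inner_self_eq_norm_sq_to_K] at h2
  have h3 : ‖CFC.abs A ψ‖ ^ 2 = ‖A ψ‖ ^ 2 := by exact_mod_cast h2
  exact (sq_eq_sq₀ (norm_nonneg _) (norm_nonneg _)).mp h3

/-- By Cauchy-Schwarz, ⟨e, |A| e⟩ ≤ ‖|A| e‖ = ‖A e‖, which can be estimated from matrix elements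
without knowing |A|. -/
theorem isTraceClass_of_summable_norm {A : Hil d ι →L[ℂ] Hil d ι}
    (h : Summable fun p : Lattice d × ι => ‖A (ket p)‖) : IsTraceClass A := by
  refine Summable.of_norm_bounded h fun p => ?_
  refine (abs_re_le_norm _).trans ((norm_inner_le_norm _ _).trans_eq ?_)
  rw [norm_ket, norm_opAbs_apply, one_mul]

/-- The component of a vector of `ℂ^ι ⊗ ℂ^κ` along the basis vector `j` of `ℂ^κ`. -/
noncomputable def sliceFiber (j : κ) : EuclideanSpace ℂ (ι × κ) →L[ℂ] EuclideanSpace ℂ ι :=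
  LinearMap.toContinuousLinearMap
    { toFun := fun v => WithLp.toLp 2 fun i => v (i, j)
      map_add' := fun _ _ => rfl
      map_smul' := fun _ _ => rfl }

/-- The tensor product of a vector of `ℂ^ι` with the basis vector `j` of `ℂ^κ`. -/
noncomputable def embedFiber (j : κ) : EuclideanSpace ℂ ι →L[ℂ] EuclideanSpace ℂ (ι × κ) :=
  LinearMap.toContinuousLinearMap
    { toFun := fun v => WithLp.toLp 2 fun p => if p.2 = j then v p.1 else 0
      map_add' := fun v w => by ext p; simp only [PiLp.add_apply]; split_ifs <;> simp
      map_smul' := fun r v => by ext p; simp }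

theorem sliceFiber_apply (j : κ) (v : EuclideanSpace ℂ (ι × κ)) (i : ι) :
    sliceFiber j v i = v (i, j) := rfl

theorem embedFiber_apply (j : κ) (v : EuclideanSpace ℂ ι) (p : ι × κ) :
    embedFiber j v p = if p.2 = j then v p.1 else 0 := rfl

theorem toEuclideanCLM_kronecker_one (a : Matrix ι ι ℂ) (v : EuclideanSpace ℂ (ι × κ)) :
    Matrix.toEuclideanCLM (𝕜 := ℂ) (a ⊗ₖ (1 : Matrix κ κ ℂ)) v
      = ∑ j : κ, embedFiber j (Matrix.toEuclideanCLM (𝕜 := ℂ) a (sliceFiber j v)) := by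
  ext ⟨i, j⟩
  rw [Matrix.ofLp_toEuclideanCLM]
  simp [embedFiber_apply, sliceFiber_apply, Matrix.mulVec, dotProduct, Fintype.sum_prod_type,
    Matrix.kroneckerMap_apply, Matrix.one_apply]

/-- The map from `ℂ^ι ⊗ ℂ^κ` to the component along the basis vector `j` of `ℂ^κ`, fiberwise. -/
noncomputable def sliceOp (j : κ) : Hil d (ι × κ) →L[ℂ] Hil d ι :=
  fiberOp (fun _ => sliceFiber j) ‖(sliceFiber j : EuclideanSpace ℂ (ι × κ) →L[ℂ] _)‖
    fun _ => le_rfl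

/-- The tensor product with the basis vector `j` of `ℂ^κ`, fiberwise. -/
noncomputable def embedOp (j : κ) : Hil d ι →L[ℂ] Hil d (ι × κ) :=
  fiberOp (fun _ => embedFiber j) ‖(embedFiber j : _ →L[ℂ] EuclideanSpace ℂ (ι × κ))‖
    fun _ => le_rfl

theorem sliceOp_apply (j : κ) (ψ : Hil d (ι × κ)) (x : Lattice d) :
    sliceOp j ψ x = sliceFiber j (ψ x) := rfl

theorem IsKernelOp.hasSum_embedOp {k : Lattice d → Lattice d → Matrix ι ι ℂ}
    {A : Hil d ι →L[ℂ] Hil d ι} (h : IsKernelOp k A) (j : κ) (ψ : Hil d (ι × κ)) (x : Lattice d) :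
    HasSum (fun y => embedFiber j (Matrix.toEuclideanCLM (𝕜 := ℂ) (k x y) (sliceFiber j (ψ y))))
      ((embedOp j (A (sliceOp j ψ)) : Hil d (ι × κ)) x) := by
  have h1 := h (sliceOp j ψ) x
  have h2 := h1.mapL (embedFiber j : EuclideanSpace ℂ ι →L[ℂ] EuclideanSpace ℂ (ι × κ))
  simp only [sliceOp_apply] at h2
  exact h2

theorem sum_op_apply {γ : Type*} (s : Finset γ) (B : γ → Hil d ι →L[ℂ] Hil d ι)
    (ψ : Hil d ι) (x : Lattice d) : (∑ j ∈ s, B j) ψ x = ∑ j ∈ s, B j ψ x := by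
  classical
  induction s using Finset.induction_on with
  | empty => simp
  | insert a s ha ih =>
    rw [Finset.sum_insert ha, Finset.sum_insert ha, ← ih]
    rfl

/-- The operator A ⊗ 1 consists of one copy of A for each basis vector of ℂ^κ. Its existence ensures
that `kernelOp` does not fall back to the default 0. -/
theorem IsKernelOp.exists_kronecker_one {k : Lattice d → Lattice d → Matrix ι ι ℂ}
    {A : Hil d ι →L[ℂ] Hil d ι} (h : IsKernelOp k A) :
    ∃ B, IsKernelOp (fun x y => k x y ⊗ₖ (1 : Matrix κ κ ℂ)) B := by
  refine ⟨∑ j : κ, embedOp j ∘L A ∘L sliceOp j, fun ψ x => ?_⟩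
  simp only [toEuclideanCLM_kronecker_one]
  rw [sum_op_apply]
  exact hasSum_sum fun j _ => h.hasSum_embedOp j ψ x

end Kernels

/-! ### Products of infinite matrices as sums over paths -/

section Paths

variable {L R : Type*}

/-- The product `r(z_0) K_0(z_0, z_1) ⋯ K_{n-1}(z_{n-1}, z_n)` along a path. -/
def pathProd [Mul R] (r : L → R) (K : ℕ → L → L → R) : (n : ℕ) → (Fin (n + 1) → L) → R
  | 0, z => r (z 0)
  | n + 1, z => pathProd r K n (Fin.init z) * K n (z (Fin.last n).castSucc) (z (Fin.last (n + 1)))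

theorem pathProd_zero [Mul R] (r : L → R) (K : ℕ → L → L → R) (z : Fin 1 → L) :
    pathProd r K 0 z = r (z 0) := rfl

theorem pathProd_succ [Mul R] (r : L → R) (K : ℕ → L → L → R) (n : ℕ) (z : Fin (n + 2) → L) :
    pathProd r K (n + 1) z = pathProd r K n (Fin.init z)
      * K n (z (Fin.last n).castSucc) (z (Fin.last (n + 1))) := rfl

theorem pathProd_eq_prod [CommMonoid R] (r : L → R) (K : ℕ → L → L → R) (n : ℕ)
    (z : Fin (n + 1) → L) :
    pathProd r K n z = r (z 0) * ∏ i : Fin n, K i (z i.castSucc) (z i.succ) := by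
  induction n with
  | zero => simp [pathProd_zero]
  | succ n ih =>
    rw [pathProd_succ, ih, Fin.prod_univ_castSucc, mul_assoc]
    rfl

theorem pathProd_eq_mul_prod_ofFn [Monoid R] (r : L → R) (K : ℕ → L → L → R) (n : ℕ)
    (z : Fin (n + 1) → L) :
    pathProd r K n z = r (z 0) * (List.ofFn fun i : Fin n => K i (z i.castSucc) (z i.succ)).prod := by
  induction n with
  | zero => simp [pathProd_zero]
  | succ n ih =>
    rw [pathProd_succ, ih, List.ofFn_succ', List.prod_concat, mul_assoc]
    rfl

theorem norm_pathProd_le [NormedRing R] (r : L → R) (K : ℕ → L → L → R) (n : ℕ)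
    (z : Fin (n + 1) → L) :
    ‖pathProd r K n z‖ ≤ ‖r (z 0)‖ * ∏ i : Fin n, ‖K i (z i.castSucc) (z i.succ)‖ := by
  have h : ‖pathProd r K n z‖ ≤ pathProd (fun x => ‖r x‖) (fun m x y => ‖K m x y‖) n z := by
    induction n with
    | zero => exact le_rfl
    | succ n ih =>
      rw [pathProd_succ, pathProd_succ]
      exact (norm_mul_le _ _).trans (by gcongr; exact ih _)
  exact h.trans_eq (pathProd_eq_prod _ _ _ _)

theorem pathProd_smul {S : Type*} [CommMonoid S] [Semigroup R] [MulAction S R]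
    [IsScalarTower S R R] [SMulCommClass S R R]
    (s : L → S) (t : ℕ → L → L → S) (r : L → R) (K : ℕ → L → L → R) (n : ℕ) (z : Fin (n + 1) → L) :
    pathProd (fun x => s x • r x) (fun m x y => t m x y • K m x y) n z
      = (s (z 0) * ∏ i : Fin n, t i (z i.castSucc) (z i.succ)) • pathProd r K n z := by
  rw [← pathProd_eq_prod]
  induction n with
  | zero => rfl
  | succ n ih => rw [pathProd_succ, ih, pathProd_succ, pathProd_succ, smul_mul_smul_comm]

/-- The expansion over paths of an iterated product of infinite matrices. -/
theorem hasSum_pathProd [NormedRing R] [CompleteSpace R] {a : ℕ → L → R} {K : ℕ → L → L → R} {N : ℕ}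
    (ha : ∀ m < N, ∀ y, a (m + 1) y = ∑' x, a m x * K m x y)
    (hs : ∀ n ≤ N, Summable fun z : Fin (n + 1) → L => ‖pathProd (a 0) K n z‖) (n : ℕ) (hn : n ≤ N)
    (y : L) :
    HasSum (fun p : Fin n → L => pathProd (a 0) K n (Fin.snoc p y : Fin (n + 1) → L)) (a n y) := by
  induction n generalizing y with
  | zero =>
    convert hasSum_unique (α := R) (β := Fin 0 → L) _ using 1
    rfl
  | succ n ih =>
    rw [ha n (by omega) y]
    let e : L × (Fin n → L) ≃ (Fin (n + 1) → L) := Fin.snocEquiv fun _ => L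
    rw [← e.hasSum_iff]
    -- Absolute summability over all paths allows summing over the earlier vertices first and over
    -- the last free vertex afterwards.
    have hsum : Summable fun p : L × (Fin n → L) =>
        pathProd (a 0) K (n + 1) (Fin.snoc (e p) y : Fin (n + 2) → L) := by
      have h1 := (hs (n + 1) hn).of_norm
      exact h1.comp_injective (i := fun p => (Fin.snoc (e p) y : Fin (n + 2) → L)) fun p q hpq => by
        have := congrArg Fin.init hpq
        simp only [Fin.init_snoc] at this
        exact e.injective this
    have h2 : ∀ x, HasSum (fun p : Fin n → L =>
        pathProd (a 0) K (n + 1) (Fin.snoc (e (x, p)) y : Fin (n + 2) → L)) (a n x * K n x y) := by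
      intro x
      have h3 := (ih (by omega) x).mul_right (K n x y)
      refine h3.congr_fun fun p => ?_
      rw [pathProd_succ, Fin.init_snoc, Fin.snoc_last]
      congr 2
      rw [Fin.snoc_castSucc]
      exact Fin.snoc_last (α := fun _ => L) x p
    have h4 := hsum.hasSum.prod_fiberwise h2
    rw [h4.tsum_eq]
    exact hsum.hasSum

end Paths

/-! ### Summability over paths -/

section PathSums

variable {L : Type*} [AddCommGroup L]

/-- Path sums with translation invariant steps. -/
theorem summable_prod_steps {g : L → ℝ} {h : L → ℝ} (hg : Summable g) (hh : Summable h)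
    (hg0 : ∀ x, 0 ≤ g x) (hh0 : ∀ x, 0 ≤ h x) (n : ℕ) :
    Summable fun z : Fin (n + 1) → L => g (z 0) * ∏ i : Fin n, h (z i.succ - z i.castSucc) := by
  induction n with
  | zero =>
    simp only [Finset.univ_eq_empty, Finset.prod_empty, mul_one]
    exact (Equiv.funUnique (Fin 1) L).summable_iff.mpr hg
  | succ n ih =>
    -- In terms of the last increment instead of the last vertex, the summand factorizes.
    let e : (Fin (n + 1) → L) × L ≃ (Fin (n + 2) → L) :=
      (((Equiv.refl _).prodShear fun z => Equiv.addLeft (z (Fin.last n)))).trans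
        ((Equiv.prodComm _ _).trans (Fin.snocEquiv fun _ => L))
    rw [← e.summable_iff]
    refine (ih.mul_of_nonneg hh (fun z => mul_nonneg (hg0 _) (Finset.prod_nonneg fun _ _ => hh0 _))
      hh0).congr fun p => ?_
    obtain ⟨z, u⟩ := p
    have he : e (z, u) = (Fin.snoc z (z (Fin.last n) + u) : Fin (n + 2) → L) := rfl
    simp only [Function.comp_apply, he]
    rw [Fin.prod_univ_castSucc, ← mul_assoc]
    congr 1
    · congr 1
      refine Finset.prod_congr rfl fun i _ => ?_
      rw [← Fin.castSucc_succ, Fin.snoc_castSucc, Fin.snoc_castSucc]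
    · rw [Fin.succ_last, Fin.snoc_last, Fin.snoc_castSucc, add_sub_cancel_left]

end PathSums

/-! ### Estimates for the Dirac phase -/

section PhaseKernel

open scoped Matrix.Norms.L2Operator

variable {d N : ℕ} {σ : Fin d → Matrix (CliffIdx d) (CliffIdx d) ℂ} (hσ : IsCliffordRep σ)

/-- Factor A ⊗ B = (A ⊗ 1)(1 ⊗ B); each factor is linear in a finite-dimensional variable. -/
theorem exists_norm_kronecker_le (m n : Type*) [Fintype m] [DecidableEq m] [Fintype n]
    [DecidableEq n] : ∃ C : ℝ, 0 ≤ C ∧ ∀ (A : Matrix m m ℂ) (B : Matrix n n ℂ),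
      ‖A ⊗ₖ B‖ ≤ C * (‖A‖ * ‖B‖) := by
  let T₁ := LinearMap.toContinuousLinearMap ((Matrix.kroneckerBilinear (R := ℂ) (α := ℂ) (l := m) (m := m)
    (n := n) (p := n)).flip 1)
  let T₂ := LinearMap.toContinuousLinearMap (Matrix.kroneckerBilinear (R := ℂ) (α := ℂ) (l := m) (m := m)
    (n := n) (p := n) 1)
  refine ⟨‖T₁‖ * ‖T₂‖, by positivity, fun A B => ?_⟩
  have h : A ⊗ₖ B = T₁ A * T₂ B := by
    change A ⊗ₖ B = (A ⊗ₖ (1 : Matrix n n ℂ)) * ((1 : Matrix m m ℂ) ⊗ₖ B)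
    rw [← Matrix.mul_kronecker_mul, mul_one, one_mul]
  rw [h]
  calc _ ≤ ‖T₁ A‖ * ‖T₂ B‖ := norm_mul_le _ _
    _ ≤ (‖T₁‖ * ‖A‖) * (‖T₂‖ * ‖B‖) := by
      gcongr
      · exact T₁.le_opNorm A
      · exact T₂.le_opNorm B
    _ = _ := by ring

theorem shiftVec_eq_add (x₀ : Fin d → ℝ) (x : Lattice d) :
    shiftVec x₀ x = WithLp.toLp 2 x₀ + shiftVec 0 x := by
  ext j
  simp [shiftVec, add_comm]

theorem phaseFiber_eq_cliff {x₀ : Fin d → ℝ} {x : Lattice d} (h : shiftVec x₀ x ≠ 0) :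
    phaseFiber σ x₀ x = cliff σ (unitVec (shiftVec x₀ x)) := by
  rw [phaseFiber, if_neg h, unitVec, map_smul, cliff_apply]
  rfl

include hσ in
theorem phaseFiber_mul_self (x₀ : Fin d → ℝ) (x : Lattice d) :
    phaseFiber σ x₀ x * phaseFiber σ x₀ x = 1 := by
  by_cases h : shiftVec x₀ x = 0
  · rw [phaseFiber, if_pos h, one_mul]
  · rw [phaseFiber_eq_cliff h, cliff_mul_self hσ, norm_unitVec h]
    simp

theorem exists_norm_phaseFiber_le (σ : Fin d → Matrix (CliffIdx d) (CliffIdx d) ℂ) :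
    ∃ C : ℝ, 0 ≤ C ∧ ∀ (x₀ : Fin d → ℝ) (x : Lattice d), ‖phaseFiber σ x₀ x‖ ≤ C := by
  obtain ⟨C, hC, h⟩ := exists_norm_cliff_le σ
  refine ⟨‖(1 : Matrix (CliffIdx d) (CliffIdx d) ℂ)‖ + C, by positivity, fun x₀ x => ?_⟩
  by_cases hx : shiftVec x₀ x = 0
  · rw [phaseFiber, if_pos hx]
    linarith
  · rw [phaseFiber_eq_cliff hx]
    have := h (unitVec (shiftVec x₀ x))
    rw [norm_unitVec hx, mul_one] at this
    linarith [norm_nonneg (1 : Matrix (CliffIdx d) (CliffIdx d) ℂ)]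

theorem isKernelOp_diracPhase (N : ℕ) (σ : Fin d → Matrix (CliffIdx d) (CliffIdx d) ℂ)
    (x₀ : Fin d → ℝ) : IsKernelOp (fun x y => if x = y then
      (1 : Matrix (Fin N) (Fin N) ℂ) ⊗ₖ phaseFiber σ x₀ x else 0) (diracPhase N σ x₀) := by
  obtain ⟨C, hC, h⟩ := exists_norm_phaseFiber_le σ
  obtain ⟨C', hC', h'⟩ := exists_norm_kronecker_le (Fin N) (CliffIdx d)
  refine isKernelOp_kernelOp (isKernelOp_fiberOp _
    (C' * (‖(1 : Matrix (Fin N) (Fin N) ℂ)‖ * C)) fun x => (h' _ _).trans ?_)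
  gcongr
  exact h _ _

include hσ in
theorem diracPhase_mul_self (x₀ : Fin d → ℝ) : diracPhase N σ x₀ * diracPhase N σ x₀ = 1 := by
  have hF := isKernelOp_diracPhase N σ x₀
  have h1 : ∀ (ψ : Hil d (Fin N × CliffIdx d)) x, diracPhase N σ x₀ ψ x
      = Matrix.toEuclideanCLM (𝕜 := ℂ) ((1 : Matrix (Fin N) (Fin N) ℂ) ⊗ₖ phaseFiber σ x₀ x)
        (ψ x) := fun ψ x => by
    have h := hasSum_single (f := fun y => Matrix.toEuclideanCLM (𝕜 := ℂ)
      (if x = y then (1 : Matrix (Fin N) (Fin N) ℂ) ⊗ₖ phaseFiber σ x₀ x else 0) (ψ y)) x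
      fun y hy => by rw [if_neg hy.symm, map_zero]; rfl
    rw [if_pos rfl] at h
    exact (hF ψ x).unique h
  refine ContinuousLinearMap.ext fun ψ => ?_
  ext1
  funext x
  have h2 : (diracPhase N σ x₀ * diracPhase N σ x₀) ψ x
      = diracPhase N σ x₀ (diracPhase N σ x₀ ψ) x := rfl
  rw [h2, h1, h1]
  have h3 := congrArg (fun T => T (ψ x)) (map_mul (Matrix.toEuclideanCLM (𝕜 := ℂ))
    ((1 : Matrix (Fin N) (Fin N) ℂ) ⊗ₖ phaseFiber σ x₀ x)
    ((1 : Matrix (Fin N) (Fin N) ℂ) ⊗ₖ phaseFiber σ x₀ x))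
  rw [← Matrix.mul_kronecker_mul, phaseFiber_mul_self hσ, one_mul, Matrix.one_kronecker_one,
    map_one] at h3
  exact h3.symm

theorem norm_le_sum_abs (v : Euc d) : ‖v‖ ≤ ∑ i, |v i| := by
  have h : v = ∑ i, (v i) • EuclideanSpace.basisFun (Fin d) ℝ i := by
    ext j
    simp [Pi.single_apply]
  conv_lhs => rw [h]
  refine (norm_sum_le _ _).trans (Finset.sum_le_sum fun i _ => ?_)
  rw [norm_smul, OrthonormalBasis.norm_eq_one, mul_one, Real.norm_eq_abs]

/-- The weight that controls the commutator with the phase. -/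
noncomputable def stepWeight (x y : Lattice d) : ℝ := ‖x - y‖ / (1 + ‖x‖)

theorem stepWeight_nonneg (x y : Lattice d) : 0 ≤ stepWeight x y := by
  unfold stepWeight; positivity

theorem one_le_norm_of_ne_zero {x : Lattice d} (h : x ≠ 0) : 1 ≤ ‖x‖ := by
  obtain ⟨i, hi⟩ := Function.ne_iff.mp h
  refine le_trans ?_ (norm_le_pi_norm x i)
  rw [Int.norm_eq_abs]
  exact_mod_cast Int.one_le_abs hi

/-- The lattice carries the sup norm. For ‖x‖ ≤ 2, where x + x₀ may be arbitrarily short, the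
trivial bound 2 suffices because distinct lattice points are at distance at least 1; this costs the
constant 6. Otherwise ‖x + x₀‖ ≥ ‖x‖ - 1 ≥ (1 + ‖x‖)/3, which costs 6d. -/
theorem norm_unitVec_shiftVec_sub_le {x₀ : Fin d → ℝ} (hx₀ : x₀ ∈ Set.Icc (0 : Fin d → ℝ) 1)
    (hz : ∀ x, shiftVec x₀ x ≠ 0) (x y : Lattice d) :
    ‖unitVec (shiftVec x₀ x) - unitVec (shiftVec x₀ y)‖ ≤ (6 * d + 6) * stepWeight x y := by
  by_cases hxy : x = y
  · simp [hxy, stepWeight]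
  have h1 : 1 ≤ ‖x - y‖ := one_le_norm_of_ne_zero (sub_ne_zero.mpr hxy)
  rw [stepWeight, mul_div_assoc', le_div_iff₀ (by positivity)]
  by_cases hx : ‖x‖ ≤ 2
  · have h2 : ‖unitVec (shiftVec x₀ x) - unitVec (shiftVec x₀ y)‖ ≤ 2 := by
      refine (norm_sub_le _ _).trans ?_
      rw [norm_unitVec (hz x), norm_unitVec (hz y)]
      norm_num
    have h3 : (0 : ℝ) ≤ d := Nat.cast_nonneg d
    nlinarith [norm_nonneg x, norm_nonneg (unitVec (shiftVec x₀ x) - unitVec (shiftVec x₀ y))]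
  · push Not at hx
    have h2 : ‖x‖ ≤ ‖shiftVec x₀ x‖ + 1 := by
      refine (pi_norm_le_iff_of_nonneg (by positivity)).mpr fun i => ?_
      have h3 := PiLp.norm_apply_le (shiftVec x₀ x) i
      simp only [shiftVec] at h3 ⊢
      rw [Real.norm_eq_abs] at h3
      rw [Int.norm_eq_abs]
      have h4 : (0 : ℝ) ≤ x₀ i := hx₀.1 i
      have h5 : x₀ i ≤ 1 := hx₀.2 i
      rw [abs_le] at h3 ⊢
      constructor <;> linarith [h3.1, h3.2]
    have h3 : ‖shiftVec x₀ x - shiftVec x₀ y‖ ≤ d * ‖x - y‖ := by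
      refine (norm_le_sum_abs _).trans ?_
      calc _ ≤ ∑ i : Fin d, ‖x - y‖ := by
            refine Finset.sum_le_sum fun i _ => ?_
            refine le_trans (le_of_eq ?_) (norm_le_pi_norm (x - y) i)
            rw [Int.norm_eq_abs]
            simp [shiftVec]
        _ = _ := by simp
    have h4 := norm_unitVec_sub_le (hz x) (hz y)
    have h5 : 0 < ‖shiftVec x₀ x‖ := norm_pos_iff.mpr (hz x)
    rw [le_div_iff₀ h5] at h4
    have h6 : 1 + ‖x‖ ≤ 3 * ‖shiftVec x₀ x‖ := by linarith
    calc _ ≤ ‖unitVec (shiftVec x₀ x) - unitVec (shiftVec x₀ y)‖ * (3 * ‖shiftVec x₀ x‖) := by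
          gcongr
      _ ≤ 3 * (2 * (d * ‖x - y‖)) := by linarith
      _ ≤ _ := by nlinarith [norm_nonneg (x - y)]

end PhaseKernel

/-! ### Path expansion of products and the form of top degree -/

section TraceFormula

set_option linter.unusedSectionVars false

open scoped Matrix.Norms.L2Operator

variable {d N : ℕ} {ι : Type} [Fintype ι] [DecidableEq ι]

theorem hasSum_kern_mul_prod (A : Hil d ι →L[ℂ] Hil d ι) (C : ℕ → Hil d ι →L[ℂ] Hil d ι)
    (x : Lattice d) (n : ℕ) (hs : ∀ m ≤ n, Summable fun z : Fin (m + 1) → Lattice d =>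
      ‖pathProd (kern A x) (fun m => kern (C m)) m z‖) (y : Lattice d) :
    HasSum (fun p : Fin n → Lattice d => pathProd (kern A x) (fun m => kern (C m)) n
      (Fin.snoc p y : Fin (n + 1) → Lattice d))
      (kern (A * (List.ofFn fun i : Fin n => C i).prod) x y) := by
  have h0 : kern (A * (List.ofFn fun i : Fin 0 => C i).prod) x = kern A x := by simp
  have h := hasSum_pathProd (N := n)
    (a := fun m => kern (A * (List.ofFn fun i : Fin m => C i).prod) x)
    (K := fun m => kern (C m)) (fun m _ y => ?_) (fun m hm => ?_) n le_rfl y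
  · simpa only [h0] using h
  · rw [List.ofFn_succ', List.prod_concat, ← mul_assoc]
    exact (hasSum_kern_mul _ _ x y).tsum_eq.symm
  · simpa only [h0] using hs m hm

/-- As F² = 1, F anticommutes with every commutator [F, B]. Moving it through an odd number of them
turns Fη + ηF into one further commutator, the one with A. -/
theorem mul_qDiff_eq {F A : Hil d ι →L[ℂ] Hil d ι} {n : ℕ} (hn : Odd n) (hF : F * F = 1)
    (B : Fin n → Hil d ι →L[ℂ] Hil d ι) :
    F * qDiff F n (A * (List.ofFn fun i => F * B i - B i * F).prod)
      = F * ((F * A - A * F) * (List.ofFn fun i => F * B i - B i * F).prod) := by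
  have hcomm : ∀ (m : ℕ) (B : Fin m → Hil d ι →L[ℂ] Hil d ι),
      (List.ofFn fun i => F * B i - B i * F).prod * F
        = (-1 : ℂ) ^ m • (F * (List.ofFn fun i => F * B i - B i * F).prod) := by
    intro m
    induction m with
    | zero => intro B; simp
    | succ m ih =>
      intro B
      have h1 : (F * B 0 - B 0 * F) * F = - (F * (F * B 0 - B 0 * F)) := by
        have e1 : (F * B 0 - B 0 * F) * F = F * B 0 * F - B 0 * (F * F) := by noncomm_ring
        have e2 : F * (F * B 0 - B 0 * F) = (F * F) * B 0 - F * B 0 * F := by noncomm_ring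
        rw [e1, e2, hF]; noncomm_ring
      rw [List.ofFn_succ, List.prod_cons, mul_assoc, ih fun i => B i.succ, mul_smul_comm,
        ← mul_assoc, h1, pow_succ, mul_neg_one, neg_smul, neg_mul, smul_neg, mul_assoc]
  set Q := (List.ofFn fun i => F * B i - B i * F).prod with hQ
  have h1 : Q * F = -(F * Q) := by
    rw [hcomm n B, hn.neg_one_pow, neg_one_smul]
  rw [qDiff, hn.neg_one_pow, neg_one_smul, sub_neg_eq_add, mul_assoc A Q F, h1]
  congr 1
  noncomm_ring

theorem opTrace_eq_tsum_trace {T : Hil d ι →L[ℂ] Hil d ι}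
    (h : Summable fun p : Lattice d × ι => ‖T (ket p)‖) :
    opTrace T = ∑' x, (kern T x x).trace := by
  have hs : Summable fun p : Lattice d × ι => inner ℂ (ket p) (T (ket p)) := by
    refine Summable.of_norm_bounded h fun p => ?_
    refine (norm_inner_le_norm _ _).trans_eq ?_
    rw [norm_ket, one_mul]
  rw [opTrace, hs.tsum_prod]
  refine tsum_congr fun x => ?_
  rw [tsum_fintype, Matrix.trace]
  refine Finset.sum_congr rfl fun i _ => ?_
  rw [inner_ket]
  rfl

end TraceFormula

/-! ### The graded trace as a sum over loops -/

section GradedTrace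

open scoped Matrix.Norms.L2Operator

variable {d N : ℕ} {σ : Fin d → Matrix (CliffIdx d) (CliffIdx d) ℂ}

theorem pathProd_kronecker {L m n : Type*} [Fintype m] [Fintype n]
    (r : L → Matrix m m ℂ) (s : L → Matrix n n ℂ) (K : ℕ → L → L → Matrix m m ℂ)
    (J : ℕ → L → L → Matrix n n ℂ) (k : ℕ) (z : Fin (k + 1) → L) :
    pathProd (fun x => r x ⊗ₖ s x) (fun m x y => K m x y ⊗ₖ J m x y) k z
      = pathProd r K k z ⊗ₖ pathProd s J k z := by
  induction k with
  | zero => rfl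
  | succ k ih =>
    rw [pathProd_succ, ih, pathProd_succ, pathProd_succ, Matrix.mul_kronecker_mul]

/-- The loop `z_n, z_0, z_1, …, z_n` expressed as a product of matrix elements. -/
noncomputable def loopProd (a : ℕ → Lattice d → Lattice d → Matrix (Fin N) (Fin N) ℂ) (n : ℕ)
    (z : Fin (n + 1) → Lattice d) : Matrix (Fin N) (Fin N) ℂ :=
  pathProd (a 0 (z (Fin.last n))) (fun m => a (m + 1)) n z

/-- The product of the weights along the path `x, z_0, …, z_n`. -/
noncomputable def pathWeight (a : ℕ → Lattice d → Lattice d → Matrix (Fin N) (Fin N) ℂ)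
    (n : ℕ) (x : Lattice d) (z : Fin (n + 1) → Lattice d) : ℝ :=
  ‖a 0 x (z 0)‖ * ∏ i : Fin n, ‖a (i + 1) (z i.castSucc) (z i.succ)‖

/-- The product of the steps weights along the path `x, z_0, …, z_n`. -/
noncomputable def pathStepWeight (n : ℕ) (x : Lattice d) (z : Fin (n + 1) → Lattice d) : ℝ :=
  stepWeight x (z 0) * ∏ i : Fin n, stepWeight (z i.castSucc) (z i.succ)

theorem pathWeight_nonneg (a : ℕ → Lattice d → Lattice d → Matrix (Fin N) (Fin N) ℂ)
    (n : ℕ) (x : Lattice d) (z : Fin (n + 1) → Lattice d) : 0 ≤ pathWeight a n x z := by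
  unfold pathWeight; positivity

theorem pathStepWeight_nonneg (n : ℕ) (x : Lattice d) (z : Fin (n + 1) → Lattice d) :
    0 ≤ pathStepWeight n x z :=
  mul_nonneg (stepWeight_nonneg _ _) (Finset.prod_nonneg fun _ _ => stepWeight_nonneg _ _)

/-- The determinant of the unit vectors in the directions `z_i + x₀`. -/
noncomputable def loopDet (x₀ : Fin d → ℝ) (z : Fin (d + 1) → Lattice d) : ℝ :=
  simplexDet unitVec (fun i => shiftVec 0 (z i)) (WithLp.toLp 2 x₀)

theorem loopDet_eq (x₀ : Fin d → ℝ) (z : Fin (d + 1) → Lattice d) :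
    loopDet x₀ z = stdDet d fun i : Fin d =>
      unitVec (shiftVec x₀ (z i.castSucc)) - unitVec (shiftVec x₀ (z i.succ)) := by
  simp only [loopDet, simplexDet, ← shiftVec_eq_add]

/-- The edge from z_d back to z_0 counts as a step too: starting the path weight at z_d records all
d + 1 edges of the loop, uniformly in x₀. -/
theorem exists_abs_loopDet_le (hσ : IsCliffordRep σ) (hd : Odd d) : ∃ C : ℝ, 0 ≤ C ∧
    ∀ x₀ ∈ Set.Icc (0 : Fin d → ℝ) 1, (∀ x, shiftVec x₀ x ≠ 0) → ∀ z,
      |loopDet x₀ z| ≤ C * pathStepWeight d (z (Fin.last d)) z := by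
  obtain ⟨C, hC, h⟩ := exists_abs_stdDet_sub_le hσ hd
  refine ⟨C * ((6 * d + 6) * (6 * d + 6) ^ d), by positivity, fun x₀ hx₀ hz z => ?_⟩
  rw [loopDet_eq]
  refine (h (fun i => unitVec (shiftVec x₀ (z i))) fun i => norm_unitVec (hz _)).trans ?_
  have hw := norm_unitVec_shiftVec_sub_le hx₀ hz
  have hnn := stepWeight_nonneg (d := d)
  calc _ ≤ C * (((6 * d + 6) * stepWeight (z (Fin.last d)) (z 0)) *
        ∏ i : Fin d, ((6 * d + 6) * stepWeight (z i.castSucc) (z i.succ))) := by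
        refine mul_le_mul_of_nonneg_left (mul_le_mul (hw _ _) ?_ (by positivity)
          (mul_nonneg (by positivity) (hnn _ _))) hC
        exact Finset.prod_le_prod (fun _ _ => norm_nonneg _) fun _ _ => hw _ _
    _ = _ := by
      rw [Finset.prod_mul_distrib, Finset.prod_const, Finset.card_univ, Fintype.card_fin,
        pathStepWeight]
      ring

variable {a : ℕ → Lattice d → Lattice d → Matrix (Fin N) (Fin N) ℂ}

/-- The operator `A ⊗ 1` with kernel `a ⊗ 1`. -/
noncomputable def ampOp (a : Lattice d → Lattice d → Matrix (Fin N) (Fin N) ℂ) :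
    Hil d (Fin N × CliffIdx d) →L[ℂ] Hil d (Fin N × CliffIdx d) :=
  kernelOp fun x y => a x y ⊗ₖ (1 : Matrix (CliffIdx d) (CliffIdx d) ℂ)

theorem kern_ampOp {a : Lattice d → Lattice d → Matrix (Fin N) (Fin N) ℂ}
    (ha : ∃ A, IsKernelOp a A) (x y : Lattice d) :
    kern (ampOp a) x y = a x y ⊗ₖ (1 : Matrix (CliffIdx d) (CliffIdx d) ℂ) := by
  obtain ⟨A, hA⟩ := ha
  obtain ⟨B, hB⟩ := hA.exists_kronecker_one (κ := CliffIdx d)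
  exact (isKernelOp_kernelOp hB).kern_eq x y

theorem kern_commutator {a : Lattice d → Lattice d → Matrix (Fin N) (Fin N) ℂ}
    (ha : ∃ A, IsKernelOp a A) (x₀ : Fin d → ℝ) (x y : Lattice d) :
    kern (diracPhase N σ x₀ * ampOp a - ampOp a * diracPhase N σ x₀) x y
      = a x y ⊗ₖ (phaseFiber σ x₀ x - phaseFiber σ x₀ y) := by
  rw [kern_sub, kern_mul_of_diag_left (isKernelOp_diracPhase N σ x₀),
    kern_mul_of_diag_right (isKernelOp_diracPhase N σ x₀), kern_ampOp ha,
    ← Matrix.mul_kronecker_mul, ← Matrix.mul_kronecker_mul, one_mul, one_mul, mul_one, mul_one]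
  ext i j
  simp [Matrix.kroneckerMap_apply, mul_sub]

/-- The norm of a product along a path of the elements of a commutator with the phase. -/
theorem norm_pathProd_kronecker_le {C B : ℝ} (hC : 0 ≤ C) (hB : 0 ≤ B)
    (h : ∀ (A : Matrix (Fin N) (Fin N) ℂ) (D : Matrix (CliffIdx d) (CliffIdx d) ℂ),
      ‖A ⊗ₖ D‖ ≤ C * (‖A‖ * ‖D‖))
    {s : Lattice d → Matrix (CliffIdx d) (CliffIdx d) ℂ}
    {J : Lattice d → Lattice d → Matrix (CliffIdx d) (CliffIdx d) ℂ}
    {v : Lattice d → ℝ} {u : Lattice d → Lattice d → ℝ} (hv : ∀ x, 0 ≤ v x)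
    (hs : ∀ x, ‖s x‖ ≤ B * v x) (hJ : ∀ x y, ‖J x y‖ ≤ B * u x y) (x : Lattice d) (n : ℕ)
    (z : Fin (n + 1) → Lattice d) :
    ‖pathProd (fun y => a 0 x y ⊗ₖ s y) (fun m x y => a (m + 1) x y ⊗ₖ J x y) n z‖
      ≤ (C * B) ^ (n + 1) * (pathWeight a n x z
        * (v (z 0) * ∏ i : Fin n, u (z i.castSucc) (z i.succ))) := by
  refine (norm_pathProd_le _ _ _ _).trans ?_
  calc _ ≤ (C * (‖a 0 x (z 0)‖ * (B * v (z 0)))) *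
      ∏ i : Fin n, (C * (‖a (i + 1) (z i.castSucc) (z i.succ)‖ *
        (B * u (z i.castSucc) (z i.succ)))) := by
        refine mul_le_mul ?_ ?_ (by positivity)
          (mul_nonneg hC (mul_nonneg (norm_nonneg _) (mul_nonneg hB (hv _))))
        · exact (h _ _).trans (mul_le_mul_of_nonneg_left
            (mul_le_mul_of_nonneg_left (hs _) (norm_nonneg _)) hC)
        · exact Finset.prod_le_prod (fun _ _ => norm_nonneg _) fun _ _ => (h _ _).trans
            (mul_le_mul_of_nonneg_left (mul_le_mul_of_nonneg_left (hJ _ _) (norm_nonneg _)) hC)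
    _ = _ := by
      simp only [Finset.prod_mul_distrib, Finset.prod_const, Finset.card_univ, Fintype.card_fin,
        pathWeight]
      ring

/-- The form `A_0 [F, A_1] ⋯ [F, A_d]`. -/
noncomputable def formOp (σ : Fin d → Matrix (CliffIdx d) (CliffIdx d) ℂ)
    (a : ℕ → Lattice d → Lattice d → Matrix (Fin N) (Fin N) ℂ) (x₀ : Fin d → ℝ) :
    Hil d (Fin N × CliffIdx d) →L[ℂ] Hil d (Fin N × CliffIdx d) :=
  ampOp (a 0) * (List.ofFn fun i : Fin d => diracPhase N σ x₀ * ampOp (a (i + 1))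
    - ampOp (a (i + 1)) * diracPhase N σ x₀).prod

/-- The equivalence between `((y, x), p)` and the path `x, p_0, …, p_{n-1}, y`. -/
def endpointsEquiv (L : Type*) (n : ℕ) : (L × L) × (Fin n → L) ≃ (L × (Fin (n + 1) → L)) where
  toFun q := (q.1.2, Fin.snoc q.2 q.1.1)
  invFun q := ((q.2 (Fin.last n), q.1), Fin.init q.2)
  left_inv q := by simp
  right_inv q := by simp

/-- Up to the bounded factor F the operator is a product of d + 1 commutators, each with a matrix
element controlled by a step weight. Its kernel is thus summable over rows and columns jointly,
which bounds the sum of the column norms. -/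
theorem summable_norm_apply_ket (hσ : IsCliffordRep σ) (hd : Odd d)
    (ha : ∀ m, ∃ A, IsKernelOp (a m) A) {x₀ : Fin d → ℝ} (hx₀ : x₀ ∈ Set.Icc (0 : Fin d → ℝ) 1)
    (hz : ∀ x, shiftVec x₀ x ≠ 0)
    (h₁ : ∀ x, ∀ n ≤ d, Summable fun z : Fin (n + 1) → Lattice d => pathWeight a n x z)
    (h₂ : Summable fun q : Lattice d × (Fin (d + 1) → Lattice d) =>
      pathWeight a d q.1 q.2 * pathStepWeight d q.1 q.2) :
    Summable fun p : Lattice d × (Fin N × CliffIdx d) => ‖(diracPhase N σ x₀ *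
      qDiff (diracPhase N σ x₀) d (formOp σ a x₀)) (ket p)‖ := by
  obtain ⟨C, hC, hCk⟩ := exists_norm_kronecker_le (Fin N) (CliffIdx d)
  obtain ⟨B, hB, hBk⟩ := exists_norm_phaseFiber_le σ
  obtain ⟨B', hB', hBk'⟩ := exists_norm_cliff_le σ
  set F := diracPhase N σ x₀ with hF
  let K : ℕ → Hil d (Fin N × CliffIdx d) →L[ℂ] Hil d (Fin N × CliffIdx d) := fun m =>
    F * ampOp (a m) - ampOp (a m) * F
  set G := K 0 * (List.ofFn fun i : Fin d => K (i + 1)).prod with hG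
  have hGeq : F * qDiff F d (formOp σ a x₀) = F * G :=
    mul_qDiff_eq hd (diracPhase_mul_self hσ x₀) fun i : Fin d => ampOp (a (i + 1))
  have hK : ∀ m, kern (K m) = fun x y => a m x y ⊗ₖ (phaseFiber σ x₀ x - phaseFiber σ x₀ y) :=
    fun m => funext fun x => funext fun y => kern_commutator (ha m) x₀ x y
  have hphase : ∀ x y, ‖phaseFiber σ x₀ x - phaseFiber σ x₀ y‖ ≤ 2 * B * 1 := fun x y => by
    refine (norm_sub_le _ _).trans ?_
    linarith [hBk x₀ x, hBk x₀ y]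
  have hphase' : ∀ x y, ‖phaseFiber σ x₀ x - phaseFiber σ x₀ y‖
      ≤ B' * (6 * d + 6) * stepWeight x y := fun x y => by
    rw [phaseFiber_eq_cliff (hz x), phaseFiber_eq_cliff (hz y), ← map_sub, mul_assoc]
    exact (hBk' _).trans (mul_le_mul_of_nonneg_left (norm_unitVec_shiftVec_sub_le hx₀ hz x y) hB')
  set M := (C * (B' * (6 * d + 6))) ^ (d + 1) with hM
  let b : (Lattice d × Lattice d) × (Fin d → Lattice d) → ℝ := fun q =>
    M * (pathWeight a d (endpointsEquiv _ d q).1 (endpointsEquiv _ d q).2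
      * pathStepWeight d (endpointsEquiv _ d q).1 (endpointsEquiv _ d q).2)
  have hb : Summable b := ((endpointsEquiv (Lattice d) d).summable_iff.mpr h₂).mul_left M
  have hb0 : ∀ q, 0 ≤ b q := fun q =>
    mul_nonneg (by positivity) (mul_nonneg (pathWeight_nonneg _ _ _ _) (pathStepWeight_nonneg _ _ _))
  have hkern : ∀ x y, ‖kern G x y‖ ≤ ∑' p, b ((y, x), p) := fun x y => by
    have hsum := hasSum_kern_mul_prod (K 0) (fun m => K (m + 1)) x d (fun n hn => ?_) y
    · rw [← hsum.tsum_eq]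
      refine tsum_of_norm_bounded (hb.prod_factor (y, x)).hasSum fun p => ?_
      simp only [hK]
      exact norm_pathProd_kronecker_le hC (by positivity) hCk (fun y => stepWeight_nonneg x y)
        (hphase' x) hphase' x d _
    -- For the path expansion to be legitimate, boundedness of the phase is enough; the step weights
    -- serve only for the final bound.
    · refine Summable.of_nonneg_of_le (fun _ => norm_nonneg _) (fun z => ?_)
        ((h₁ x n hn).mul_left ((C * (2 * B)) ^ (n + 1)))
      simp only [hK]
      have := norm_pathProd_kronecker_le (a := a) hC (by positivity) hCk
        (v := fun _ => 1) (u := fun _ _ => 1) (fun _ => zero_le_one)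
        (hphase x) hphase x n z
      simpa using this
  have hb1 : Summable fun q : Lattice d × Lattice d => ∑' p, b (q, p) := hb.prod
  have hb2 : Summable fun y : Lattice d => ∑' x, ∑' p, b ((y, x), p) := hb1.prod
  have hket : ∀ (y : Lattice d) j, ‖G (ket (y, j))‖ ≤ ∑' x, ∑' p, b ((y, x), p) := fun y j => by
    have h3 : Summable fun x => ‖kern G x y‖ := Summable.of_nonneg_of_le
      (fun _ => norm_nonneg _) (fun x => hkern x y) (hb1.prod_factor y)
    exact (norm_apply_ket_le h3 j).trans
      (h3.tsum_le_tsum (fun x => hkern x y) (hb1.prod_factor y))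
  have hfin : Summable fun p : Lattice d × (Fin N × CliffIdx d) =>
      (∑' x, ∑' q, b ((p.1, x), q)) * (1 : ℝ) :=
    hb2.mul_of_nonneg (g := fun _ : Fin N × CliffIdx d => (1 : ℝ)) (Summable.of_finite)
      (fun y => tsum_nonneg fun x => tsum_nonneg fun p => hb0 _)
      (fun _ => zero_le_one)
  rw [hGeq]
  refine Summable.of_nonneg_of_le (fun _ => norm_nonneg _) (fun p => ?_) (hfin.mul_left ‖F‖)
  refine (F.le_opNorm (G (ket p))).trans ?_
  rw [mul_one]
  exact mul_le_mul_of_nonneg_left (hket p.1 p.2) (norm_nonneg _)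

theorem trace_kern_formOp (hσ : IsCliffordRep σ) (hd : Odd d)
    (ha : ∀ m, ∃ A, IsKernelOp (a m) A) {x₀ : Fin d → ℝ} (hz : ∀ x, shiftVec x₀ x ≠ 0)
    (h₁ : ∀ x, ∀ n ≤ d, Summable fun z : Fin (n + 1) → Lattice d => pathWeight a n x z)
    (x : Lattice d) :
    HasSum (fun p : Fin d → Lattice d =>
      (loopProd a d (Fin.snoc p x)).trace * (cliffConst d * (loopDet x₀ (Fin.snoc p x) : ℂ)))
      (kern (formOp σ a x₀) x x).trace := by
  obtain ⟨C, hC, hCk⟩ := exists_norm_kronecker_le (Fin N) (CliffIdx d)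
  obtain ⟨B, hB, hBk⟩ := exists_norm_phaseFiber_le σ
  set F := diracPhase N σ x₀ with hF
  let K : ℕ → Hil d (Fin N × CliffIdx d) →L[ℂ] Hil d (Fin N × CliffIdx d) := fun m =>
    F * ampOp (a m) - ampOp (a m) * F
  have hK : ∀ m, kern (K m) = fun x y => a m x y ⊗ₖ (phaseFiber σ x₀ x - phaseFiber σ x₀ y) :=
    fun m => funext fun x => funext fun y => kern_commutator (ha m) x₀ x y
  have hA : kern (ampOp (a 0)) x
      = fun y => a 0 x y ⊗ₖ (1 : Matrix (CliffIdx d) (CliffIdx d) ℂ) :=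
    funext fun y => kern_ampOp (ha 0) x y
  set D := 2 * B + ‖(1 : Matrix (CliffIdx d) (CliffIdx d) ℂ)‖ with hD
  have hphase : ∀ x y, ‖phaseFiber σ x₀ x - phaseFiber σ x₀ y‖ ≤ D * 1 := fun x y => by
    refine (norm_sub_le _ _).trans ?_
    linarith [hBk x₀ x, hBk x₀ y, norm_nonneg (1 : Matrix (CliffIdx d) (CliffIdx d) ℂ)]
  have hsum := hasSum_kern_mul_prod (ampOp (a 0)) (fun m => K (m + 1)) x d (fun n hn => ?_) x
  · have htr := hsum.mapL (LinearMap.toContinuousLinearMap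
      (Matrix.traceLinearMap (Fin N × CliffIdx d) ℂ ℂ))
    refine HasSum.congr_fun htr fun p => ?_
    simp only [hA, hK, LinearMap.coe_toContinuousLinearMap', Matrix.traceLinearMap_apply]
    rw [pathProd_kronecker (a 0 x) (fun _ => 1) (fun m => a (m + 1))
      (fun _ x y => phaseFiber σ x₀ x - phaseFiber σ x₀ y), Matrix.trace_kronecker]
    congr 1
    · rw [loopProd, Fin.snoc_last]
    · rw [pathProd_eq_mul_prod_ofFn, one_mul, loopDet_eq, ← trace_prod_cliff hσ hd]
      simp only [phaseFiber_eq_cliff (hz _), map_sub]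
  · refine Summable.of_nonneg_of_le (fun _ => norm_nonneg _) (fun z => ?_)
      ((h₁ x n hn).mul_left ((C * D) ^ (n + 1)))
    simp only [hK, hA]
    have := norm_pathProd_kronecker_le (a := a) hC (B := D) (by positivity) hCk
      (v := fun _ => 1) (u := fun _ _ => 1) (fun _ => zero_le_one)
      (s := fun _ => 1) (by intro; linarith) hphase x n z
    simpa using this

/-- F acts on each fiber with square 1, so at every site FFη and FηF have the same diagonal trace as
η. Hence Tr' is the sum of the diagonal traces of η, and η itself need not be shown to be trace
class. -/
theorem gradedTrace_formOp (hσ : IsCliffordRep σ) (hd : Odd d)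
    (ha : ∀ m, ∃ A, IsKernelOp (a m) A) {x₀ : Fin d → ℝ} (hx₀ : x₀ ∈ Set.Icc (0 : Fin d → ℝ) 1)
    (hz : ∀ x, shiftVec x₀ x ≠ 0)
    (h₁ : ∀ x, ∀ n ≤ d, Summable fun z : Fin (n + 1) → Lattice d => pathWeight a n x z)
    (h₂ : Summable fun q : Lattice d × (Fin (d + 1) → Lattice d) =>
      pathWeight a d q.1 q.2 * pathStepWeight d q.1 q.2) :
    gradedTrace (diracPhase N σ x₀) (formOp σ a x₀) = ∑' z : Fin (d + 1) → Lattice d,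
      (loopProd a d z).trace * (cliffConst d * (loopDet x₀ z : ℂ)) := by
  obtain ⟨T, hT, hTk⟩ := exists_norm_trace_le (Fin N)
  obtain ⟨C, hC, hCk⟩ := exists_abs_loopDet_le hσ hd
  have hF := isKernelOp_diracPhase N σ x₀
  have hs : Summable fun z : Fin (d + 1) → Lattice d =>
      (loopProd a d z).trace * (cliffConst d * (loopDet x₀ z : ℂ)) := by
    have h3 : Summable fun z : Fin (d + 1) → Lattice d =>
        pathWeight a d (z (Fin.last d)) z * pathStepWeight d (z (Fin.last d)) z :=
      h₂.comp_injective (i := fun z : Fin (d + 1) → Lattice d => (z (Fin.last d), z))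
        fun z z' h => congrArg Prod.snd h
    refine Summable.of_norm_bounded (h3.mul_left (T * (‖cliffConst d‖ * C))) fun z => ?_
    rw [norm_mul, norm_mul, norm_real, Real.norm_eq_abs]
    calc _ ≤ (T * pathWeight a d (z (Fin.last d)) z) *
          (‖cliffConst d‖ * (C * pathStepWeight d (z (Fin.last d)) z)) := by
          refine mul_le_mul ((hTk _).trans (mul_le_mul_of_nonneg_left (norm_pathProd_le _ _ _ _) hT))
            (mul_le_mul_of_nonneg_left (hCk _ hx₀ hz z) (norm_nonneg _)) (by positivity)
            (mul_nonneg hT (pathWeight_nonneg _ _ _ _))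
      _ = _ := by ring
  have htr : ∀ x, (kern (diracPhase N σ x₀ * qDiff (diracPhase N σ x₀) d (formOp σ a x₀)) x x).trace
      = 2 * (kern (formOp σ a x₀) x x).trace := fun x => by
    rw [qDiff, hd.neg_one_pow, neg_one_smul, sub_neg_eq_add,
      kern_mul_of_diag_left hF, kern_add, kern_mul_of_diag_left hF, kern_mul_of_diag_right hF,
      mul_add, Matrix.trace_add, ← mul_assoc, ← mul_assoc, ← Matrix.mul_kronecker_mul,
      phaseFiber_mul_self hσ, Matrix.trace_mul_comm (_ * _), ← mul_assoc, ← Matrix.mul_kronecker_mul,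
      phaseFiber_mul_self hσ, one_mul, Matrix.one_kronecker_one, one_mul, two_mul]
  rw [gradedTrace, opTrace_eq_tsum_trace (summable_norm_apply_ket hσ hd ha hx₀ hz h₁ h₂)]
  simp only [htr]
  rw [tsum_mul_left, ← mul_assoc, one_div, inv_mul_cancel₀ two_ne_zero, one_mul,
    ← (Fin.snocEquiv fun _ => Lattice d).tsum_eq, Summable.tsum_prod]
  · exact tsum_congr fun x => (trace_kern_formOp hσ hd ha hz h₁ x).tsum_eq.symm
  · exact (Fin.snocEquiv fun _ => Lattice d).summable_iff.mpr hs

end GradedTrace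

/-! ### Lattice sums with polynomial and exponential weights -/

section LatticeSums

variable {d : ℕ}

theorem summable_inv_one_add_norm_pow (d : ℕ) :
    Summable fun x : Lattice d => ((1 + ‖x‖) ^ (d + 1))⁻¹ := by
  let b := Pi.basisFun ℝ (Fin d)
  let S : Submodule ℤ (Fin d → ℝ) := Submodule.span ℤ (Set.range b)
  have hS : Module.finrank ℤ S = d := by
    rw [ZLattice.rank ℝ S]
    simp
  have hmem : ∀ x : Lattice d, (fun i => (x i : ℝ)) ∈ S := fun x => by
    have h : (fun i => (x i : ℝ)) = ∑ i, x i • b i := by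
      ext j
      simp [b, Pi.single_apply, Finset.sum_apply]
    rw [h]
    exact Submodule.sum_mem _ fun i _ => Submodule.smul_mem _ _ (Submodule.subset_span ⟨i, rfl⟩)
  have h1 := ZLattice.summable_norm_pow_inv S (d + 1) (by omega)
  have h2 := h1.comp_injective (i := fun x : Lattice d => (⟨fun i => (x i : ℝ), hmem x⟩ : S))
    fun x y hxy => by
      funext i
      have := congrFun (congrArg Subtype.val hxy) i
      simpa using this
  -- The comparison fails at x = 0, where the majorant has the default value coming from 0⁻¹ = 0.
  refine Summable.of_norm_bounded_eventually h2 ?_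
  rw [Filter.eventually_cofinite]
  refine (Set.finite_singleton (0 : Lattice d)).subset fun x hx => ?_
  by_contra h0
  apply hx
  have h3 : ‖(⟨fun i => (x i : ℝ), hmem x⟩ : S)‖ = ‖x‖ := by
    simp only [Pi.norm_def]
    congr 2
  have h4 : 0 < ‖x‖ := norm_pos_iff.mpr h0
  simp only [Function.comp_apply]
  rw [h3, Real.norm_of_nonneg (by positivity), inv_pow]
  gcongr
  linarith

theorem one_add_pow_mul_exp_le {l t : ℝ} (hl : 0 < l) (ht : 0 ≤ t) (n : ℕ) :
    (1 + t) ^ n * Real.exp (-(l * t)) ≤ n ! * Real.exp l / l ^ n := by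
  have h := Real.pow_div_factorial_le_exp (l * (1 + t)) (by positivity) n
  rw [div_le_iff₀ (by positivity), mul_pow, mul_add, mul_one, Real.exp_add] at h
  rw [le_div_iff₀ (by positivity), Real.exp_neg]
  have h1 := Real.exp_pos (l * t)
  rw [← div_eq_mul_inv, div_mul_eq_mul_div, div_le_iff₀ h1]
  linarith

theorem summable_one_add_norm_pow_mul_exp {l : ℝ} (hl : 0 < l) (n : ℕ) :
    Summable fun x : Lattice d => (1 + ‖x‖) ^ n * Real.exp (-(l * ‖x‖)) := by
  refine Summable.of_nonneg_of_le (fun x => by positivity) (fun x => ?_)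
    ((summable_inv_one_add_norm_pow d).mul_left ((n + (d + 1)) ! * Real.exp l / l ^ (n + (d + 1))))
  have h := one_add_pow_mul_exp_le hl (norm_nonneg x) (n + (d + 1))
  rw [← div_eq_mul_inv, le_div_iff₀ (by positivity)]
  calc _ = (1 + ‖x‖) ^ (n + (d + 1)) * Real.exp (-(l * ‖x‖)) := by ring
    _ ≤ _ := h

/-- Iterates 1 + ‖a + b‖ ≤ (1 + ‖a‖)(1 + ‖b‖) along the path; the steps after i only contribute
factors at least 1. -/
theorem one_add_norm_le_mul_prod {E : Type*} [NormedAddCommGroup E] (n : ℕ) (p : Fin (n + 1) → E)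
    (i : Fin (n + 1)) :
    1 + ‖p 0‖ ≤ (1 + ‖p i‖) * ∏ j : Fin n, (1 + ‖p j.succ - p j.castSucc‖) := by
  induction n with
  | zero =>
    rw [Fin.fin_one_eq_zero i]
    simp
  | succ n ih =>
    rw [Fin.prod_univ_castSucc, ← mul_assoc]
    have hpos : ∀ i, 0 ≤ (1 + ‖p i‖) *
        ∏ j : Fin n, (1 + ‖p j.castSucc.succ - p j.castSucc.castSucc‖) := fun i => by positivity
    refine Fin.lastCases ?_ (fun i => ?_) i
    · have h1 := ih (fun j => p j.castSucc) (Fin.last n)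
      refine h1.trans ?_
      have h2 : 1 + ‖p (Fin.last n).castSucc‖ ≤ (1 + ‖p (Fin.last (n + 1))‖) *
          (1 + ‖p (Fin.last n).succ - p (Fin.last n).castSucc‖) := by
        have h3 := norm_sub_le (p (Fin.last n).succ) (p (Fin.last n).succ - p (Fin.last n).castSucc)
        rw [sub_sub_cancel] at h3
        rw [← Fin.succ_last]
        nlinarith [norm_nonneg (p (Fin.last n).succ),
          norm_nonneg (p (Fin.last n).succ - p (Fin.last n).castSucc)]
      calc _ ≤ ((1 + ‖p (Fin.last (n + 1))‖) *
          (1 + ‖p (Fin.last n).succ - p (Fin.last n).castSucc‖)) *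
            ∏ j : Fin n, (1 + ‖p j.castSucc.succ - p j.castSucc.castSucc‖) :=
            mul_le_mul_of_nonneg_right h2 (by positivity)
        _ = _ := by ring
    · have h1 := ih (fun j => p j.castSucc) i
      refine h1.trans (le_mul_of_one_le_right (hpos i.castSucc) ?_)
      linarith [norm_nonneg (p (Fin.last n).succ - p (Fin.last n).castSucc)]

/-- Each of the n denominators is moved back to p_0 at the cost of all the factors 1 + step length.
Together with one factor from its numerator every step then occurs n + 1 times. -/
theorem prod_stepWeight_le (n : ℕ) (p : Fin (n + 1) → Lattice d) :
    ∏ i : Fin n, stepWeight (p i.castSucc) (p i.succ)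
      ≤ ((1 + ‖p 0‖) ^ n)⁻¹ * ∏ i : Fin n, (1 + ‖p i.succ - p i.castSucc‖) ^ (n + 1) := by
  set Q := ∏ j : Fin n, (1 + ‖p j.succ - p j.castSucc‖) with hQ
  have hQ0 : 0 < Q := Finset.prod_pos fun _ _ => by positivity
  calc _ ≤ ∏ i : Fin n, ((1 + ‖p i.succ - p i.castSucc‖) * (Q * (1 + ‖p 0‖)⁻¹)) := by
        refine Finset.prod_le_prod (fun _ _ => stepWeight_nonneg _ _) fun i _ => ?_
        rw [stepWeight, div_eq_mul_inv]
        refine mul_le_mul ?_ ?_ (by positivity) (by positivity)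
        · rw [norm_sub_rev]; linarith
        · have h := one_add_norm_le_mul_prod n p i.castSucc
          rw [← hQ] at h
          rw [← div_eq_mul_inv, le_div_iff₀ (by positivity), inv_mul_le_iff₀ (by positivity)]
          exact h
    _ = _ := by
      rw [Finset.prod_mul_distrib, Finset.prod_const, Finset.card_univ, Fintype.card_fin,
        Finset.prod_pow, ← hQ, mul_pow, inv_pow]
      ring

/-- The exponential weight of the path `x, z_0, …, z_n`. -/
noncomputable def pathExp (l : ℝ) (n : ℕ) (x : Lattice d) (z : Fin (n + 1) → Lattice d) : ℝ :=
  Real.exp (-(l * ‖z 0 - x‖)) * ∏ i : Fin n, Real.exp (-(l * ‖z i.succ - z i.castSucc‖))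

theorem pathExp_nonneg (l : ℝ) (n : ℕ) (x : Lattice d) (z : Fin (n + 1) → Lattice d) :
    0 ≤ pathExp l n x z := by
  unfold pathExp; positivity

theorem summable_pathExp_mul_prod {l : ℝ} (hl : 0 < l) (n : ℕ) (x : Lattice d) :
    Summable fun z : Fin (n + 1) → Lattice d =>
      pathExp l n x z * ∏ i : Fin n, (1 + ‖z i.succ - z i.castSucc‖) := by
  have hg : Summable fun y : Lattice d => Real.exp (-(l * ‖y - x‖)) := by
    have := (Equiv.subRight x).summable_iff.mpr
      (summable_one_add_norm_pow_mul_exp (d := d) hl 0)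
    simpa [Function.comp_def] using this
  have h := summable_prod_steps hg (summable_one_add_norm_pow_mul_exp (d := d) hl 1)
    (fun _ => by positivity) (fun _ => by positivity) n
  refine h.congr fun z => ?_
  rw [pathExp, mul_assoc, ← Finset.prod_mul_distrib]
  simp only [pow_one]
  congr 1
  exact Finset.prod_congr rfl fun i _ => mul_comm _ _

/-- Exponential decay absorbs the powers of the step lengths. The d + 1 steps leave (1 +
‖x‖)^{-(d+1)} at the starting point, summable over ℤ^d. -/
theorem summable_pathExp_mul_pathStepWeight {l : ℝ} (hl : 0 < l) :
    Summable fun q : Lattice d × (Fin (d + 1) → Lattice d) =>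
      pathExp l d q.1 q.2 * pathStepWeight d q.1 q.2 := by
  have h := summable_prod_steps (summable_inv_one_add_norm_pow d)
    (summable_one_add_norm_pow_mul_exp (d := d) hl (d + 2)) (fun _ => by positivity)
    (fun _ => by positivity) (d + 1)
  refine Summable.of_nonneg_of_le
    (fun q => mul_nonneg (pathExp_nonneg _ _ _ _) (pathStepWeight_nonneg _ _ _)) (fun q => ?_)
    ((Fin.consEquiv fun _ => Lattice d).summable_iff.mpr h)
  set p : Fin (d + 2) → Lattice d := Fin.consEquiv (fun _ => Lattice d) q with hp
  have h1 : pathExp l d q.1 q.2 = ∏ i : Fin (d + 1), Real.exp (-(l * ‖p i.succ - p i.castSucc‖)) := by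
    rw [Fin.prod_univ_succ]
    rfl
  have h2 : pathStepWeight d q.1 q.2 = ∏ i : Fin (d + 1), stepWeight (p i.castSucc) (p i.succ) := by
    rw [Fin.prod_univ_succ]
    rfl
  rw [h1, h2]
  simp only [Function.comp_apply]
  rw [← hp, Finset.prod_mul_distrib, ← mul_assoc, mul_comm]
  exact mul_le_mul_of_nonneg_right (prod_stepWeight_le (d + 1) p) (by positivity)

end LatticeSums

/-! ### Expectations of series and of products -/

section Expectation

variable {Ω : Type*} [MeasurableSpace Ω] {P : Measure Ω}

theorem ae_summable_of_summable_integral {ι : Type*} [Countable ι] {F : ι → Ω → ℝ}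
    (h0 : ∀ i, 0 ≤ᵐ[P] F i) (hF : ∀ i, Integrable (F i) P) (hs : Summable fun i => ∫ ω, F i ω ∂P) :
    ∀ᵐ ω ∂P, Summable fun i => F i ω := by
  have h1 : ∑' i, eLpNorm (F i) 1 P ≠ ⊤ := by
    have h2 : ∀ i, eLpNorm (F i) 1 P = ENNReal.ofReal (∫ ω, F i ω ∂P) := fun i => by
      rw [eLpNorm_one_eq_lintegral_enorm, ← ofReal_integral_norm_eq_lintegral_enorm (hF i)]
      congr 1
      refine integral_congr_ae ?_
      filter_upwards [h0 i] with ω hω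
      exact Real.norm_of_nonneg hω
    simp only [h2]
    exact hs.tsum_ofReal_ne_top
  filter_upwards [summable_norm_of_tsum_eLpNorm_ne_top le_rfl (fun i => (hF i).1) h1] with ω hω
  exact hω.of_norm

theorem integrable_tsum_of_summable_integral_norm {ι E : Type*} [Countable ι]
    [NormedAddCommGroup E] [CompleteSpace E] {F : ι → Ω → E}
    (hF : ∀ i, Integrable (F i) P) (hs : Summable fun i => ∫ ω, ‖F i ω‖ ∂P) :
    Integrable (fun ω => ∑' i, F i ω) P := by
  refine ⟨AEStronglyMeasurable.tsum fun i => (hF i).1, ?_⟩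
  have h2 : ∀ i, ∫⁻ ω, ‖F i ω‖ₑ ∂P = ENNReal.ofReal (∫ ω, ‖F i ω‖ ∂P) := fun i =>
    (ofReal_integral_norm_eq_lintegral_enorm (hF i)).symm
  calc ∫⁻ ω, ‖∑' i, F i ω‖ₑ ∂P ≤ ∫⁻ ω, ∑' i, ‖F i ω‖ₑ ∂P :=
        lintegral_mono fun ω => enorm_tsum_le_tsum_enorm
    _ = ∑' i, ∫⁻ ω, ‖F i ω‖ₑ ∂P := lintegral_tsum fun i => (hF i).1.enorm
    _ < ⊤ := by
      simp only [h2]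
      exact hs.tsum_ofReal_ne_top.lt_top

/-- Products of bounded random variables with small expectations. -/
theorem integral_prod_le_exp [IsProbabilityMeasure P] {n : ℕ} {F : Fin (n + 1) → Ω → ℝ} {C A l : ℝ}
    {r : Fin (n + 1) → ℝ} (hC : 1 ≤ C) (hA : 0 ≤ A) (hl : 0 < l)
    (hm : ∀ i, AEStronglyMeasurable (F i) P) (h0 : ∀ i ω, 0 ≤ F i ω)
    (hb : ∀ i, ∀ᵐ ω ∂P, F i ω ≤ C) (hE : ∀ i, ∫ ω, F i ω ∂P ≤ A * Real.exp (-(l * r i))) :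
    Integrable (fun ω => ∏ i, F i ω) P ∧
      ∫ ω, ∏ i, F i ω ∂P ≤ C ^ n * A * ∏ i, Real.exp (-(l / (n + 1) * r i)) := by
  have hb' : ∀ᵐ ω ∂P, ∀ i, F i ω ≤ C := ae_all_iff.mpr hb
  have hint : Integrable (fun ω => ∏ i, F i ω) P := by
    refine Integrable.of_bound (Finset.aestronglyMeasurable_fun_prod _ fun i _ => hm i)
      (C ^ (n + 1)) ?_
    filter_upwards [hb'] with ω hω
    rw [Real.norm_of_nonneg (Finset.prod_nonneg fun i _ => h0 i ω)]
    calc _ ≤ ∏ i : Fin (n + 1), C := Finset.prod_le_prod (fun i _ => h0 i ω) fun i _ => hω i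
      _ = _ := by simp
  refine ⟨hint, ?_⟩
  -- No independence is needed: all factors but the one with the largest r_j are bounded by C, and
  -- r_j is at least the mean of the r_i, whence the rate l/(n + 1).
  obtain ⟨j, -, hj⟩ := Finset.exists_max_image Finset.univ r Finset.univ_nonempty
  have hintj : Integrable (F j) P := by
    refine Integrable.of_bound (hm j) C ?_
    filter_upwards [hb'] with ω hω
    rw [Real.norm_of_nonneg (h0 j ω)]
    exact hω j
  have h1 : ∫ ω, ∏ i, F i ω ∂P ≤ ∫ ω, C ^ n * F j ω ∂P := by
    refine integral_mono_ae hint (hintj.const_mul _) ?_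
    filter_upwards [hb'] with ω hω
    rw [Fin.prod_univ_succAbove _ j, mul_comm]
    refine mul_le_mul_of_nonneg_right ?_ (h0 j ω)
    calc _ ≤ ∏ i : Fin n, C := Finset.prod_le_prod (fun i _ => h0 _ ω) fun i _ => hω _
      _ = _ := by simp
  refine h1.trans ?_
  rw [integral_const_mul, mul_assoc]
  refine mul_le_mul_of_nonneg_left ((hE j).trans ?_) (by positivity)
  refine mul_le_mul_of_nonneg_left ?_ hA
  rw [← Real.exp_sum, Real.exp_le_exp, Finset.sum_neg_distrib, neg_le_neg_iff, ← Finset.mul_sum]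
  have h2 : ∑ i, r i ≤ (n + 1) * r j := by
    calc _ ≤ ∑ i : Fin (n + 1), r j := Finset.sum_le_sum fun i hi => hj i hi
      _ = _ := by simp
  rw [div_mul_eq_mul_div, div_le_iff₀ (by positivity)]
  nlinarith

end Expectation

/-! ### Localized observables: moments and covariance -/

section Localized

set_option linter.unusedSectionVars false

open scoped Matrix.Norms.L2Operator

variable {Ω : Type*} {d N : ℕ} [AddAction (Lattice d) Ω] [MeasurableSpace Ω]
  [MeasurableConstVAdd (Lattice d) Ω] {P : Measure Ω} [IsProbabilityMeasure P]
  [VAddInvariantMeasure (Lattice d) Ω P] {w : Lattice d →ₗ[ℤ] Lattice d →ₗ[ℤ] ℝ}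

/-- A sequence of symbols that are localized with uniform constants. -/
structure IsUniformlyLocalized (P : Measure Ω) (w : Lattice d →ₗ[ℤ] Lattice d →ₗ[ℤ] ℝ)
    (g : ℕ → Symbol Ω d N) (C A l : ℝ) : Prop where
  aestronglyMeasurable : ∀ m x, AEStronglyMeasurable (fun ω => g m ω x) P
  one_le : 1 ≤ C
  nonneg : 0 ≤ A
  pos : 0 < l
  bounded : ∀ᵐ ω ∂P, ∀ m, ∃ B, IsKernelOp (covKernel w (g m) ω) B ∧ ‖B‖ ≤ C
  decay : ∀ m x, ∫ ω, ‖g m ω x‖ ∂P ≤ A * Real.exp (-(l * ‖x‖))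

theorem aestronglyMeasurable_matrix {M : Ω → Matrix (Fin N) (Fin N) ℂ}
    (h : ∀ a b, AEMeasurable (fun ω => M ω a b) P) : AEStronglyMeasurable M P := by
  have h1 : M = fun ω => ∑ i, ∑ j, M ω i j • Matrix.single i j (1 : ℂ) := by
    funext ω
    conv_lhs => rw [Matrix.matrix_eq_sum_single (M ω)]
    simp [Matrix.smul_single]
  rw [h1]
  exact Finset.aestronglyMeasurable_fun_sum _ fun i _ =>
    Finset.aestronglyMeasurable_fun_sum _ fun j _ =>
      ((h i j).aestronglyMeasurable).smul_const _

theorem norm_le_norm_shiftVec (x : Lattice d) : ‖x‖ ≤ ‖shiftVec 0 x‖ := by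
  refine (pi_norm_le_iff_of_nonneg (norm_nonneg _)).mpr fun i => ?_
  have h := PiLp.norm_apply_le (shiftVec 0 x) i
  refine le_trans (le_of_eq ?_) h
  simp [shiftVec, Int.norm_eq_abs, Real.norm_eq_abs]

theorem exists_isUniformlyLocalized {f : Fin (d + 1) → Symbol Ω d N}
    (hf : ∀ i, IsLocalized P w (f i)) :
    ∃ (g : ℕ → Symbol Ω d N) (C A l : ℝ), (∀ i : Fin (d + 1), g i = f i) ∧
      IsUniformlyLocalized P w g C A l := by
  choose C hC using fun i => (hf i).essBounded.bounded
  choose A hA l hl hdec using fun i => (hf i).decay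
  obtain ⟨j, -, hj⟩ := Finset.exists_min_image Finset.univ l Finset.univ_nonempty
  -- Indices are reduced modulo d + 1, so constants valid for the finitely many f_i serve the whole
  -- sequence.
  refine ⟨fun m => f (Fin.ofNat (d + 1) m), 1 + ∑ i, |C i|, ∑ i, A i, l j, fun i => ?_, ?_⟩
  · simp
  · constructor
    · exact fun m x => aestronglyMeasurable_matrix fun a b => (hf _).essBounded.aemeasurable x a b
    · linarith [Finset.sum_nonneg fun (i : Fin (d + 1)) (_ : i ∈ Finset.univ) => abs_nonneg (C i)]
    · exact Finset.sum_nonneg fun i _ => (hA i).le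
    · exact hl j
    · filter_upwards [ae_all_iff.mpr hC] with ω hω m
      obtain ⟨B, hB, hBC⟩ := hω (Fin.ofNat (d + 1) m)
      refine ⟨B, hB, hBC.trans ((le_abs_self _).trans ?_)⟩
      linarith [Finset.single_le_sum (fun i _ => abs_nonneg (C i))
        (Finset.mem_univ (Fin.ofNat (d + 1) m))]
    · intro m x
      refine (hdec (Fin.ofNat (d + 1) m) x).trans (mul_le_mul ?_ ?_ (Real.exp_pos _).le
        (Finset.sum_nonneg fun i _ => (hA i).le))
      · exact Finset.single_le_sum (fun i _ => (hA i).le) (Finset.mem_univ _)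
      · rw [Real.exp_le_exp, neg_mul, neg_le_neg_iff]
        exact mul_le_mul (hj _ (Finset.mem_univ _)) (norm_le_norm_shiftVec x) (norm_nonneg _)
          (hl _).le

/-- The matrix elements of `π_ω(g_0), π_ω(g_1), …`. -/
noncomputable def kernelSeq (w : Lattice d →ₗ[ℤ] Lattice d →ₗ[ℤ] ℝ) (g : ℕ → Symbol Ω d N) (ω : Ω) :
    ℕ → Lattice d → Lattice d → Matrix (Fin N) (Fin N) ℂ :=
  fun m => covKernel w (g m) ω

theorem norm_kernelSeq (g : ℕ → Symbol Ω d N) (ω : Ω) (m : ℕ) (x y : Lattice d) :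
    ‖kernelSeq w g ω m x y‖ = ‖g m (-x +ᵥ ω) (y - x)‖ := by
  rw [kernelSeq, covKernel, norm_smul, mul_comm I, norm_exp_ofReal_mul_I, one_mul]

namespace IsUniformlyLocalized

variable {g : ℕ → Symbol Ω d N} {C A l : ℝ} (hg : IsUniformlyLocalized P w g C A l)

include hg

theorem aestronglyMeasurable_kernelSeq (m : ℕ) (x y : Lattice d) :
    AEStronglyMeasurable (fun ω => kernelSeq w g ω m x y) P := by
  have h := ((hg.aestronglyMeasurable m (y - x)).comp_measurePreserving
    (measurePreserving_vadd (-x) P)).const_smul (cexp (I * (w y x : ℂ)))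
  exact h.congr (ae_of_all _ fun ω => rfl)

theorem integral_norm_kernelSeq_le (m : ℕ) (x y : Lattice d) :
    ∫ ω, ‖kernelSeq w g ω m x y‖ ∂P ≤ A * Real.exp (-(l * ‖y - x‖)) := by
  simp only [norm_kernelSeq]
  rw [integral_vadd_eq_self (fun ω => ‖g m ω (y - x)‖)]
  exact hg.decay m (y - x)

theorem ae_norm_kernelSeq_le : ∀ᵐ ω ∂P, ∀ m x y, ‖kernelSeq w g ω m x y‖ ≤ C := by
  filter_upwards [hg.bounded] with ω hω m x y
  obtain ⟨B, hB, hBC⟩ := hω m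
  exact (hB.norm_le x y).trans hBC

theorem integral_pathWeight_le (n : ℕ) : ∃ K l' : ℝ, 0 ≤ K ∧ 0 < l' ∧ ∀ x z,
    Integrable (fun ω => pathWeight (kernelSeq w g ω) n x z) P ∧
      ∫ ω, pathWeight (kernelSeq w g ω) n x z ∂P ≤ K * pathExp l' n x z := by
  refine ⟨C ^ n * A, l / (n + 1), mul_nonneg (pow_nonneg (zero_le_one.trans hg.one_le) n) hg.nonneg,
    div_pos hg.pos (by positivity), fun x z => ?_⟩
  let p : Fin (n + 2) → Lattice d := Fin.cons x z
  have h := integral_prod_le_exp (P := P) (n := n)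
    (F := fun i ω => ‖kernelSeq w g ω i (p i.castSucc) (p i.succ)‖)
    (r := fun i => ‖p i.succ - p i.castSucc‖) hg.one_le hg.nonneg hg.pos
    (fun i => (hg.aestronglyMeasurable_kernelSeq i _ _).norm) (fun _ _ => norm_nonneg _)
    (fun i => by filter_upwards [hg.ae_norm_kernelSeq_le] with ω hω using hω _ _ _)
    (fun i => hg.integral_norm_kernelSeq_le _ _ _)
  have h1 : ∀ ω, ∏ i : Fin (n + 1), ‖kernelSeq w g ω i (p i.castSucc) (p i.succ)‖
      = pathWeight (kernelSeq w g ω) n x z := fun ω => by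
    rw [Fin.prod_univ_succ]
    rfl
  have h2 : ∏ i : Fin (n + 1), Real.exp (-(l / (n + 1) * ‖p i.succ - p i.castSucc‖))
      = pathExp (l / (n + 1)) n x z := by
    rw [Fin.prod_univ_succ]
    rfl
  simpa only [h1, h2] using h

/-- The factors 1 + step length make room for the polynomial coefficients produced by the
derivations. -/
theorem ae_summable_pathWeight_mul_prod : ∀ᵐ ω ∂P, ∀ (x : Lattice d) (n : ℕ),
    Summable fun z : Fin (n + 1) → Lattice d => pathWeight (kernelSeq w g ω) n x z *
      ∏ i : Fin n, (1 + ‖z i.succ - z i.castSucc‖) := by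
  refine ae_all_iff.mpr fun x => ae_all_iff.mpr fun n => ?_
  obtain ⟨K, l', hK, hl', h⟩ := hg.integral_pathWeight_le n
  have h0 : ∀ z : Fin (n + 1) → Lattice d, 0 ≤ ∏ i : Fin n, (1 + ‖z i.succ - z i.castSucc‖) :=
    fun z => by positivity
  refine ae_summable_of_summable_integral
    (fun z => ae_of_all _ fun ω => mul_nonneg (pathWeight_nonneg _ _ _ _) (h0 z))
    (fun z => (h x z).1.mul_const _) ?_
  refine Summable.of_nonneg_of_le (fun z => integral_nonneg fun ω =>
    mul_nonneg (pathWeight_nonneg _ _ _ _) (h0 z)) (fun z => ?_)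
    ((summable_pathExp_mul_prod hl' n x).mul_left K)
  rw [integral_mul_const, ← mul_assoc]
  exact mul_le_mul_of_nonneg_right (h x z).2 (h0 z)

theorem ae_summable_pathWeight : ∀ᵐ ω ∂P, ∀ (x : Lattice d) (n : ℕ),
    Summable fun z : Fin (n + 1) → Lattice d => pathWeight (kernelSeq w g ω) n x z := by
  filter_upwards [hg.ae_summable_pathWeight_mul_prod] with ω hω x n
  refine Summable.of_nonneg_of_le (fun z => pathWeight_nonneg _ _ _ _) (fun z => ?_) (hω x n)
  refine le_mul_of_one_le_right (pathWeight_nonneg _ _ _ _) ?_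
  calc (1 : ℝ) = ∏ i : Fin n, 1 := by simp
    _ ≤ _ := Finset.prod_le_prod (fun _ _ => zero_le_one) fun i _ => by
      linarith [norm_nonneg (z i.succ - z i.castSucc)]

theorem summable_integral_pathWeight_mul :
    Summable fun q : Lattice d × (Fin (d + 1) → Lattice d) =>
      (∫ ω, pathWeight (kernelSeq w g ω) d q.1 q.2 ∂P) * pathStepWeight d q.1 q.2 := by
  obtain ⟨K, l', hK, hl', h⟩ := hg.integral_pathWeight_le d
  refine Summable.of_nonneg_of_le (fun q => mul_nonneg (integral_nonneg fun ω =>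
    pathWeight_nonneg _ _ _ _) (pathStepWeight_nonneg _ _ _)) (fun q => ?_)
    ((summable_pathExp_mul_pathStepWeight hl').mul_left K)
  rw [← mul_assoc]
  exact mul_le_mul_of_nonneg_right (h _ _).2 (pathStepWeight_nonneg _ _ _)

theorem ae_summable_pathWeight_mul_pathStepWeight : ∀ᵐ ω ∂P,
    Summable fun q : Lattice d × (Fin (d + 1) → Lattice d) =>
      pathWeight (kernelSeq w g ω) d q.1 q.2 * pathStepWeight d q.1 q.2 := by
  obtain ⟨K, l', hK, hl', h⟩ := hg.integral_pathWeight_le d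
  refine ae_summable_of_summable_integral (fun q => ae_of_all _ fun ω =>
    mul_nonneg (pathWeight_nonneg _ _ _ _) (pathStepWeight_nonneg _ _ _))
    (fun q => (h _ _).1.mul_const _) ?_
  simpa only [integral_mul_const] using hg.summable_integral_pathWeight_mul

theorem aestronglyMeasurable_loopProd (n : ℕ) (z : Fin (n + 1) → Lattice d) :
    AEStronglyMeasurable (fun ω => loopProd (kernelSeq w g ω) n z) P := by
  have h : ∀ (x : Lattice d) (n : ℕ) (z : Fin (n + 1) → Lattice d), AEStronglyMeasurable (fun ω =>
      pathProd (kernelSeq w g ω 0 x) (fun m => kernelSeq w g ω (m + 1)) n z) P := by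
    intro x n
    induction n with
    | zero => exact fun z => hg.aestronglyMeasurable_kernelSeq 0 x (z 0)
    | succ n ih =>
      intro z
      exact (ih (Fin.init z)).mul (hg.aestronglyMeasurable_kernelSeq (n + 1) _ _)
  exact h _ n z

theorem norm_trace_loopProd_le {T : ℝ} (hT : 0 ≤ T)
    (h : ∀ M : Matrix (Fin N) (Fin N) ℂ, ‖M.trace‖ ≤ T * ‖M‖) (ω : Ω) (n : ℕ)
    (z : Fin (n + 1) → Lattice d) : ‖(loopProd (kernelSeq w g ω) n z).trace‖
      ≤ T * pathWeight (kernelSeq w g ω) n (z (Fin.last n)) z :=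
  (h _).trans (mul_le_mul_of_nonneg_left (norm_pathProd_le _ _ _ _) hT)

theorem integrable_trace_loopProd (n : ℕ) (z : Fin (n + 1) → Lattice d) :
    Integrable (fun ω => (loopProd (kernelSeq w g ω) n z).trace) P := by
  obtain ⟨T, hT, hTk⟩ := exists_norm_trace_le (Fin N)
  obtain ⟨K, l', hK, hl', h⟩ := hg.integral_pathWeight_le n
  refine ((h (z (Fin.last n)) z).1.const_mul T).mono' ?_
    (ae_of_all _ fun ω => hg.norm_trace_loopProd_le hT hTk ω n z)
  have hc : Continuous fun M : Matrix (Fin N) (Fin N) ℂ => M.trace := by fun_prop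
  exact hc.comp_aestronglyMeasurable (hg.aestronglyMeasurable_loopProd n z)

end IsUniformlyLocalized

theorem pathProd_comp {L L' R : Type*} [Mul R] (r : L' → R) (K : ℕ → L' → L' → R) (h : L → L')
    (n : ℕ) (z : Fin (n + 1) → L) : pathProd r K n (fun i => h (z i))
      = pathProd (fun x => r (h x)) (fun m x y => K m (h x) (h y)) n z := by
  induction n with
  | zero => rfl
  | succ n ih =>
    rw [pathProd_succ, pathProd_succ, ← ih]
    rfl

theorem prod_mul_inv_telescope {G : Type*} [CommGroup G] (n : ℕ) (t : Fin (n + 1) → G) :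
    ∏ i : Fin n, (t i.succ * (t i.castSucc)⁻¹) = t (Fin.last n) * (t 0)⁻¹ := by
  induction n with
  | zero => simp
  | succ n ih =>
    rw [Fin.prod_univ_castSucc]
    have := ih fun i => t i.castSucc
    simp only [← Fin.castSucc_succ, Fin.castSucc_zero] at this ⊢
    rw [this, Fin.succ_last, mul_comm, mul_assoc, inv_mul_cancel_left]

/-- By bilinearity and antisymmetry the magnetic phase changes by a quotient of values at the two
end points, which telescopes along a path and cancels around a loop. -/
theorem kernelSeq_add (hw : ∀ x y, w x y = -w y x) (g : ℕ → Symbol Ω d N) (ω : Ω) (m : ℕ)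
    (x y a : Lattice d) : kernelSeq w g ω m (x + a) (y + a)
      = (Circle.exp (w y a) * (Circle.exp (w x a))⁻¹) • kernelSeq w g (-a +ᵥ ω) m x y := by
  have haa : w a a = 0 := by linarith [hw a a]
  have h1 : -(x + a) +ᵥ ω = -x +ᵥ (-a +ᵥ ω) := by rw [vadd_vadd, neg_add]
  have h2 : cexp (I * (w (y + a) (x + a) : ℂ))
      = ((Circle.exp (w y a) * (Circle.exp (w x a))⁻¹ : Circle) : ℂ) * cexp (I * (w y x : ℂ)) := by
    rw [← Circle.exp_neg, ← Circle.exp_add, Circle.coe_exp, ← Complex.exp_add]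
    congr 1
    simp only [map_add, LinearMap.add_apply, haa, hw a x]
    push_cast
    ring
  rw [kernelSeq, kernelSeq, covKernel, covKernel, h1, add_sub_add_right_eq_sub, h2, mul_smul]
  rfl

theorem loopProd_add (hw : ∀ x y, w x y = -w y x) (g : ℕ → Symbol Ω d N) (ω : Ω) (n : ℕ)
    (z : Fin (n + 1) → Lattice d) (a : Lattice d) :
    loopProd (kernelSeq w g ω) n (fun i => z i + a) = loopProd (kernelSeq w g (-a +ᵥ ω)) n z := by
  rw [loopProd, pathProd_comp (h := fun x => x + a)]
  simp only [kernelSeq_add hw]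
  rw [pathProd_smul (fun y => Circle.exp (w y a) * (Circle.exp (w (z (Fin.last n)) a))⁻¹)
    (fun _ x y => Circle.exp (w y a) * (Circle.exp (w x a))⁻¹),
    prod_mul_inv_telescope n fun i => Circle.exp (w (z i) a)]
  have h : ∀ u v : Circle, u * v⁻¹ * (v * u⁻¹) = 1 := fun u v => by
    rw [mul_assoc, inv_mul_cancel_left, mul_inv_cancel]
  rw [h, one_smul]
  rfl

theorem integral_trace_loopProd_add (hw : ∀ x y, w x y = -w y x) (g : ℕ → Symbol Ω d N) (n : ℕ)
    (z : Fin (n + 1) → Lattice d) (a : Lattice d) :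
    ∫ ω, (loopProd (kernelSeq w g ω) n fun i => z i + a).trace ∂P
      = ∫ ω, (loopProd (kernelSeq w g ω) n z).trace ∂P := by
  simp only [loopProd_add hw]
  exact integral_vadd_eq_self (fun ω => (loopProd (kernelSeq w g ω) n z).trace)

end Localized

/-! ### From the unit cube to ℝ^d, and the constants -/

section Tiling

variable {d : ℕ}

/-- The integral over `ℝ^d` as a sum of integrals over the translates of the unit cube. -/
theorem hasSum_integral_unitCube {E : Type*} [NormedAddCommGroup E] [NormedSpace ℝ E]
    {G : (Fin d → ℝ) → E} (hG : Integrable G) :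
    HasSum (fun x : Lattice d => ∫ v in Set.Icc (0 : Fin d → ℝ) 1, G fun i => v i + x i)
      (∫ v, G v) := by
  -- The level sets of the floor map are half-open cubes that tile ℝ^d exactly; they differ from
  -- closed cubes by null sets.
  let s : Lattice d → Set (Fin d → ℝ) := fun x => (fun v i => ⌊v i⌋) ⁻¹' {x}
  have hm : Measurable fun (v : Fin d → ℝ) i => ⌊v i⌋ :=
    measurable_pi_lambda _ fun i => (measurable_pi_apply i).floor
  have hs : ∀ x, MeasurableSet (s x) := fun x => hm (measurableSet_singleton x)
  have hU : ⋃ x, s x = Set.univ := by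
    ext v
    simp [s]
  have hdisj : Pairwise (Function.onFun Disjoint s) := fun x y hxy =>
    Disjoint.preimage _ (Set.disjoint_singleton.mpr hxy)
  have h := hasSum_integral_iUnion (μ := volume) (f := G) hs hdisj hG.integrableOn
  rw [hU, setIntegral_univ] at h
  refine h.congr_fun fun x => ?_
  let a : Fin d → ℝ := fun i => x i
  have h1 := (measurePreserving_add_right (volume : Measure (Fin d → ℝ)) a).setIntegral_preimage_emb
    (measurableEmbedding_addRight a) G (s x)
  have h2 : (fun v => v + a) ⁻¹' s x = Set.univ.pi fun _ => Set.Ico (0 : ℝ) 1 := by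
    ext v
    simp [s, a, funext_iff, Int.floor_eq_zero_iff]
  have h3 : (Set.univ.pi fun _ => Set.Ico (0 : ℝ) 1)
      =ᵐ[(volume : Measure (Fin d → ℝ))] Set.Icc (0 : Fin d → ℝ) 1 :=
    Measure.univ_pi_Ico_ae_eq_Icc
  rw [h2, setIntegral_congr_set h3] at h1
  exact h1

theorem loopDet_add (x₀ : Fin d → ℝ) (z : Fin (d + 1) → Lattice d) (x : Lattice d) :
    loopDet x₀ (fun i => z i + x)
      = simplexDet unitVec (fun i => shiftVec 0 (z i)) (WithLp.toLp 2 fun i => x₀ i + x i) := by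
  rw [loopDet, simplexDet, simplexDet]
  have h : ∀ y : Lattice d, WithLp.toLp 2 x₀ + shiftVec 0 (y + x)
      = WithLp.toLp 2 (fun i => x₀ i + x i) + shiftVec 0 y := fun y => by
    ext i
    simp [shiftVec]
    ring
  simp only [h]

variable {σ : Fin d → Matrix (CliffIdx d) (CliffIdx d) ℂ}

theorem integrable_loopDet (hσ : IsCliffordRep σ) (hd : Odd d) (z : Fin (d + 1) → Lattice d) :
    Integrable fun x₀ : Fin d → ℝ => loopDet x₀ z :=
  (PiLp.volume_preserving_toLp (Fin d)).integrable_comp_of_integrable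
    (integrable_simplexDet_unitVec hσ hd _)

/-- Translating the loop by x amounts to translating x₀ by x, so the cubes reassemble ℝ^d. -/
theorem hasSum_integral_loopDet_add (hσ : IsCliffordRep σ) (hd : Odd d)
    (z : Fin (d + 1) → Lattice d) :
    HasSum (fun x : Lattice d => ∫ x₀ in Set.Icc (0 : Fin d → ℝ) 1, loopDet x₀ fun i => z i + x)
      (volume.real (Metric.ball (0 : Euc d) 1) *
        stdDet d fun i => shiftVec 0 (z i.castSucc) - shiftVec 0 (z i.succ)) := by
  have h := hasSum_integral_unitCube (integrable_loopDet hσ hd z)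
  rw [← integral_simplexDet_unitVec hσ hd fun i => shiftVec 0 (z i)]
  have h1 := (PiLp.volume_preserving_toLp (Fin d)).integral_comp
    (MeasurableEquiv.toLp 2 (Fin d → ℝ)).measurableEmbedding
    (simplexDet unitVec fun i => shiftVec 0 (z i))
  rw [← h1]
  simp only [loopDet_add]
  exact h

/-- For these x₀ there is no zero mode, and every fiber of the phase is Clifford multiplication by a
unit vector. -/
theorem ae_forall_shiftVec_ne_zero (hd : Odd d) :
    ∀ᵐ x₀ : Fin d → ℝ, ∀ x : Lattice d, shiftVec x₀ x ≠ 0 := by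
  have : Nonempty (Fin d) := ⟨⟨0, hd.pos⟩⟩
  refine ae_all_iff.mpr fun x => ?_
  have h : ∀ᵐ x₀ : Fin d → ℝ, x₀ ∉ ({fun j => -(x j : ℝ)} : Set (Fin d → ℝ)) :=
    (Set.countable_singleton _).ae_notMem _
  filter_upwards [h] with x₀ hx₀ h0
  refine hx₀ (funext fun j => ?_)
  have := congrArg (fun v : Euc d => v j) h0
  simp only [shiftVec, PiLp.zero_apply] at this
  linarith

/-- This is the Leibniz formula; reversing the edges turns each -i into i. -/
theorem sum_sign_mul_prod (z : Fin (d + 1) → Lattice d) :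
    ∑ ρ : Equiv.Perm (Fin d), ((Equiv.Perm.sign ρ : ℤ) : ℂ) *
        ∏ i : Fin d, (-I * (((z i.succ - z i.castSucc) (ρ i) : ℤ) : ℂ))
      = I ^ d * ((stdDet d fun i => shiftVec 0 (z i.castSucc) - shiftVec 0 (z i.succ) : ℝ) : ℂ) := by
  rw [stdDet_apply, ← Matrix.det_transpose, Matrix.det_apply, ofReal_sum, Finset.mul_sum]
  refine Finset.sum_congr rfl fun ρ _ => ?_
  have h : ∀ i : Fin d, -I * (((z i.succ - z i.castSucc) (ρ i) : ℤ) : ℂ)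
      = I * (((shiftVec 0 (z i.castSucc) - shiftVec 0 (z i.succ) : Euc d) (ρ i) : ℝ) : ℂ) :=
    fun i => by
      simp [shiftVec]
      ring
  rw [Finset.prod_congr rfl fun i _ => h i, Finset.prod_mul_distrib, Finset.prod_const,
    Finset.card_univ, Fintype.card_fin, Units.smul_def, zsmul_eq_mul]
  push_cast
  simp only [Matrix.transpose_apply, Matrix.of_apply]
  ring

/-- For d = 2k + 1 the ball has volume π^k 2^{k+1}/d!!, and 2^{k+1} with the Clifford dimension 2^k
cancels 2^{-d}. -/
theorem lambdaConst_mul_eq (hd : Odd d) :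
    lambdaConst d * cliffConst d * (volume.real (Metric.ball (0 : Euc d) 1) : ℂ)
      = LambdaConst d * I ^ d := by
  obtain ⟨k, rfl⟩ := hd
  have h1 := InnerProductSpace.volume_ball_of_dim_odd (E := Euc (2 * k + 1)) (k := k)
    (by simp) 0 1
  have h2 : (2 * k + 1 - 1) / 2 = k := by omega
  have h3 : volume.real (Metric.ball (0 : Euc (2 * k + 1)) 1)
      = Real.pi ^ k * 2 ^ (k + 1) / ((2 * k + 1)‼ : ℝ) := by
    rw [Measure.real, h1]
    rw [ENNReal.ofReal_one, one_pow, one_mul, ENNReal.toReal_ofReal (by positivity),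
      finrank_euclideanSpace_fin]
  rw [h3, lambdaConst, cliffConst, LambdaConst, h2]
  push_cast
  have h4 : (I : ℂ) ^ (2 * k + 1 + 1) = I ^ (2 * k + 1) * I := pow_succ _ _
  rw [h4, mul_pow (-I)]
  field_simp
  ring

end Tiling

/-! ### The trace per unit volume as a sum over loops -/

section Derivations

set_option linter.unusedSectionVars false

open scoped Matrix.Norms.L2Operator

theorem foldl_ofFn {α β : Type*} (op : β → α → β) (u : ℕ → α) (a : ℕ → β)
    (ha : ∀ m, a (m + 1) = op (a m) (u m)) (n : ℕ) :
    (List.ofFn fun i : Fin n => u i).foldl op (a 0) = a n := by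
  induction n with
  | zero => rfl
  | succ n ih =>
    rw [List.ofFn_succ', List.concat_eq_append, List.foldl_append]
    simp only [List.foldl_cons, List.foldl_nil, Fin.val_castSucc, Fin.val_last, ih, ha]

variable {Ω : Type*} {d N : ℕ} [AddAction (Lattice d) Ω] [MeasurableSpace Ω]
  [MeasurableConstVAdd (Lattice d) Ω] {P : Measure Ω} [IsProbabilityMeasure P]
  [VAddInvariantMeasure (Lattice d) Ω P] {w : Lattice d →ₗ[ℤ] Lattice d →ₗ[ℤ] ℝ}

/-- The factor by which the derivations `∂_{r_0}, ∂_{r_1}, …` multiply the contribution of a path. -/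
noncomputable def derivCoeff (r : ℕ → Fin d) (n : ℕ) (z : Fin (n + 1) → Lattice d) : ℂ :=
  ∏ i : Fin n, (-I * (((z i.succ - z i.castSucc) (r i) : ℤ) : ℂ))

theorem norm_derivCoeff_le (r : ℕ → Fin d) (n : ℕ) (z : Fin (n + 1) → Lattice d) :
    ‖derivCoeff r n z‖ ≤ ∏ i : Fin n, (1 + ‖z i.succ - z i.castSucc‖) := by
  rw [derivCoeff, norm_prod]
  refine Finset.prod_le_prod (fun _ _ => norm_nonneg _) fun i _ => ?_
  have h := norm_le_pi_norm (z i.succ - z i.castSucc) (r i)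
  rw [norm_mul, norm_neg, norm_I, one_mul, Complex.norm_intCast, ← Int.norm_eq_abs]
  linarith

theorem covKernel_symbolDeriv_eq_smul (j : Fin d) (f : Symbol Ω d N) (ω : Ω) (x y : Lattice d) :
    covKernel w (symbolDeriv j f) ω x y = (-I * (((y - x) j : ℤ) : ℂ)) • covKernel w f ω x y := by
  rw [covKernel, symbolDeriv, covKernel, smul_comm]

theorem kernelSeq_zero_zero (g : ℕ → Symbol Ω d N) (ω : Ω) (m : ℕ) :
    kernelSeq w g ω m 0 = g m ω := by
  funext y
  simp [kernelSeq, covKernel]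

/-- A symbol is the row at the site 0 of its operator, so the twisted convolution is a row times a
matrix and iterated products expand over paths from 0. -/
theorem symbolMul_eq_tsum_covKernel (f g : Symbol Ω d N) (ω : Ω) (y : Lattice d) :
    symbolMul w f g ω y = ∑' x, f ω x * covKernel w g ω x y := by
  simp only [symbolMul, covKernel, mul_smul_comm]

theorem pathProd_symbolDeriv (r : ℕ → Fin d) (g : ℕ → Symbol Ω d N) (ω : Ω) (n : ℕ)
    (z : Fin (n + 1) → Lattice d) :
    pathProd (g 0 ω) (fun m => covKernel w (symbolDeriv (r m) (g (m + 1))) ω) n z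
      = derivCoeff r n z •
        pathProd (kernelSeq w g ω 0 0) (fun m => kernelSeq w g ω (m + 1)) n z := by
  have h := pathProd_smul (S := ℂ) (fun _ : Lattice d => 1)
    (fun m x y => -I * (((y - x) (r m) : ℤ) : ℂ)) (kernelSeq w g ω 0 0)
    (fun m => kernelSeq w g ω (m + 1)) n z
  rw [one_mul] at h
  rw [derivCoeff, ← h, kernelSeq_zero_zero]
  simp only [one_smul, kernelSeq, ← covKernel_symbolDeriv_eq_smul]

variable {g : ℕ → Symbol Ω d N} {C A l : ℝ}

theorem IsUniformlyLocalized.ae_hasSum_derivProd (hg : IsUniformlyLocalized P w g C A l)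
    (r : ℕ → Fin d) (n : ℕ) : ∀ᵐ ω ∂P,
    HasSum (fun p : Fin n → Lattice d => derivCoeff r n (Fin.snoc p 0 : Fin (n + 1) → Lattice d) •
      loopProd (kernelSeq w g ω) n (Fin.snoc p 0))
      ((List.ofFn fun i : Fin n => symbolDeriv (r i) (g (i + 1))).foldl (symbolMul w) (g 0) ω 0) := by
  let a : ℕ → Symbol Ω d N := Nat.rec (g 0) fun m b => symbolMul w b (symbolDeriv (r m) (g (m + 1)))
  filter_upwards [hg.ae_summable_pathWeight_mul_prod] with ω hω
  have ha : (List.ofFn fun i : Fin n => symbolDeriv (r i) (g (i + 1))).foldl (symbolMul w) (g 0)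
      = a n := foldl_ofFn (symbolMul w) (fun m => symbolDeriv (r m) (g (m + 1))) a (fun m => rfl) n
  rw [ha]
  have h := hasSum_pathProd (a := fun m => a m ω)
    (K := fun m => covKernel w (symbolDeriv (r m) (g (m + 1))) ω) (N := n)
    (fun m _ y => symbolMul_eq_tsum_covKernel _ _ _ _) (fun k _ => ?_) n le_rfl 0
  · refine h.congr_fun fun p => ?_
    change _ = pathProd (g 0 ω) _ n _
    rw [pathProd_symbolDeriv, loopProd, Fin.snoc_last]
  · change Summable fun z => ‖pathProd (g 0 ω) _ k z‖
    refine Summable.of_nonneg_of_le (fun _ => norm_nonneg _) (fun z => ?_) (hω 0 k)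
    rw [pathProd_symbolDeriv, norm_smul, mul_comm]
    exact mul_le_mul (norm_pathProd_le _ _ _ _) (norm_derivCoeff_le r k z) (norm_nonneg _)
      (pathWeight_nonneg _ _ _ _)

theorem IsUniformlyLocalized.summable_derivCoeff_mul (hg : IsUniformlyLocalized P w g C A l)
    (r : ℕ → Fin d) (n : ℕ) :
    Summable fun p : Fin n → Lattice d => ∫ ω, ‖derivCoeff r n (Fin.snoc p 0) *
      (loopProd (kernelSeq w g ω) n (Fin.snoc p 0)).trace‖ ∂P := by
  obtain ⟨T, hT, hTk⟩ := exists_norm_trace_le (Fin N)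
  obtain ⟨K, l', hK, hl', h⟩ := hg.integral_pathWeight_le n
  have h1 : Summable fun p : Fin n → Lattice d => T * K *
      (pathExp l' n 0 (Fin.snoc p 0 : Fin (n + 1) → Lattice d) *
        ∏ i : Fin n, (1 + ‖(Fin.snoc p 0 : Fin (n + 1) → Lattice d) i.succ
          - (Fin.snoc p 0 : Fin (n + 1) → Lattice d) i.castSucc‖)) :=
    ((summable_pathExp_mul_prod hl' n 0).mul_left (T * K)).comp_injective
      (i := fun p : Fin n → Lattice d => (Fin.snoc p 0 : Fin (n + 1) → Lattice d))
      fun p q hpq => by simpa only [Fin.init_snoc] using congrArg Fin.init hpq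
  refine Summable.of_nonneg_of_le (fun _ => integral_nonneg fun _ => norm_nonneg _) (fun p => ?_) h1
  set z : Fin (n + 1) → Lattice d := Fin.snoc p 0 with hz
  have hz0 : z (Fin.last n) = 0 := Fin.snoc_last _ _
  have h2 : ∫ ω, ‖(loopProd (kernelSeq w g ω) n z).trace‖ ∂P ≤ T * (K * pathExp l' n 0 z) := by
    refine (integral_mono (hg.integrable_trace_loopProd n z).norm ((h 0 z).1.const_mul T)
      fun ω => ?_).trans ?_
    · have := hg.norm_trace_loopProd_le hT hTk ω n z
      rwa [hz0] at this
    · rw [integral_const_mul]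
      exact mul_le_mul_of_nonneg_left (h 0 z).2 hT
  simp only [norm_mul]
  rw [integral_const_mul]
  calc _ ≤ (∏ i : Fin n, (1 + ‖z i.succ - z i.castSucc‖)) * (T * (K * pathExp l' n 0 z)) :=
        mul_le_mul (norm_derivCoeff_le r n z) h2 (integral_nonneg fun _ => norm_nonneg _)
          (by positivity)
    _ = _ := by ring

/-- The expansion over paths of the trace per unit volume of `g_0 ∂_{r_0} g_1 ⋯ ∂_{r_{n-1}} g_n`. -/
theorem IsUniformlyLocalized.hasSum_traceVol (hg : IsUniformlyLocalized P w g C A l)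
    (r : ℕ → Fin d) (n : ℕ) {f : Symbol Ω d N}
    (hf : f = (List.ofFn fun i : Fin n => symbolDeriv (r i) (g (i + 1))).foldl
      (symbolMul w) (g 0)) :
    Integrable (fun ω => (f ω 0).trace) P ∧
    HasSum (fun p : Fin n → Lattice d => derivCoeff r n (Fin.snoc p 0 : Fin (n + 1) → Lattice d) *
      ∫ ω, (loopProd (kernelSeq w g ω) n (Fin.snoc p 0)).trace ∂P) (traceVol P f) := by
  have h1 : ∀ᵐ ω ∂P, ∑' p : Fin n → Lattice d,
      derivCoeff r n (Fin.snoc p 0 : Fin (n + 1) → Lattice d) *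
        (loopProd (kernelSeq w g ω) n (Fin.snoc p 0)).trace = (f ω 0).trace := by
    filter_upwards [hg.ae_hasSum_derivProd r n] with ω hω
    have hc : Continuous fun M : Matrix (Fin N) (Fin N) ℂ => M.trace := by fun_prop
    have := (hω.map (Matrix.traceAddMonoidHom (Fin N) ℂ) hc).tsum_eq
    rw [← hf] at this
    simpa [Function.comp_def, Matrix.trace_smul] using this
  have h2 : ∀ p : Fin n → Lattice d, Integrable (fun ω => derivCoeff r n (Fin.snoc p 0) *
      (loopProd (kernelSeq w g ω) n (Fin.snoc p 0)).trace) P := fun p =>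
    (hg.integrable_trace_loopProd n _).const_mul _
  have h3 := hg.summable_derivCoeff_mul r n
  refine ⟨(integrable_tsum_of_summable_integral_norm h2 h3).congr h1, ?_⟩
  have h4 := hasSum_integral_of_summable_integral_norm h2 h3
  rw [integral_congr_ae h1] at h4
  simp only [integral_const_mul] at h4
  exact h4

end Derivations

/-! ### Exchange of sums and integrals, and the local formula -/

section LocalFormula

set_option linter.unusedSectionVars false

open scoped Matrix.Norms.L2Operator

variable {Ω : Type*} {d N : ℕ} [AddAction (Lattice d) Ω] [MeasurableSpace Ω]
  [MeasurableConstVAdd (Lattice d) Ω] {P : Measure Ω} [IsProbabilityMeasure P]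
  [VAddInvariantMeasure (Lattice d) Ω P] {w : Lattice d →ₗ[ℤ] Lattice d →ₗ[ℤ] ℝ}
  {σ : Fin d → Matrix (CliffIdx d) (CliffIdx d) ℂ} {g : ℕ → Symbol Ω d N} {C A l : ℝ}

theorem topForm_eq_formOp {f : Fin (d + 1) → Symbol Ω d N} (hgf : ∀ i : Fin (d + 1), g i = f i)
    (x₀ : Fin d → ℝ) (ω : Ω) : topForm w σ f x₀ ω = formOp σ (kernelSeq w g ω) x₀ := by
  have h : ∀ i : Fin d, g (i + 1) = f i.succ := fun i => hgf i.succ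
  have h0 : g 0 = f 0 := hgf 0
  simp only [topForm, formOp, kernelSeq, h, h0]
  rfl

theorem ae_restrict_forall_shiftVec_ne_zero (hd : Odd d) :
    ∀ᵐ x₀ ∂(volume.restrict (Set.Icc (0 : Fin d → ℝ) 1)),
      x₀ ∈ Set.Icc (0 : Fin d → ℝ) 1 ∧ ∀ x : Lattice d, shiftVec x₀ x ≠ 0 :=
  (ae_restrict_mem measurableSet_Icc).and (ae_restrict_of_ae (ae_forall_shiftVec_ne_zero hd))

namespace IsUniformlyLocalized

variable (hg : IsUniformlyLocalized P w g C A l)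

include hg

theorem ae_isTraceClass (hσ : IsCliffordRep σ) (hd : Odd d) :
    ∀ᵐ q ∂(volume.restrict (Set.Icc (0 : Fin d → ℝ) 1)).prod P,
      IsTraceClass (diracPhase N σ q.1 *
        qDiff (diracPhase N σ q.1) d (formOp σ (kernelSeq w g q.2) q.1)) := by
  filter_upwards [Measure.quasiMeasurePreserving_fst.ae (ae_restrict_forall_shiftVec_ne_zero hd),
    Measure.quasiMeasurePreserving_snd.ae hg.bounded,
    Measure.quasiMeasurePreserving_snd.ae hg.ae_summable_pathWeight,
    Measure.quasiMeasurePreserving_snd.ae hg.ae_summable_pathWeight_mul_pathStepWeight]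
    with q h1 h2 h3 h4
  exact isTraceClass_of_summable_norm (summable_norm_apply_ket hσ hd
    (fun m => (h2 m).imp fun _ h => h.1) h1.1 h1.2 (fun x n _ => h3 x n) h4)

theorem ae_gradedTrace_eq (hσ : IsCliffordRep σ) (hd : Odd d) :
    ∀ᵐ q ∂(volume.restrict (Set.Icc (0 : Fin d → ℝ) 1)).prod P,
      ∑' z : Fin (d + 1) → Lattice d, cliffConst d * (loopDet q.1 z : ℂ) *
          (loopProd (kernelSeq w g q.2) d z).trace
        = gradedTrace (diracPhase N σ q.1) (formOp σ (kernelSeq w g q.2) q.1) := by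
  filter_upwards [Measure.quasiMeasurePreserving_fst.ae (ae_restrict_forall_shiftVec_ne_zero hd),
    Measure.quasiMeasurePreserving_snd.ae hg.bounded,
    Measure.quasiMeasurePreserving_snd.ae hg.ae_summable_pathWeight,
    Measure.quasiMeasurePreserving_snd.ae hg.ae_summable_pathWeight_mul_pathStepWeight]
    with q h1 h2 h3 h4
  rw [gradedTrace_formOp hσ hd (fun m => (h2 m).imp fun _ h => h.1) h1.1 h1.2
    (fun x n _ => h3 x n) h4]
  exact tsum_congr fun z => mul_comm _ _

theorem summable_integral_loopDet_mul (hσ : IsCliffordRep σ) (hd : Odd d) :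
    Summable fun z : Fin (d + 1) → Lattice d => ∫ q, ‖cliffConst d * (loopDet q.1 z : ℂ) *
      (loopProd (kernelSeq w g q.2) d z).trace‖
        ∂(volume.restrict (Set.Icc (0 : Fin d → ℝ) 1)).prod P := by
  obtain ⟨T, hT, hTk⟩ := exists_norm_trace_le (Fin N)
  obtain ⟨K, l', hK, hl', h⟩ := hg.integral_pathWeight_le d
  obtain ⟨B, hB, hBk⟩ := exists_abs_loopDet_le hσ hd
  have hinj : Function.Injective fun z : Fin (d + 1) → Lattice d => (z (Fin.last d), z) :=
    fun z z' h => congrArg Prod.snd h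
  refine Summable.of_nonneg_of_le (fun _ => integral_nonneg fun _ => norm_nonneg _) (fun z => ?_)
    ((hg.summable_integral_pathWeight_mul.comp_injective hinj).mul_left (‖cliffConst d‖ * B * T))
  simp only [norm_mul, Function.comp_apply]
  rw [integral_prod_mul (fun x₀ : Fin d → ℝ => ‖cliffConst d‖ * ‖(loopDet x₀ z : ℂ)‖)
    (fun ω => ‖(loopProd (kernelSeq w g ω) d z).trace‖), integral_const_mul]
  have h1 : ∫ x₀ in Set.Icc (0 : Fin d → ℝ) 1, ‖(loopDet x₀ z : ℂ)‖
      ≤ B * pathStepWeight d (z (Fin.last d)) z := by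
    have : IsFiniteMeasure (volume.restrict (Set.Icc (0 : Fin d → ℝ) 1)) :=
      isFiniteMeasure_restrict.mpr measure_Icc_lt_top.ne
    refine (integral_mono_of_nonneg (ae_of_all _ fun _ => norm_nonneg _) (integrable_const _)
      ?_).trans_eq (?_ : ∫ _ in Set.Icc (0 : Fin d → ℝ) 1, B * pathStepWeight d (z (Fin.last d)) z
        = _)
    · filter_upwards [ae_restrict_forall_shiftVec_ne_zero hd] with x₀ hx₀
      rw [norm_real, Real.norm_eq_abs]
      exact hBk x₀ hx₀.1 hx₀.2 z
    · simp [Measure.real, Real.volume_Icc_pi]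
  have h2 : ∫ ω, ‖(loopProd (kernelSeq w g ω) d z).trace‖ ∂P
      ≤ T * ∫ ω, pathWeight (kernelSeq w g ω) d (z (Fin.last d)) z ∂P := by
    rw [← integral_const_mul]
    exact integral_mono (hg.integrable_trace_loopProd d z).norm ((h _ z).1.const_mul T)
      fun ω => hg.norm_trace_loopProd_le hT hTk ω d z
  calc _ ≤ ‖cliffConst d‖ * (B * pathStepWeight d (z (Fin.last d)) z) *
        (T * ∫ ω, pathWeight (kernelSeq w g ω) d (z (Fin.last d)) z ∂P) := by
        refine mul_le_mul (mul_le_mul_of_nonneg_left h1 (norm_nonneg _)) h2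
          (integral_nonneg fun _ => norm_nonneg _) ?_
        exact mul_nonneg (norm_nonneg _) (mul_nonneg hB (pathStepWeight_nonneg _ _ _))
    _ = _ := by ring

/-- Joint measurability of the graded trace is inherited from the series over loops to which it is
almost everywhere equal; each term there is a function of x₀ times a function of ω. -/
theorem hasSum_integral_gradedTrace (hσ : IsCliffordRep σ) (hd : Odd d) :
    Integrable (fun q : (Fin d → ℝ) × Ω => gradedTrace (diracPhase N σ q.1)
      (formOp σ (kernelSeq w g q.2) q.1)) ((volume.restrict (Set.Icc (0 : Fin d → ℝ) 1)).prod P) ∧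
    HasSum (fun z : Fin (d + 1) → Lattice d => cliffConst d *
        ((∫ x₀ in Set.Icc (0 : Fin d → ℝ) 1, loopDet x₀ z : ℝ) : ℂ) *
        ∫ ω, (loopProd (kernelSeq w g ω) d z).trace ∂P)
      (∫ x₀ in Set.Icc (0 : Fin d → ℝ) 1, ∫ ω, gradedTrace (diracPhase N σ x₀)
        (formOp σ (kernelSeq w g ω) x₀) ∂P) := by
  have h1 := hg.ae_gradedTrace_eq (σ := σ) hσ hd
  have h2 := hg.summable_integral_loopDet_mul hσ hd
  have h3 : ∀ z : Fin (d + 1) → Lattice d, Integrable (fun q : (Fin d → ℝ) × Ω =>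
      cliffConst d * (loopDet q.1 z : ℂ) * (loopProd (kernelSeq w g q.2) d z).trace)
      ((volume.restrict (Set.Icc (0 : Fin d → ℝ) 1)).prod P) := fun z =>
    (((integrable_loopDet hσ hd z).restrict.ofReal (𝕜 := ℂ)).const_mul (cliffConst d)).mul_prod
      (hg.integrable_trace_loopProd d z)
  have h4 := (integrable_tsum_of_summable_integral_norm h3 h2).congr h1
  refine ⟨h4, ?_⟩
  have h5 := hasSum_integral_of_summable_integral_norm h3 h2
  rw [integral_congr_ae h1, integral_prod _ h4] at h5
  refine h5.congr_fun fun z => ?_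
  rw [integral_prod_mul (fun x₀ : Fin d → ℝ => cliffConst d * (loopDet x₀ z : ℂ))
    (fun ω => (loopProd (kernelSeq w g ω) d z).trace), integral_const_mul, integral_complex_ofReal]

end IsUniformlyLocalized

/-- A loop is given by its last point and the positions of the other points relative to it. -/
def loopEquiv (L : Type*) [AddGroup L] (n : ℕ) : (Fin n → L) × L ≃ (Fin (n + 1) → L) where
  toFun q i := (Fin.snoc q.1 0 : Fin (n + 1) → L) i + q.2
  invFun z := (fun i => z i.castSucc - z (Fin.last n), z (Fin.last n))
  left_inv q := by
    ext i
    · simp [Fin.snoc_castSucc, Fin.snoc_last]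
    · simp [Fin.snoc_last]
  right_inv z := by
    funext i
    refine Fin.lastCases ?_ (fun i => ?_) i
    · simp [Fin.snoc_last]
    · simp [Fin.snoc_castSucc]

/-- Loops are grouped by their shape relative to the last point. The expectation of the loop product
depends on the shape only, so the sum over positions acts on the determinant alone. -/
theorem IsUniformlyLocalized.hasSum_loop (hg : IsUniformlyLocalized P w g C A l)
    (hw : ∀ x y, w x y = -w y x) (hσ : IsCliffordRep σ) (hd : Odd d) :
    HasSum (fun p : Fin d → Lattice d => cliffConst d *
        ((volume.real (Metric.ball (0 : Euc d) 1) * stdDet d fun i =>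
          shiftVec 0 ((Fin.snoc p 0 : Fin (d + 1) → Lattice d) i.castSucc)
            - shiftVec 0 ((Fin.snoc p 0 : Fin (d + 1) → Lattice d) i.succ) : ℝ) : ℂ) *
        ∫ ω, (loopProd (kernelSeq w g ω) d (Fin.snoc p 0)).trace ∂P)
      (∫ x₀ in Set.Icc (0 : Fin d → ℝ) 1, ∫ ω, gradedTrace (diracPhase N σ x₀)
        (formOp σ (kernelSeq w g ω) x₀) ∂P) := by
  have h := (loopEquiv (Lattice d) d).hasSum_iff.mpr (hg.hasSum_integral_gradedTrace hσ hd).2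
  refine h.prod_fiberwise fun p => ?_
  have h1 := ((hasSum_ofReal.mpr
    (hasSum_integral_loopDet_add hσ hd (Fin.snoc p 0 : Fin (d + 1) → Lattice d))).mul_left
    (cliffConst d)).mul_right (∫ ω, (loopProd (kernelSeq w g ω) d (Fin.snoc p 0)).trace ∂P)
  refine h1.congr_fun fun x => ?_
  simp only [Function.comp_apply, loopEquiv, Equiv.coe_fn_mk]
  rw [integral_trace_loopProd_add hw]

theorem cocycle_eq {f : Fin (d + 1) → Symbol Ω d N} (hgf : ∀ i : Fin (d + 1), g i = f i)
    (hg : IsUniformlyLocalized P w g C A l) (hw : ∀ x y, w x y = -w y x) (hσ : IsCliffordRep σ)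
    (hd : Odd d) :
    (∀ ρ : Equiv.Perm (Fin d), Integrable (fun ω => (derivProd w f ρ ω 0).trace) P) ∧
    cocycle P w σ f = LambdaConst d * ∑ ρ : Equiv.Perm (Fin d),
      ((Equiv.Perm.sign ρ : ℤ) : ℂ) * traceVol P (derivProd w f ρ) := by
  -- Reduction modulo d extends ρ to a sequence; only the indices below d enter.
  let r : Equiv.Perm (Fin d) → ℕ → Fin d := fun ρ m => ρ ⟨m % d, Nat.mod_lt _ hd.pos⟩
  have hr : ∀ ρ (i : Fin d), r ρ i = ρ i := fun ρ i => by
    simp [r, Nat.mod_eq_of_lt i.isLt]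
  have h1 : ∀ ρ, derivProd w f ρ = (List.ofFn fun i : Fin d =>
      symbolDeriv (r ρ i) (g (i + 1))).foldl (symbolMul w) (g 0) := fun ρ => by
    have h : ∀ i : Fin d, g (i + 1) = f i.succ := fun i => hgf i.succ
    have h0 : g 0 = f 0 := hgf 0
    simp only [derivProd, hr, h, h0]
  have h2 := fun ρ => hg.hasSum_traceVol (r ρ) d (h1 ρ)
  refine ⟨fun ρ => (h2 ρ).1, ?_⟩
  have h3 := (hasSum_sum (s := Finset.univ) fun ρ (_ : ρ ∈ Finset.univ) =>
    (h2 ρ).2.mul_left ((Equiv.Perm.sign ρ : ℤ) : ℂ)).mul_left (LambdaConst d)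
  have h4 := (hg.hasSum_loop hw hσ hd).mul_left (lambdaConst d)
  rw [cocycle]
  simp only [topForm_eq_formOp hgf]
  refine h4.unique (h3.congr_fun fun p => ?_)
  have h5 := sum_sign_mul_prod (Fin.snoc p 0 : Fin (d + 1) → Lattice d)
  simp only [derivCoeff, hr, ← mul_assoc, ← Finset.sum_mul]
  rw [h5, ofReal_mul, ← mul_assoc, ← mul_assoc, lambdaConst_mul_eq hd]

end LocalFormula

end OddChern

theorem mainTheorem2 {d N : ℕ} (hd : Odd d)
    {Ω : Type*} [TopologicalSpace Ω] [CompactSpace Ω] [MeasurableSpace Ω] [BorelSpace Ω]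
    [AddAction (OddChern.Lattice d) Ω] [ContinuousConstVAdd (OddChern.Lattice d) Ω]
    (P : Measure Ω) [IsProbabilityMeasure P] [ErgodicVAdd (OddChern.Lattice d) Ω P]
    (w : OddChern.Lattice d →ₗ[ℤ] OddChern.Lattice d →ₗ[ℤ] ℝ) (hw : ∀ x y, w x y = -w y x)
    (σ : Fin d → Matrix (OddChern.CliffIdx d) (OddChern.CliffIdx d) ℂ)
    (hσ : OddChern.IsCliffordRep σ)
    (f : Fin (d + 1) → OddChern.Symbol Ω d N) (hf : ∀ i, OddChern.IsLocalized P w (f i)) :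
    -- both sides are well defined
    (∀ᵐ q ∂(volume.restrict (Set.Icc (0 : Fin d → ℝ) 1)).prod P,
      OddChern.IsTraceClass (OddChern.diracPhase N σ q.1 *
        OddChern.qDiff (OddChern.diracPhase N σ q.1) d (OddChern.topForm w σ f q.1 q.2))) ∧
    Integrable (fun q : (Fin d → ℝ) × Ω =>
        OddChern.gradedTrace (OddChern.diracPhase N σ q.1) (OddChern.topForm w σ f q.1 q.2))
      ((volume.restrict (Set.Icc (0 : Fin d → ℝ) 1)).prod P) ∧
    (∀ ρ : Equiv.Perm (Fin d),
      Integrable (fun ω => (OddChern.derivProd w f ρ ω 0).trace) P) ∧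
    -- the local formula
    OddChern.cocycle P w σ f
      = OddChern.LambdaConst d * ∑ ρ : Equiv.Perm (Fin d), ((Equiv.Perm.sign ρ : ℤ) : ℂ) *
          OddChern.traceVol P (OddChern.derivProd w f ρ) := by
  obtain ⟨g, C, A, l, hgf, hg⟩ := OddChern.exists_isUniformlyLocalized hf
  refine ⟨?_, ?_, OddChern.cocycle_eq hgf hg hw hσ hd⟩
  · simpa only [OddChern.topForm_eq_formOp hgf] using hg.ae_isTraceClass hσ hd
  · simpa only [OddChern.topForm_eq_formOp hgf] using (hg.hasSum_integral_gradedTrace hσ hd).1
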